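/- **Notation.** Let $\mathbb T=\mathbb R/\mathbb Z$, identified with $[0,1)$, let $\mathcal D$ be the set of dyadic intervals $[m2^{-j},(m+1)2^{-j})$, $j\ge 0$, $0\le m<2^j$, and let $\mathcal R=\{I\times J: I,J\in\mathcal D\}$. For $I\in\mathcal D$ with left and right halves $I^-,I^+$ let $h_I=|I|^{-1/2}(\chi_{I^+}-\chi_{I^-})$, and for $R=I\times J$ let $h_R=h_I\otimes h_J$. All functions are real- or complex-valued. For $f\in L^2(\mathbb T^2)$ write $f_R=f_{I\times J}=\int f\,h_R$, $f_J(s)=\int_{\mathbb T} f(s,t)h_J(t)\,dt$, $f_I(t)=\int_{\mathbb T} f(s,t)h_I(s)\,ds$, and $m_I$, $m_J$ for means over $I$ (in the first variable) and over $J$ (in the second variable). Let $L^2_0(\mathbb T^2)$ be the space of $f\in L^2(\mathbb T^2)$ with $\int_{\mathbb T} f(s,t)\,dt=0$ for a.e. $s$ and $\int_{\mathbb T} f(s,t)\,ds=0$ for a.e. $t$. For $b\in L^2(\mathbb T^2)$ put $$\|b\|_{\mathrm{BMO}^d}=\sup_{\Omega}\Big(\frac1{|\Omega|}\sum_{R\in\mathcal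 R,\ R\subseteq\Omega}|b_R|^2\Big)^{1/2},$$ the supremum being over all non-empty open $\Omega\subseteq\mathbb T^2$, and let $\mathrm{BMO}^d(\mathbb T^2)=\{b\in L^2_0(\mathbb T^2):\|b\|_{\mathrm{BMO}^d}<\infty\}$. The paraproducts below take values in $L^2(\mathbb T^2)$ but not in $L^2_0(\mathbb T^2)$, so their values are measured in the extension of this norm to $L^2(\mathbb T^2)$ given by the completed Haar system $\mathcal H=\{u\otimes v: u,v\in\{1\}\cup\{h_I:I\in\mathcal D\}\}$, which is an orthonormal basis of $L^2(\mathbb T^2)$: $$\|g\|_{*}=\sup_{\Omega}\Big(\frac1{|\Omega|}\sum_{w\in\mathcal H,\ R_w\subseteq\Omega}|\langle g,w\rangle|^2\Big)^{1/2},$$ where $R_w$ is the supporting rectangle of $w$ (that is $I\times J$, $\mathbb T\times J$, $I\times\mathbb T$, $\mathbb T\times\mathbb T$ for $w=h_I\otimes h_J$, $1\otimes h_J$, $h_I\otimes 1$, $1\otimes 1$). One has $\|g\|_{\mathrm{BMO}^d}\le\|g\|_*$, with equality for $g\in L^2_0(\mathbb T^2)$. For $\phi\in L^2(\mathbb T^2)$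 consider the operators, given by series that are to converge unconditionally in $L^2(\mathbb T^2)$, $$\Delta_\phi f=\sum_{R\in\mathcal R}\frac{\chi_R}{|R|}\,\phi_R f_R,$$ $$\Pi^{(0,1)}(\phi,f)=\sum_{I\times J\in\mathcal R}h_I(s)\frac{\chi_J(t)}{|J|}\,\phi_{I\times J}\,m_If_J,\qquad \Pi^{(1,0)}(\phi,f)=\sum_{I\times J\in\mathcal R}\frac{\chi_I(s)}{|I|}h_J(t)\,\phi_{I\times J}\,m_Jf_I .$$ Such an operator $T$ is called *bounded on* $\mathrm{BMO}^d(\mathbb T^2)$ if there is $M<\infty$ such that for every $f\in\mathrm{BMO}^d(\mathbb T^2)$ the series converges and $\|Tf\|_{*}\le M\|f\|_{\mathrm{BMO}^d}$; the infimum of such $M$ is $\|T\|_{\mathrm{BMO}^d\to\mathrm{BMO}^d}$ ($=\infty$ if there is none). For $i,j\ge0$ let $Q^{(1)}_i\phi=\sum_{|I|\le2^{-i}}\phi_{I\times J}h_{I\times J}$ and $Q^{(2)}_j\phi=\sum_{|J|\le2^{-j}}\phi_{I\times J}h_{I\times J}$. Say that $\phi\in\mathrm{LMO}^d_1(\mathbb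 T^2)$ if there is $C>0$ with $\|Q^{(1)}_i\phi\|_{\mathrm{BMO}^d}\le C/(i+1)$ for all $i\ge 0$, and $\phi\in\mathrm{LMO}^d_2(\mathbb T^2)$ if there is $C>0$ with $\|Q^{(2)}_j\phi\|_{\mathrm{BMO}^d}\le C/(j+1)$ for all $j\ge 0$; the infima of such $C$ are $\|\phi\|_{\mathrm{LMO}^d_1}$ and $\|\phi\|_{\mathrm{LMO}^d_2}$. **Theorem.** There are absolute constants $0<c,C<\infty$ such that for every $\phi\in L^2(\mathbb T^2)$: 1. $\Delta_\phi$ is bounded on $\mathrm{BMO}^d(\mathbb T^2)$ if and only if $\|\phi\|_{\mathrm{BMO}^d}<\infty$; moreover $c\,\|\phi\|_{\mathrm{BMO}^d}\le\|\Delta_\phi\|_{\mathrm{BMO}^d\to\mathrm{BMO}^d}\le C\,\|\phi\|_{\mathrm{BMO}^d}$. 2. If $\phi\in\mathrm{LMO}^d_1(\mathbb T^2)$, then $\Pi^{(0,1)}(\phi,\cdot)$ is bounded on $\mathrm{BMO}^d(\mathbb T^2)$, and $\|\Pi^{(0,1)}(\phi,\cdot)\|_{\mathrm{BMO}^d\to\mathrm{BMO}^d}\le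 C\,\|\phi\|_{\mathrm{LMO}^d_1}$. 3. If $\phi\in\mathrm{LMO}^d_2(\mathbb T^2)$, then $\Pi^{(1,0)}(\phi,\cdot)$ is bounded on $\mathrm{BMO}^d(\mathbb T^2)$, and $\|\Pi^{(1,0)}(\phi,\cdot)\|_{\mathrm{BMO}^d\to\mathrm{BMO}^d}\le C\,\|\phi\|_{\mathrm{LMO}^d_2}$. -/

import Mathlib

open MeasureTheory
open scoped ENNReal NNReal

noncomputable section

namespace BidiscBMO

/-- The circle `𝕋 = ℝ/ℤ`, of total mass one. -/
abbrev T : Type := UnitAddCircle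

/-- The bidisc torus `𝕋²` (with product measure `volume`). -/
abbrev T2 : Type := T × T

/-- The representative of a point of `𝕋` in `[0,1)`. -/
def rep (x : T) : ℝ := (AddCircle.equivIco (1 : ℝ) 0 x : ℝ)

lemma measurable_rep : Measurable rep :=
  measurable_subtype_coe.comp (AddCircle.measurableEquivIco (1 : ℝ) 0).measurable

/-- The subset of `𝕋` that is identified with `[a,b) ∩ [0,1)`. -/
def arc (a b : ℝ) : Set T := rep ⁻¹' Set.Ico a b

lemma measurableSet_arc (a b : ℝ) : MeasurableSet (arc a b) :=
  measurable_rep measurableSet_Ico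

/-- Dyadic intervals: `⟨j, m⟩`, `0 ≤ m < 2 ^ j`, stands for `[m / 2 ^ j, (m + 1) / 2 ^ j)`. -/
abbrev DyadicInt : Type := Σ j : ℕ, Fin (2 ^ j)

namespace DyadicInt

/-- The length `|I| = 2 ^ (-j)`. -/
def len (I : DyadicInt) : ℝ := (2 ^ I.1 : ℝ)⁻¹

/-- The left end point `m / 2 ^ j`. -/
def left (I : DyadicInt) : ℝ := (I.2 : ℕ) * len I

/-- The dyadic interval as a subset of `𝕋`. -/
def set (I : DyadicInt) : Set T := arc (left I) (left I + len I)

/-- The left half `I⁻`. -/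
def leftHalf (I : DyadicInt) : Set T := arc (left I) (left I + len I / 2)

/-- The right half `I⁺`. -/
def rightHalf (I : DyadicInt) : Set T := arc (left I + len I / 2) (left I + len I)

end DyadicInt

/-- The Haar function `h_I = |I|^{-1/2} (χ_{I⁺} - χ_{I⁻})`. -/
def haar (I : DyadicInt) (x : T) : ℝ :=
  (Real.sqrt I.len)⁻¹ * (I.rightHalf.indicator 1 x - I.leftHalf.indicator 1 x)

/-- `h_I^0 = h_I` and `h_I^1 = |I|^{-1/2} |h_I|` (which is `χ_I / |I|`). -/
def haarE (ε : Fin 2) (I : DyadicInt) (x : T) : ℝ :=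
  if ε = 0 then haar I x else (Real.sqrt I.len)⁻¹ * |haar I x|

/-- The one-variable Haar system completed by the constant function `1` (index `none`). -/
def haarC : Option DyadicInt → T → ℝ
  | none => fun _ => 1
  | some I => haar I

/-- The supporting interval of a function of the completed Haar system. -/
def suppC : Option DyadicInt → Set T
  | none => Set.univ
  | some I => I.set

lemma measurable_haar (I : DyadicInt) : Measurable (haar I) := by
  have h1 : Measurable (I.rightHalf.indicator (1 : T → ℝ)) :=
    measurable_one.indicator (measurableSet_arc _ _)
  have h2 : Measurable (I.leftHalf.indicator (1 : T → ℝ)) :=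
    measurable_one.indicator (measurableSet_arc _ _)
  exact (h1.sub h2).const_mul _

lemma abs_haar_le (I : DyadicInt) (x : T) : |haar I x| ≤ (Real.sqrt I.len)⁻¹ * 2 := by
  unfold haar
  rw [abs_mul, abs_of_nonneg (inv_nonneg.2 (Real.sqrt_nonneg _))]
  refine mul_le_mul_of_nonneg_left ?_ (inv_nonneg.2 (Real.sqrt_nonneg _))
  have h (s : Set T) : 0 ≤ s.indicator (1 : T → ℝ) x ∧ s.indicator (1 : T → ℝ) x ≤ 1 := by
    by_cases hx : x ∈ s <;> simp [hx]
  have h1 := h I.rightHalf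
  have h2 := h I.leftHalf
  rw [abs_le]
  constructor <;> linarith [h1.1, h1.2, h2.1, h2.2]

lemma measurable_haarE (ε : Fin 2) (I : DyadicInt) : Measurable (haarE ε I) := by
  unfold haarE
  split_ifs
  · exact measurable_haar I
  · exact (measurable_haar I).abs.const_mul _

lemma exists_haarE_le (ε : Fin 2) (I : DyadicInt) : ∃ K : ℝ, ∀ x, |haarE ε I x| ≤ K := by
  unfold haarE
  split_ifs
  · exact ⟨_, abs_haar_le I⟩
  · refine ⟨(Real.sqrt I.len)⁻¹ * ((Real.sqrt I.len)⁻¹ * 2), fun x => ?_⟩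
    rw [abs_mul, abs_abs, abs_of_nonneg (inv_nonneg.2 (Real.sqrt_nonneg _))]
    exact mul_le_mul_of_nonneg_left (abs_haar_le I x) (inv_nonneg.2 (Real.sqrt_nonneg _))

lemma measurable_haarC (a : Option DyadicInt) : Measurable (haarC a) := by
  cases a with
  | none => exact measurable_const
  | some I => exact measurable_haar I

lemma exists_haarC_le (a : Option DyadicInt) : ∃ K : ℝ, ∀ x, |haarC a x| ≤ K := by
  cases a with
  | none => exact ⟨1, fun x => by simp [haarC]⟩
  | some I => exact ⟨_, abs_haar_le I⟩

/-- DyadicInt rectangles `R = I × J`. -/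
abbrev Rect : Type := DyadicInt × DyadicInt

/-- The dyadic rectangle as a subset of `𝕋²`. -/
def Rect.set (R : Rect) : Set T2 := R.1.set ×ˢ R.2.set

variable (𝕜 : Type*) [RCLike 𝕜]

/-- `L²(𝕋²)` with values in `𝕜`. -/
abbrev L2 : Type _ := Lp 𝕜 2 (volume : Measure T2)

variable {𝕜}

/-- The tensor product `(u ⊗ v)(s, t) = u(s) v(t)`, as a `𝕜`-valued function. -/
def tensor (𝕜 : Type*) [RCLike 𝕜] (u v : T → ℝ) (p : T2) : 𝕜 := ((u p.1 * v p.2 : ℝ) : 𝕜)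

lemma memLp_tensor {u v : T → ℝ} (hu : Measurable u) (hv : Measurable v)
    (bu : ∃ K : ℝ, ∀ x, |u x| ≤ K) (bv : ∃ K : ℝ, ∀ x, |v x| ≤ K) :
    MemLp (tensor 𝕜 u v) 2 (volume : Measure T2) := by
  obtain ⟨K, hK⟩ := bu
  obtain ⟨L, hL⟩ := bv
  have hm : Measurable (tensor 𝕜 u v) :=
    RCLike.measurable_ofReal.comp ((hu.comp measurable_fst).mul (hv.comp measurable_snd))
  refine MemLp.of_bound hm.aestronglyMeasurable (K * L) (Filter.Eventually.of_forall fun p => ?_)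
  rw [tensor, RCLike.norm_ofReal, abs_mul]
  exact mul_le_mul (hK _) (hL _) (abs_nonneg _) ((abs_nonneg _).trans (hK p.1))

/-- `h_R^ε = h_I^{ε₁} ⊗ h_J^{ε₂}` for `R = I × J`, as an element of `L²(𝕋²)`. -/
def haarRect (𝕜 : Type*) [RCLike 𝕜] (ε : Fin 2 × Fin 2) (R : Rect) : L2 𝕜 :=
  (memLp_tensor (𝕜 := 𝕜) (measurable_haarE ε.1 R.1) (measurable_haarE ε.2 R.2)
    (exists_haarE_le _ _) (exists_haarE_le _ _)).toLp _

/-- The elements of the completed product Haar system, an orthonormal basis of all of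
`L²(𝕋²)`: `h_I ⊗ h_J`, `1 ⊗ h_J`, `h_I ⊗ 1` and `1 ⊗ 1`. -/
def haarRectC (𝕜 : Type*) [RCLike 𝕜] (a : Option DyadicInt × Option DyadicInt) : L2 𝕜 :=
  (memLp_tensor (𝕜 := 𝕜) (measurable_haarC a.1) (measurable_haarC a.2)
    (exists_haarC_le _) (exists_haarC_le _)).toLp _

/-- `⟨f, h_R^ε⟩`, linear in `f`. -/
def coef (ε : Fin 2 × Fin 2) (f : L2 𝕜) (R : Rect) : 𝕜 := inner 𝕜 (haarRect 𝕜 ε R) f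

/-- `L²₀(𝕋²)`: functions of mean zero in each variable separately. -/
def IsL20 (f : L2 𝕜) : Prop :=
  (∀ᵐ s : T, ∫ t : T, f (s, t) = 0) ∧ (∀ᵐ t : T, ∫ s : T, f (s, t) = 0)

/-- `‖b‖_{BMO^d} = sup_Ω (|Ω|⁻¹ ∑_{R ⊆ Ω} |b_R|²)^{1/2}`, over all open `Ω ⊆ 𝕋²`. The empty set
contributes `0`. -/
def bmoNorm (b : L2 𝕜) : ℝ≥0∞ :=
  ⨆ (Ω : Set T2) (_ : IsOpen Ω),
    ((volume Ω)⁻¹ * ∑' R : {R : Rect // R.set ⊆ Ω}, ‖coef (0, 0) b R.1‖ₑ ^ 2) ^ (1 / 2 : ℝ)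

/-- The extension of the `BMO^d` norm from `L²₀(𝕋²)` to `L²(𝕋²)`: the functions `1 ⊗ h_J`,
`h_I ⊗ 1`, `1 ⊗ 1`, which are orthogonal to `L²₀(𝕋²)`, are added to the Haar functions, with
supporting rectangles `𝕋 × J`, `I × 𝕋`, `𝕋 × 𝕋`. On `L²₀(𝕋²)` it equals `bmoNorm`, and it is never
smaller than `bmoNorm`. It is needed because the paraproducts do not map into `L²₀(𝕋²)`. -/
def bmoNormExt (g : L2 𝕜) : ℝ≥0∞ :=
  ⨆ (Ω : Set T2) (_ : IsOpen Ω),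
    ((volume Ω)⁻¹ * ∑' a : {a : Option DyadicInt × Option DyadicInt // suppC a.1 ×ˢ suppC a.2 ⊆ Ω},
      ‖(inner 𝕜 (haarRectC 𝕜 a.1) g : 𝕜)‖ₑ ^ 2) ^ (1 / 2 : ℝ)

/-- The martingale difference `Δ_k f = ∑_{R ∈ 𝓡_k} ⟨f, h_R⟩ h_R`. -/
def delta (k : ℕ × ℕ) (f : L2 𝕜) : L2 𝕜 :=
  ∑ a : Fin (2 ^ k.1), ∑ b : Fin (2 ^ k.2),
    coef (0, 0) f (⟨k.1, a⟩, ⟨k.2, b⟩) • haarRect 𝕜 (0, 0) (⟨k.1, a⟩, ⟨k.2, b⟩)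

/-- `Q^{(1)}_i f = ∑_{k₁ ≥ i} Δ_k f`, an orthogonal series in `L²(𝕋²)`. -/
def Q1 (i : ℕ) (f : L2 𝕜) : L2 𝕜 := ∑' k : {k : ℕ × ℕ // i ≤ k.1}, delta k.1 f

/-- `Q^{(2)}_j f = ∑_{k₂ ≥ j} Δ_k f`, an orthogonal series in `L²(𝕋²)`. -/
def Q2 (j : ℕ) (f : L2 𝕜) : L2 𝕜 := ∑' k : {k : ℕ × ℕ // j ≤ k.2}, delta k.1 f

/-- `φ ∈ LMO^d_1` (`φ` being in `L²`). -/
def MemLMO1 (φ : L2 𝕜) : Prop :=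
  ∃ C : ℝ≥0, 0 < C ∧ ∀ i : ℕ, bmoNorm (Q1 i φ) ≤ C * (1 / ((i : ℝ≥0∞) + 1))

/-- `φ ∈ LMO^d_2` (`φ` being in `L²`). -/
def MemLMO2 (φ : L2 𝕜) : Prop :=
  ∃ C : ℝ≥0, 0 < C ∧ ∀ j : ℕ, bmoNorm (Q2 j φ) ≤ C * (1 / ((j : ℝ≥0∞) + 1))

/-- `‖φ‖_{LMO^d_1}`, the infimum of the admissible constants. -/
def lmo1Norm (φ : L2 𝕜) : ℝ≥0∞ :=
  ⨅ (C : ℝ≥0) (_ : 0 < C ∧ ∀ i : ℕ, bmoNorm (Q1 i φ) ≤ C * (1 / ((i : ℝ≥0∞) + 1))), (C : ℝ≥0∞)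

/-- `‖φ‖_{LMO^d_2}`, the infimum of the admissible constants. -/
def lmo2Norm (φ : L2 𝕜) : ℝ≥0∞ :=
  ⨅ (C : ℝ≥0) (_ : 0 < C ∧ ∀ j : ℕ, bmoNorm (Q2 j φ) ≤ C * (1 / ((j : ℝ≥0∞) + 1))), (C : ℝ≥0∞)

/-- The term `φ_R ⟨f, h_R^{1-β}⟩ h_R^β` of the paraproduct `Π^β(φ, f)`. -/
def paraTerm (β : Fin 2 × Fin 2) (φ f : L2 𝕜) (R : Rect) : L2 𝕜 :=
  (coef (0, 0) φ R * coef (1 - β.1, 1 - β.2) f R) • haarRect 𝕜 β R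

/-- The paraproduct `Π^β(φ, f) = ∑_R φ_R ⟨f, h_R^{1-β}⟩ h_R^β`, an unconditional sum in `L²(𝕋²)`.
For `β = (1,1)` it is `Δ_φ f = ∑_R (χ_R / |R|) φ_R f_R`, for `β = (0,1)` it is
`∑_{I × J} h_I(s) (χ_J(t) / |J|) φ_{I × J} m_I f_J`, for `β = (1,0)` it is
`∑_{I × J} (χ_I(s) / |I|) h_J(t) φ_{I × J} m_J f_I`. -/
def paraproduct (β : Fin 2 × Fin 2) (φ f : L2 𝕜) : L2 𝕜 := ∑' R : Rect, paraTerm β φ f R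

/-- `M` is a bound for `Π^β(φ, ·)` on `BMO^d(𝕋²)`: for every `f` in `BMO^d(𝕋²)` the series of
`Π^β(φ, f)` converges and its sum has norm at most `M ‖f‖_{BMO^d}`. -/
def BoundedBy (β : Fin 2 × Fin 2) (φ : L2 𝕜) (M : ℝ≥0) : Prop :=
  ∀ f : L2 𝕜, IsL20 f → bmoNorm f < ⊤ →
    Summable (paraTerm β φ f) ∧ bmoNormExt (paraproduct β φ f) ≤ M * bmoNorm f

/-- `Π^β(φ, ·)` is bounded on `BMO^d(𝕋²)`. -/
def IsBoundedOnBMO (β : Fin 2 × Fin 2) (φ : L2 𝕜) : Prop := ∃ M : ℝ≥0, BoundedBy β φ M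

/-- The operator norm of `Π^β(φ, ·)` on `BMO^d(𝕋²)` (`⊤` if the operator is unbounded). -/
def paraNorm (β : Fin 2 × Fin 2) (φ : L2 𝕜) : ℝ≥0∞ :=
  ⨅ (M : ℝ≥0) (_ : BoundedBy β φ M), (M : ℝ≥0∞)

end BidiscBMO

end

noncomputable section

namespace BidiscBMO

section

/-! ### Geometry of dyadic intervals -/

/-! The supremum over open sets is replaced by the packing condition `Carleson`, tested on finite
unions of rectangles. Its main consequence is an H¹–BMO type duality, `Carleson.sq_sum_mul_le`: if
|φ_R|² packs with constant A, then (∑ φ_R c_R)² is at most 16 A times the squared integral of the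
square function of c. It rests on the Carleson embedding theorem and the strong dyadic maximal
theorem. On the output side, h_R^ε is a combination of completed Haar functions whose supports
contain R. Hence `summable_and_bmoNormExt_le` reduces every upper bound to an L² estimate: the
partial sum over a finite family 𝓖 must have squared norm O(|⋃ 𝓖|).

For `Δ_φ`, let G be the sum of |φ_R f_R| χ_R / |R| and Q = ∫ G². Then Q = ∑ |φ_R| |f_R| av_R G.
Duality together with the pointwise bound S(f_R av_R G) ≤ S(f_R) · MG gives Q² ≲ A (∑ |f_R|²) Q, and
Q is divided out (`lintegral_sq_sum_indicator_le`).

For the mixed paraproducts the coefficient m_I f_J may grow with the level of I, and the decay in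
LMO has to compensate. Fix 𝓖 and expand m_I f_J in the Haar functions of the ancestors K of I. If K
× J is at least half covered by rectangles of 𝓖 whose first side is no shorter than K, then it lies
where the maximal function of χ_{⋃ 𝓖} exceeds 1/2. These coefficients have total energy O(F² |⋃ 𝓖|),
and a bilinear form of the duality suffices (`Carleson.sq_sum_mul_av_mul_av_le`). Otherwise a fixed
proportion of J is covered only at later levels. These levels are cut into layers [16^m, 16^(m+1)),
and the square of the proportion `gam` is shared out: one factor goes with φ, where the layer forces
level at least 16^m and LMO yields 16^(-m) (`sum_layers_le`); the other goes with f, where the BMO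
growth over a block of levels is O(16^n) (`carleson_layers`). The two powers cancel and leave a
geometric series. This is `sum_lintegral_strip_sq_le`; the other mixed paraproduct follows by
exchanging the variables.

For the lower bound on `Δ_φ`, choose in a finite family a subfamily 𝓖 of largest packing ratio X,
put E = ⋃ 𝓖, and apply `Δ_φ` to the function with coefficients conj φ_R, R ∈ 𝓖. Extremality bounds
its norm by √X. The image F = ∑ |φ_R|² χ_R / |R| satisfies ∫_E F = X |E|, and ‖F‖₂² ≤ 256 X² |E| by
the upper estimate. Split the pairing of F with χ_E over the Haar system. Functions supported in an
enlargement of E of comparable measure are controlled by the BMO norm of F; on the others χ_E has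
energy at most 16δ|E| (`sum_sq_sliceCoef_le`). For small δ the second part is absorbed, and X ≲ M²
(`BoundedBy.packing_le`). -/

instance : IsProbabilityMeasure (volume : Measure T) := ⟨UnitAddCircle.measure_univ⟩

instance : IsProbabilityMeasure (volume : Measure T2) :=
  inferInstanceAs (IsProbabilityMeasure ((volume : Measure T).prod volume))

lemma rep_nonneg (x : T) : 0 ≤ rep x := by
  have := (AddCircle.equivIco (1 : ℝ) 0 x).2.1
  simpa [rep] using this

lemma rep_lt_one (x : T) : rep x < 1 := by
  have := (AddCircle.equivIco (1 : ℝ) 0 x).2.2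
  simpa [rep] using this

lemma rep_coe {a : ℝ} (h0 : 0 ≤ a) (h1 : a < 1) : rep (a : T) = a := by
  unfold rep
  rw [AddCircle.coe_equivIco_mk_apply]
  simp [Int.fract_eq_self.2 ⟨h0, h1⟩]

lemma volume_arc {a b : ℝ} (h0 : 0 ≤ a) (h1 : b ≤ 1) :
    volume (arc a b) = ENNReal.ofReal (b - a) := by
  have h := (UnitAddCircle.measurePreserving_mk 0).measure_preimage
    (measurableSet_arc a b).nullMeasurableSet
  rw [← h, zero_add, ← Measure.restrict_congr_set Ico_ae_eq_Ioc]
  rw [Measure.restrict_apply (AddCircle.measurable_mk' (measurableSet_arc a b)),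
    ← Real.volume_Ico]
  congr 1
  ext x
  simp only [Set.mem_inter_iff, Set.mem_preimage, arc, Set.mem_Ico]
  constructor
  · rintro ⟨h2, h3⟩
    rwa [rep_coe h3.1 h3.2] at h2
  · intro h2
    have h3 : 0 ≤ x ∧ x < 1 := ⟨h0.trans h2.1, h2.2.trans_le h1⟩
    exact ⟨by rwa [rep_coe h3.1 h3.2], h3⟩

/-- The dyadic interval of level `n` that contains `x`. -/
def ix (n : ℕ) (x : T) : DyadicInt :=
  ⟨n, ⟨⌊rep x * 2 ^ n⌋₊, by
    rw [Nat.floor_lt (mul_nonneg (rep_nonneg x) (by positivity))]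
    push_cast
    have := rep_lt_one x
    have h2 : (0 : ℝ) < 2 ^ n := by positivity
    nlinarith⟩⟩

@[simp] lemma ix_fst (n : ℕ) (x : T) : (ix n x).1 = n := rfl

lemma ix_eq_mk {n : ℕ} {x : T} {a : Fin (2 ^ n)} :
    ix n x = ⟨n, a⟩ ↔ ⌊rep x * 2 ^ n⌋₊ = (a : ℕ) := by
  simp [ix, Fin.ext_iff]

lemma ix_eq_ix {n : ℕ} {x y : T} :
    ix n x = ix n y ↔ ⌊rep x * 2 ^ n⌋₊ = ⌊rep y * 2 ^ n⌋₊ := by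
  simp [ix]

namespace DyadicInt

lemma len_pos (I : DyadicInt) : 0 < I.len := by unfold len; positivity

lemma mem_set_iff {I : DyadicInt} {x : T} : x ∈ I.set ↔ ix I.1 x = I := by
  obtain ⟨n, a⟩ := I
  rw [ix_eq_mk, Nat.floor_eq_iff (mul_nonneg (rep_nonneg x) (by positivity))]
  have h2 : (0 : ℝ) < 2 ^ n := by positivity
  simp only [set, arc, left, len, Set.mem_preimage, Set.mem_Ico]
  rw [← div_eq_mul_inv, div_le_iff₀ h2, show ((a : ℕ) : ℝ) / 2 ^ n + (2 ^ n)⁻¹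
    = ((a : ℕ) + 1) / 2 ^ n by field_simp, lt_div_iff₀ h2]

lemma mem_ix (n : ℕ) (x : T) : x ∈ (ix n x).set := mem_set_iff.2 rfl

lemma left_nonneg (I : DyadicInt) : 0 ≤ I.left :=
  mul_nonneg (Nat.cast_nonneg _) I.len_pos.le

lemma left_add_len (I : DyadicInt) : I.left + I.len ≤ 1 := by
  obtain ⟨n, a⟩ := I
  have h2 : (0 : ℝ) < 2 ^ n := by positivity
  have h3 : ((a : ℕ) : ℝ) + 1 ≤ 2 ^ n := by exact_mod_cast a.2
  simp only [left, len]
  rw [show ((a : ℕ) : ℝ) * (2 ^ n)⁻¹ + (2 ^ n)⁻¹ = ((a : ℕ) + 1) / 2 ^ n by field_simp,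
    div_le_one h2]
  exact h3

lemma measurableSet_set (I : DyadicInt) : MeasurableSet I.set := measurableSet_arc _ _

lemma volume_set (I : DyadicInt) : volume I.set = ENNReal.ofReal I.len := by
  rw [set, volume_arc I.left_nonneg I.left_add_len]
  congr 1
  ring

lemma volume_set_ne_zero (I : DyadicInt) : volume I.set ≠ 0 := by
  rw [volume_set]
  simpa using I.len_pos

/-- The left end point of a dyadic interval, as a point of the circle. -/
def pt (I : DyadicInt) : T := (I.left : ℝ)

lemma rep_pt (I : DyadicInt) : rep I.pt = I.left :=
  rep_coe I.left_nonneg (by linarith [I.left_add_len, I.len_pos])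

lemma pt_mem (I : DyadicInt) : I.pt ∈ I.set := by
  simp [set, arc, rep_pt, I.len_pos]

@[simp] lemma ix_pt (I : DyadicInt) : ix I.1 I.pt = I := mem_set_iff.1 I.pt_mem

end DyadicInt

open DyadicInt

/-- The position at level `k` is the integer quotient by `2 ^ (n - k)` of the position at level `n`.
All nestedness of dyadic intervals comes from here. -/
lemma ix_congr_le {k n : ℕ} (hkn : k ≤ n) {x y : T} (h : ix n x = ix n y) :
    ix k x = ix k y := by
  rw [ix_eq_ix] at h ⊢
  have key : ∀ z : T, ⌊rep z * 2 ^ k⌋₊ = ⌊rep z * 2 ^ n⌋₊ / 2 ^ (n - k) := by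
    intro z
    have h1 : rep z * 2 ^ k = (rep z * 2 ^ n) / ((2 ^ (n - k) : ℕ) : ℝ) := by
      have : (2 : ℝ) ^ n = 2 ^ k * 2 ^ (n - k) := by
        rw [← pow_add]; congr 1; omega
      push_cast
      rw [this]
      field_simp
    rw [h1, Nat.floor_div_natCast]
  rw [key, key, h]

lemma ix_eq_of_mem {k : ℕ} {I : DyadicInt} (hk : k ≤ I.1) {x y : T} (hx : x ∈ I.set)
    (hy : y ∈ I.set) : ix k x = ix k y :=
  ix_congr_le hk ((mem_set_iff.1 hx).trans (mem_set_iff.1 hy).symm)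

lemma set_subset_of_mem {I K : DyadicInt} (h : K.1 ≤ I.1) {x : T} (hI : x ∈ I.set)
    (hK : x ∈ K.set) : I.set ⊆ K.set := fun y hy => by
  rw [mem_set_iff] at hK ⊢
  rw [ix_eq_of_mem h hy hI, hK]

lemma set_subset_ix {I : DyadicInt} {k : ℕ} (h : k ≤ I.1) {x : T} (hx : x ∈ I.set) :
    I.set ⊆ (ix k x).set := set_subset_of_mem h hx (mem_ix k x)

namespace DyadicInt

/-- The left child. -/
def lo (I : DyadicInt) : DyadicInt :=
  ⟨I.1 + 1, ⟨2 * (I.2 : ℕ), by have := I.2.2; rw [pow_succ]; omega⟩⟩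

/-- The right child. -/
def hi (I : DyadicInt) : DyadicInt :=
  ⟨I.1 + 1, ⟨2 * (I.2 : ℕ) + 1, by have := I.2.2; rw [pow_succ]; omega⟩⟩

lemma len_lo (I : DyadicInt) : I.lo.len = I.len / 2 := by
  simp only [lo, len, pow_succ]; field_simp

lemma len_hi (I : DyadicInt) : I.hi.len = I.len / 2 := by
  simp only [hi, len, pow_succ]; field_simp

lemma leftHalf_eq (I : DyadicInt) : I.leftHalf = I.lo.set := by
  have h : I.lo.left = I.left := by
    simp only [left, len_lo]; simp only [lo]; push_cast; ring
  rw [leftHalf, set, h, len_lo]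

lemma rightHalf_eq (I : DyadicInt) : I.rightHalf = I.hi.set := by
  have h : I.hi.left = I.left + I.len / 2 := by
    simp only [left, len_hi]; simp only [hi]; push_cast; ring
  rw [rightHalf, set, h, len_hi]
  congr 1; ring

lemma lo_ne_hi (I : DyadicInt) : I.lo ≠ I.hi := by
  simp only [lo, hi, ne_eq, Sigma.mk.injEq, heq_eq_eq, Fin.mk.injEq, true_and]
  omega

lemma lo_subset (I : DyadicInt) : I.lo.set ⊆ I.set := by
  rw [← leftHalf_eq]
  intro x hx
  simp only [leftHalf, set, arc, Set.mem_preimage, Set.mem_Ico] at *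
  constructor <;> linarith [I.len_pos]

lemma hi_subset (I : DyadicInt) : I.hi.set ⊆ I.set := by
  rw [← rightHalf_eq]
  intro x hx
  simp only [rightHalf, set, arc, Set.mem_preimage, Set.mem_Ico] at *
  constructor <;> linarith [I.len_pos]

lemma mem_lo_or_hi {I : DyadicInt} {x : T} (hx : x ∈ I.set) : x ∈ I.lo.set ∨ x ∈ I.hi.set := by
  rw [← leftHalf_eq, ← rightHalf_eq]
  simp only [leftHalf, rightHalf, set, arc, Set.mem_preimage, Set.mem_Ico] at *
  by_cases h : rep x < I.left + I.len / 2
  · left; exact ⟨hx.1, h⟩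
  · right; exact ⟨not_lt.1 h, hx.2⟩

lemma disjoint_lo_hi (I : DyadicInt) : Disjoint I.lo.set I.hi.set := by
  rw [Set.disjoint_left]
  intro x h1 h2
  rw [mem_set_iff] at h1 h2
  exact I.lo_ne_hi (h1.symm.trans h2)

lemma set_eq_union (I : DyadicInt) : I.set = I.lo.set ∪ I.hi.set :=
  Set.Subset.antisymm (fun _ hx => mem_lo_or_hi hx) (Set.union_subset I.lo_subset I.hi_subset)

end DyadicInt

/-! ### Haar functions -/

lemma haar_of_mem_lo {I : DyadicInt} {x : T} (hx : x ∈ I.lo.set) :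
    haar I x = -(Real.sqrt I.len)⁻¹ := by
  have h2 : x ∉ I.hi.set := fun h => Set.disjoint_left.1 I.disjoint_lo_hi hx h
  simp [haar, leftHalf_eq, rightHalf_eq, hx, h2]

lemma haar_of_mem_hi {I : DyadicInt} {x : T} (hx : x ∈ I.hi.set) :
    haar I x = (Real.sqrt I.len)⁻¹ := by
  have h2 : x ∉ I.lo.set := fun h => Set.disjoint_left.1 I.disjoint_lo_hi h hx
  simp [haar, leftHalf_eq, rightHalf_eq, hx, h2]

lemma haar_of_notMem {I : DyadicInt} {x : T} (hx : x ∉ I.set) : haar I x = 0 := by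
  have h1 : x ∉ I.lo.set := fun h => hx (I.lo_subset h)
  have h2 : x ∉ I.hi.set := fun h => hx (I.hi_subset h)
  simp [haar, leftHalf_eq, rightHalf_eq, h1, h2]

lemma haar_eq_sub (I : DyadicInt) (x : T) : haar I x =
    (Real.sqrt I.len)⁻¹ * (I.hi.set.indicator 1 x - I.lo.set.indicator 1 x) := by
  rw [haar, leftHalf_eq, rightHalf_eq]

lemma haar_mul_self (I : DyadicInt) (x : T) :
    haar I x * haar I x = I.set.indicator (fun _ => I.len⁻¹) x := by
  have h : (Real.sqrt I.len)⁻¹ * (Real.sqrt I.len)⁻¹ = I.len⁻¹ := by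
    rw [← mul_inv, Real.mul_self_sqrt I.len_pos.le]
  by_cases hx : x ∈ I.set
  · rw [Set.indicator_of_mem hx]
    rcases mem_lo_or_hi hx with h1 | h1
    · rw [haar_of_mem_lo h1, neg_mul_neg, h]
    · rw [haar_of_mem_hi h1, h]
  · rw [Set.indicator_of_notMem hx, haar_of_notMem hx, zero_mul]

lemma abs_haar (I : DyadicInt) (x : T) :
    |haar I x| = I.set.indicator (fun _ => (Real.sqrt I.len)⁻¹) x := by
  by_cases hx : x ∈ I.set
  · rw [Set.indicator_of_mem hx]
    rcases mem_lo_or_hi hx with h1 | h1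
    · rw [haar_of_mem_lo h1, abs_neg, abs_of_nonneg (by positivity)]
    · rw [haar_of_mem_hi h1, abs_of_nonneg (by positivity)]
  · rw [Set.indicator_of_notMem hx, haar_of_notMem hx, abs_zero]

lemma haarE_zero (I : DyadicInt) : haarE 0 I = haar I := by
  ext x; simp [haarE]

lemma haarE_one (I : DyadicInt) (x : T) :
    haarE 1 I x = I.set.indicator (fun _ => I.len⁻¹) x := by
  have h : (Real.sqrt I.len)⁻¹ * (Real.sqrt I.len)⁻¹ = I.len⁻¹ := by
    rw [← mul_inv, Real.mul_self_sqrt I.len_pos.le]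
  simp only [haarE, one_ne_zero, if_false, abs_haar]
  by_cases hx : x ∈ I.set <;> simp [hx, h]

/-- A Haar function is constant on strictly smaller dyadic intervals. -/
lemma haar_eq_of_mem {I K : DyadicInt} (h : K.1 < I.1) {x y : T} (hx : x ∈ I.set)
    (hy : y ∈ I.set) : haar K x = haar K y := by
  have h1 : ∀ L : DyadicInt, L.1 = K.1 + 1 → (x ∈ L.set ↔ y ∈ L.set) := by
    intro L hL
    rw [mem_set_iff, mem_set_iff, ix_eq_of_mem (by omega) hx hy]
  have h2 := h1 K.lo rfl
  have h3 := h1 K.hi rfl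
  by_cases h4 : y ∈ K.lo.set <;> by_cases h5 : y ∈ K.hi.set <;>
    simp [haar_eq_sub, Set.indicator, h2, h3, h4, h5]

/-- Expansion of `χ_I / |I|` in the Haar basis. -/
lemma haarE_one_expand (I : DyadicInt) {p : T} (hp : p ∈ I.set) (x : T) :
    haarE 1 I x = 1 + ∑ k ∈ Finset.range I.1, haar (ix k p) p * haar (ix k p) x := by
  -- Passing from K of level `n` to its child containing `p`, the normalized indicator doubles on
  -- that half and vanishes on the other. The change is exactly `haar K p * haar K x`.
  have key : ∀ n : ℕ, (ix n p).set.indicator (fun _ => (ix n p).len⁻¹) x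
      = 1 + ∑ k ∈ Finset.range n, haar (ix k p) p * haar (ix k p) x := by
    intro n
    induction n with
    | zero =>
      have h1 : x ∈ (ix 0 p).set := by
        rw [mem_set_iff, ix_fst, ix_eq_ix, pow_zero, mul_one, mul_one,
          Nat.floor_eq_zero.2 (rep_lt_one x), Nat.floor_eq_zero.2 (rep_lt_one p)]
      simp [h1, len]
    | succ n ih =>
      rw [Finset.sum_range_succ, ← add_assoc, ← ih]
      set K := ix n p with hK
      have hpK : p ∈ K.set := mem_ix n p
      have hl : (ix (n + 1) p).len⁻¹ = 2 * K.len⁻¹ := by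
        simp [len, hK, pow_succ, mul_comm]
      have h : (Real.sqrt K.len)⁻¹ * (Real.sqrt K.len)⁻¹ = K.len⁻¹ := by
        rw [← mul_inv, Real.mul_self_sqrt K.len_pos.le]
      have hix : ∀ L : DyadicInt, L.1 = n + 1 → p ∈ L.set → ix (n + 1) p = L := by
        intro L hL h1
        rw [mem_set_iff] at h1
        rw [← hL, h1]
      by_cases hx : x ∈ K.set
      · rcases mem_lo_or_hi hpK with h1 | h1 <;> rcases mem_lo_or_hi hx with h2 | h2
        · rw [hix _ rfl h1] at hl ⊢
          rw [Set.indicator_of_mem h2, Set.indicator_of_mem hx, haar_of_mem_lo h1,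
            haar_of_mem_lo h2, hl, neg_mul_neg, h]
          ring
        · rw [hix _ rfl h1] at hl ⊢
          rw [Set.indicator_of_notMem (fun h3 => Set.disjoint_left.1 K.disjoint_lo_hi h3 h2),
            Set.indicator_of_mem hx, haar_of_mem_lo h1,
            haar_of_mem_hi h2, neg_mul, h]
          ring
        · rw [hix _ rfl h1] at hl ⊢
          rw [Set.indicator_of_notMem (fun h3 => Set.disjoint_left.1 K.disjoint_lo_hi h2 h3),
            Set.indicator_of_mem hx, haar_of_mem_hi h1,
            haar_of_mem_lo h2, mul_neg, h]
          ring
        · rw [hix _ rfl h1] at hl ⊢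
          rw [Set.indicator_of_mem h2, Set.indicator_of_mem hx, haar_of_mem_hi h1,
            haar_of_mem_hi h2, hl, h]
          ring
      · have h3 : x ∉ (ix (n + 1) p).set := by
          intro h3
          exact hx (set_subset_of_mem (Nat.le_succ n) (mem_ix (n + 1) p) hpK h3)
        rw [Set.indicator_of_notMem h3, Set.indicator_of_notMem hx, haar_of_notMem hx]
        simp
  have h1 : ix I.1 p = I := mem_set_iff.1 hp
  rw [haarE_one, ← key, h1]

lemma integrable_of_bdd {X : Type*} [MeasurableSpace X] {μ : Measure X} [IsFiniteMeasure μ]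
    {f : X → ℝ} (hf : Measurable f) (hb : ∃ K : ℝ, ∀ x, |f x| ≤ K) : Integrable f μ := by
  obtain ⟨K, hK⟩ := hb
  exact Integrable.of_bound hf.aestronglyMeasurable K (Filter.Eventually.of_forall hK)

lemma integrable_sq_of_bdd {X : Type*} [MeasurableSpace X] {μ : Measure X} [IsFiniteMeasure μ]
    {f : X → ℝ} (hf : Measurable f) (hb : ∃ K : ℝ, ∀ x, |f x| ≤ K) :
    Integrable (fun x => f x ^ 2) μ := by
  obtain ⟨K, hK⟩ := hb
  refine integrable_of_bdd (hf.pow_const 2) ⟨K ^ 2, fun x => ?_⟩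
  rw [abs_pow]
  exact pow_le_pow_left₀ (abs_nonneg _) (hK x) 2

lemma volume_real_set (I : DyadicInt) : volume.real I.set = I.len := by
  rw [Measure.real, volume_set, ENNReal.toReal_ofReal I.len_pos.le]

/-- The pairing with a Haar function. -/
lemma integral_mul_haar (I : DyadicInt) {g : T → ℝ} (hg : Integrable g) :
    ∫ x, g x * haar I x = (Real.sqrt I.len)⁻¹ * (∫ x in I.hi.set, g x)
      - (Real.sqrt I.len)⁻¹ * ∫ x in I.lo.set, g x := by
  have h1 : ∀ x, g x * haar I x = (Real.sqrt I.len)⁻¹ * I.hi.set.indicator g x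
      - (Real.sqrt I.len)⁻¹ * I.lo.set.indicator g x := by
    intro x
    rw [haar_eq_sub]
    simp only [Set.indicator]
    split_ifs <;> simp <;> ring
  simp_rw [h1]
  rw [integral_sub, integral_const_mul, integral_const_mul,
    integral_indicator I.hi.measurableSet_set, integral_indicator I.lo.measurableSet_set]
  · exact (hg.indicator I.hi.measurableSet_set).const_mul _
  · exact (hg.indicator I.lo.measurableSet_set).const_mul _

lemma integral_haar (I : DyadicInt) : ∫ x, haar I x = 0 := by
  have := integral_mul_haar I (g := fun _ => (1 : ℝ)) (integrable_const _)
  simp only [one_mul] at this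
  rw [this]
  simp [volume_real_set, len_lo, len_hi]

lemma integrable_haar (I : DyadicInt) : Integrable (haar I) :=
  integrable_of_bdd (measurable_haar I) ⟨_, abs_haar_le I⟩

/-- `h_K` has mean zero on dyadic intervals that are not strictly smaller than `K`. -/
lemma setIntegral_haar_of_le {I K : DyadicInt} (h : I.1 ≤ K.1) : ∫ x in I.set, haar K x = 0 := by
  by_cases hIK : I.set ∩ K.set = ∅
  · rw [setIntegral_congr_fun I.measurableSet_set (g := fun _ => (0 : ℝ)), integral_zero]
    intro x hx
    exact haar_of_notMem fun hK => by
      have : x ∈ I.set ∩ K.set := ⟨hx, hK⟩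
      rw [hIK] at this; exact this
  · obtain ⟨x, hx1, hx2⟩ := Set.nonempty_iff_ne_empty.2 hIK
    have hs := set_subset_of_mem h hx2 hx1
    rw [setIntegral_eq_integral_of_forall_compl_eq_zero, integral_haar]
    intro y hy
    exact haar_of_notMem fun h3 => hy (hs h3)

lemma setIntegral_haar_of_lt {I K : DyadicInt} (h : K.1 < I.1) {p : T} (hp : p ∈ I.set) :
    ∫ x in I.set, haar K x = I.len * haar K p := by
  rw [setIntegral_congr_fun I.measurableSet_set (g := fun _ => haar K p)]
  · simp [volume_real_set]
  · intro x hx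
    exact haar_eq_of_mem h hx hp

/-- On different levels, the Haar function of the coarser interval is constant on the finer one,
where the other function has mean zero. Distinct intervals of one level are disjoint. -/
lemma integral_haar_mul_haar (I K : DyadicInt) :
    ∫ x, haar I x * haar K x = if I = K then 1 else 0 := by
  have key : ∀ I K : DyadicInt, I.1 ≤ K.1 → ∫ x, haar I x * haar K x = if I = K then 1 else 0 := by
    intro I K h
    split_ifs with hIK
    · subst hIK
      simp_rw [haar_mul_self]
      rw [integral_indicator I.measurableSet_set]
      simp [volume_real_set, I.len_pos.ne']
    · by_cases hlt : I.1 < K.1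
      · have : ∀ x, haar I x * haar K x = haar I K.pt * haar K x := by
          intro x
          by_cases hx : x ∈ K.set
          · rw [haar_eq_of_mem hlt hx K.pt_mem]
          · simp [haar_of_notMem hx]
        simp_rw [this]
        rw [integral_const_mul, integral_haar, mul_zero]
      · have : ∀ x, haar I x * haar K x = 0 := by
          intro x
          by_cases hx : x ∈ K.set
          · have hx' : x ∉ I.set := by
              intro hx'
              rw [mem_set_iff] at hx hx'
              apply hIK
              rw [← hx, ← hx', show K.1 = I.1 by omega]
            simp [haar_of_notMem hx']
          · simp [haar_of_notMem hx]
        simp [this]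
  rcases le_total I.1 K.1 with h | h
  · exact key I K h
  · simp_rw [mul_comm (haar I _), key K I h, eq_comm]

lemma integral_haarC_mul_haarC (a b : Option DyadicInt) :
    ∫ x, haarC a x * haarC b x = if a = b then 1 else 0 := by
  cases a <;> cases b <;> simp [haarC, integral_haar, integral_haar_mul_haar, Measure.real]

end

section

/-! ### Cauchy–Schwarz inequalities in `ℝ≥0∞` -/

lemma sq_sum_mul_le {ι : Type*} (s : Finset ι) (f g : ι → ℝ≥0∞) :
    (∑ i ∈ s, f i * g i) ^ 2 ≤ (∑ i ∈ s, f i ^ 2) * ∑ i ∈ s, g i ^ 2 := by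
  have h := ENNReal.inner_le_Lp_mul_Lq s f g (Real.HolderConjugate.two_two)
  calc (∑ i ∈ s, f i * g i) ^ 2
      ≤ ((∑ i ∈ s, f i ^ (2 : ℝ)) ^ (1 / 2 : ℝ) * (∑ i ∈ s, g i ^ (2 : ℝ)) ^ (1 / 2 : ℝ)) ^ 2 := by
        gcongr
    _ = _ := by
        rw [mul_pow, ← ENNReal.rpow_natCast, ← ENNReal.rpow_mul, ← ENNReal.rpow_natCast,
          ← ENNReal.rpow_mul]
        norm_num

lemma sq_add_le (p q : ℝ≥0∞) : (p + q) ^ 2 ≤ 2 * p ^ 2 + 2 * q ^ 2 := by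
  have := sq_sum_mul_le (Finset.univ : Finset (Fin 2)) (fun _ => 1) ![p, q]
  simp only [Fin.sum_univ_two, Matrix.cons_val_zero, Matrix.cons_val_one, one_mul, one_pow] at this
  refine this.trans (le_of_eq ?_)
  norm_num
  ring

lemma sq_lintegral_mul_le {X : Type*} [MeasurableSpace X] (μ : Measure X) {f g : X → ℝ≥0∞}
    (hf : Measurable f) (hg : Measurable g) :
    (∫⁻ x, f x * g x ∂μ) ^ 2 ≤ (∫⁻ x, f x ^ 2 ∂μ) * ∫⁻ x, g x ^ 2 ∂μ := by
  have h := ENNReal.lintegral_mul_le_Lp_mul_Lq μ (Real.HolderConjugate.two_two)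
    hf.aemeasurable hg.aemeasurable
  calc (∫⁻ x, f x * g x ∂μ) ^ 2
      ≤ ((∫⁻ x, f x ^ (2 : ℝ) ∂μ) ^ (1 / 2 : ℝ) * (∫⁻ x, g x ^ (2 : ℝ) ∂μ) ^ (1 / 2 : ℝ)) ^ 2 := by
        gcongr
        exact h
    _ = _ := by
        rw [mul_pow, ← ENNReal.rpow_natCast, ← ENNReal.rpow_mul, ← ENNReal.rpow_natCast,
          ← ENNReal.rpow_mul]
        norm_num

/-! ### Carleson families and averages -/

/-- The packing condition `∑_{i ∈ s} a_i ≤ A |⋃_{i ∈ s} E_i|`. -/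
def Carleson {ι X : Type*} [MeasureSpace X] (E : ι → Set X) (a : ι → ℝ≥0∞) (A : ℝ≥0∞) : Prop :=
  ∀ s : Finset ι, ∑ i ∈ s, a i ≤ A * volume (⋃ i ∈ s, E i)

/-- The Carleson embedding theorem. -/
theorem Carleson.sum_mul_le {ι X : Type*} [MeasureSpace X] {E : ι → Set X} {a : ι → ℝ≥0∞}
    {A : ℝ≥0∞} (h : Carleson E a A) (hE : ∀ i, MeasurableSet (E i)) (s : Finset ι)
    (c : ι → ℝ≥0∞) (g : X → ℝ≥0∞) (hg : ∀ i ∈ s, ∀ x ∈ E i, c i ≤ g x) :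
    ∑ i ∈ s, a i * c i ≤ A * ∫⁻ x, g x := by
  classical
  induction hn : s.card generalizing s c g with
  | zero =>
    rw [Finset.card_eq_zero] at hn
    simp [hn]
  | succ n ih =>
    have hne : s.Nonempty := Finset.card_pos.1 (by omega)
    -- Layer-cake argument: the smallest value `c j` is split off from all the `c i`, and from `g`
    -- on the union. The bottom layer is the packing condition itself, and in the remainder the
    -- index `j` has dropped out.
    obtain ⟨j, hj, hmin⟩ := s.exists_min_image c hne
    set U := ⋃ i ∈ s, E i with hU
    have hUm : MeasurableSet U := Finset.measurableSet_biUnion s fun i _ => hE i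
    have h1 := ih (s.erase j) (fun i => c i - c j) (U.indicator fun x => g x - c j) (by
      intro i hi x hx
      have hi' := Finset.mem_of_mem_erase hi
      rw [Set.indicator_of_mem (Set.mem_iUnion₂.2 ⟨i, hi', hx⟩)]
      exact tsub_le_tsub_right (hg i hi' x hx) _) (by
      rw [Finset.card_erase_of_mem hj, hn]; rfl)
    calc ∑ i ∈ s, a i * c i = ∑ i ∈ s, (a i * c j + a i * (c i - c j)) := by
          refine Finset.sum_congr rfl fun i hi => ?_
          rw [← mul_add, add_tsub_cancel_of_le (hmin i hi)]
      _ = (∑ i ∈ s, a i) * c j + ∑ i ∈ s.erase j, a i * (c i - c j) := by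
          rw [Finset.sum_add_distrib, Finset.sum_mul,
            ← Finset.sum_erase_add s (fun i => a i * (c i - c j)) hj, tsub_self, mul_zero, add_zero]
      _ ≤ (A * volume U) * c j + A * ∫⁻ x, U.indicator (fun x => g x - c j) x := by
          gcongr
          exact h s
      _ = A * ∫⁻ x, (U.indicator (fun _ => c j) x + U.indicator (fun x => g x - c j) x) := by
          rw [lintegral_add_left (measurable_const.indicator hUm), lintegral_indicator hUm
            (fun _ => c j), lintegral_const, Measure.restrict_apply_univ]
          ring
      _ ≤ A * ∫⁻ x, g x := by
          gcongr with x
          by_cases hx : x ∈ U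
          · rw [Set.indicator_of_mem hx, Set.indicator_of_mem hx]
            obtain ⟨i, hi, hxi⟩ := Set.mem_iUnion₂.1 hx
            rw [add_tsub_cancel_of_le ((hmin i hi).trans (hg i hi x hxi))]
          · simp [hx]

/-- The mean of `f` over `E`. -/
def av {X : Type*} [MeasureSpace X] (E : Set X) (f : X → ℝ≥0∞) : ℝ≥0∞ :=
  (volume E)⁻¹ * ∫⁻ x in E, f x

/-- The maximal function of `f` with respect to the family `E`. -/
def maxFn {ι X : Type*} [MeasureSpace X] (E : ι → Set X) (f : X → ℝ≥0∞) (x : X) : ℝ≥0∞ :=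
  ⨆ i, (E i).indicator (fun _ => av (E i) f) x

section av

variable {ι X : Type*} [MeasureSpace X]

lemma av_le_maxFn {E : ι → Set X} (f : X → ℝ≥0∞) {i : ι} {x : X} (hx : x ∈ E i) :
    av (E i) f ≤ maxFn E f x := by
  refine le_iSup_of_le i ?_
  rw [Set.indicator_of_mem hx]

lemma measurable_maxFn [Countable ι] {E : ι → Set X} (hE : ∀ i, MeasurableSet (E i))
    (f : X → ℝ≥0∞) : Measurable (maxFn E f) :=
  Measurable.iSup fun i => measurable_const.indicator (hE i)

lemma av_mono {E : Set X} (hE : MeasurableSet E) {f g : X → ℝ≥0∞} (h : ∀ x ∈ E, f x ≤ g x) :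
    av E f ≤ av E g := by
  unfold av
  gcongr 1
  exact setLIntegral_mono' hE h

lemma av_const {E : Set X} (h0 : volume E ≠ 0) (h1 : volume E ≠ ⊤) (c : ℝ≥0∞) :
    av E (fun _ => c) = c := by
  unfold av
  rw [lintegral_const, Measure.restrict_apply_univ, mul_comm c, ← mul_assoc,
    ENNReal.inv_mul_cancel h0 h1, one_mul]

lemma av_sum {κ : Type*} (s : Finset κ) {E : Set X} {f : κ → X → ℝ≥0∞}
    (hf : ∀ k ∈ s, Measurable (f k)) : av E (fun x => ∑ k ∈ s, f k x) = ∑ k ∈ s, av E (f k) := by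
  unfold av
  rw [lintegral_finsetSum' _ fun k hk => (hf k hk).aemeasurable, Finset.mul_sum]

lemma sq_av_mul_le {E : Set X} {f g : X → ℝ≥0∞} (hf : Measurable f) (hg : Measurable g) :
    av E (fun x => f x * g x) ^ 2 ≤ av E (fun x => f x ^ 2) * av E (fun x => g x ^ 2) := by
  unfold av
  calc _ = (volume E)⁻¹ ^ 2 * (∫⁻ x in E, f x * g x) ^ 2 := by ring
    _ ≤ (volume E)⁻¹ ^ 2 * ((∫⁻ x in E, f x ^ 2) * ∫⁻ x in E, g x ^ 2) := by
        gcongr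
        exact sq_lintegral_mul_le _ hf hg
    _ = _ := by ring

lemma sq_av_le {E : Set X} (h0 : volume E ≠ 0) (h1 : volume E ≠ ⊤) {f : X → ℝ≥0∞}
    (hf : Measurable f) : av E f ^ 2 ≤ av E (fun x => f x ^ 2) := by
  have := sq_av_mul_le (E := E) hf (measurable_const (a := (1 : ℝ≥0∞)))
  simpa [av_const h0 h1] using this

lemma volume_mul_av {E : Set X} (h0 : volume E ≠ 0) (h1 : volume E ≠ ⊤) (f : X → ℝ≥0∞) :
    volume E * av E f = ∫⁻ x in E, f x := by
  unfold av
  rw [← mul_assoc, ENNReal.mul_inv_cancel h0 h1, one_mul]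

lemma av_indicator {E F : Set X} (hF : MeasurableSet F) :
    av E (F.indicator fun _ => 1) = (volume E)⁻¹ * volume (E ∩ F) := by
  unfold av
  rw [lintegral_indicator hF, lintegral_const, one_mul, Measure.restrict_apply_univ,
    Measure.restrict_apply hF, Set.inter_comm]

lemma Carleson.sum_mul_sq_av_le {E : ι → Set X} {a : ι → ℝ≥0∞}
    {A : ℝ≥0∞} (h : Carleson E a A) (hE : ∀ i, MeasurableSet (E i)) (s : Finset ι)
    (g : X → ℝ≥0∞) : ∑ i ∈ s, a i * av (E i) g ^ 2 ≤ A * ∫⁻ x, maxFn E g x ^ 2 :=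
  h.sum_mul_le hE s _ _ fun i _ x hx => by
    gcongr
    exact av_le_maxFn g hx

lemma Carleson.mono {E : ι → Set X} {a b : ι → ℝ≥0∞} {A : ℝ≥0∞} (h : Carleson E a A)
    (hb : ∀ i, b i ≤ a i) : Carleson E b A := fun s =>
  (Finset.sum_le_sum fun i _ => hb i).trans (h s)

end av

/-! ### The dyadic maximal theorem -/

/-- Sum over one level of the dyadic tree in terms of the level above. -/
lemma sum_level_succ {M : Type*} [AddCommMonoid M] (n : ℕ) (G : DyadicInt → M) :
    ∑ a : Fin (2 ^ (n + 1)), G ⟨n + 1, a⟩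
      = ∑ a : Fin (2 ^ n), (G (DyadicInt.lo ⟨n, a⟩) + G (DyadicInt.hi ⟨n, a⟩)) := by
  let e : Fin (2 ^ n) × Fin 2 ≃ Fin (2 ^ (n + 1)) :=
    finProdFinEquiv.trans (finCongr (pow_succ 2 n).symm)
  rw [← Fintype.sum_equiv e (fun p => G ⟨n + 1, e p⟩) _ (fun _ => rfl), Fintype.sum_prod_type]
  refine Finset.sum_congr rfl fun a _ => ?_
  rw [Fin.sum_univ_two]
  have h0 : (⟨n + 1, e (a, 0)⟩ : DyadicInt) = DyadicInt.lo ⟨n, a⟩ := by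
    simp [e, DyadicInt.lo, Fin.ext_iff]
  have h1 : (⟨n + 1, e (a, 1)⟩ : DyadicInt) = DyadicInt.hi ⟨n, a⟩ := by
    simp [e, DyadicInt.hi, Fin.ext_iff]
    omega
  rw [h0, h1]

/-- The average of `G` over the intervals of level `n`. -/
def levelAv (n : ℕ) (G : DyadicInt → ℝ) : ℝ := (2 ^ n)⁻¹ * ∑ a : Fin (2 ^ n), G ⟨n, a⟩

lemma levelAv_succ (n : ℕ) (G : DyadicInt → ℝ) :
    levelAv (n + 1) G = levelAv n fun I => (G I.lo + G I.hi) / 2 := by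
  simp only [levelAv, sum_level_succ, ← Finset.sum_div, pow_succ]
  field_simp

lemma levelAv_mono (n : ℕ) {G H : DyadicInt → ℝ} (h : ∀ I, G I ≤ H I) :
    levelAv n G ≤ levelAv n H := by
  unfold levelAv
  gcongr
  exact h _

/-- The root of the dyadic tree. -/
def root : DyadicInt := ⟨0, 0⟩

lemma levelAv_zero (G : DyadicInt → ℝ) : levelAv 0 G = G root := by
  unfold levelAv
  rw [pow_zero, inv_one, one_mul]
  exact Fin.sum_univ_one (fun a : Fin 1 => G ⟨0, a⟩)

lemma levelAv_le_root (n : ℕ) {G : DyadicInt → ℝ} (h : ∀ I : DyadicInt, (G I.lo + G I.hi) / 2 ≤ G I) :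
    levelAv n G ≤ G root := by
  induction n with
  | zero => rw [levelAv_zero]
  | succ n ih => exact (levelAv_succ n G).le.trans ((levelAv_mono n h).trans ih)

/-- The largest value of `x` on the ancestors of an interval, by recursion on the level. -/
def runMax (x : DyadicInt → ℝ) : (n : ℕ) → Fin (2 ^ n) → ℝ
  | 0, a => x ⟨0, a⟩
  | n + 1, a => max (runMax x n ⟨a / 2, by
      have h := a.2
      have h2 : 2 ^ (n + 1) = 2 ^ n * 2 := pow_succ 2 n
      omega⟩) (x ⟨n + 1, a⟩)

/-- The largest value of `x` on the ancestors of `I`. -/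
def ancMax (x : DyadicInt → ℝ) (I : DyadicInt) : ℝ := runMax x I.1 I.2

lemma ancMax_lo (x : DyadicInt → ℝ) (I : DyadicInt) :
    ancMax x I.lo = max (ancMax x I) (x I.lo) := by
  obtain ⟨n, a⟩ := I
  simp [ancMax, DyadicInt.lo, runMax]

lemma ancMax_hi (x : DyadicInt → ℝ) (I : DyadicInt) :
    ancMax x I.hi = max (ancMax x I) (x I.hi) := by
  obtain ⟨n, a⟩ := I
  have : (2 * (a : ℕ) + 1) / 2 = a := by omega
  simp [ancMax, DyadicInt.hi, runMax, this]

lemma le_ancMax_self (x : DyadicInt → ℝ) (I : DyadicInt) : x I ≤ ancMax x I := by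
  obtain ⟨n, a⟩ := I
  cases n with
  | zero => exact le_rfl
  | succ n => exact le_max_right _ _

lemma ix_succ (n : ℕ) (t : T) : ix (n + 1) t = (ix n t).lo ∨ ix (n + 1) t = (ix n t).hi := by
  rcases DyadicInt.mem_lo_or_hi (DyadicInt.mem_ix n t) with h1 | h1 <;>
    rw [DyadicInt.mem_set_iff] at h1
  · exact Or.inl h1
  · exact Or.inr h1

lemma ancMax_ix_succ (x : DyadicInt → ℝ) (n : ℕ) (t : T) :
    ancMax x (ix (n + 1) t) = max (ancMax x (ix n t)) (x (ix (n + 1) t)) := by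
  rcases ix_succ n t with h | h <;> rw [h]
  · exact ancMax_lo x _
  · exact ancMax_hi x _

/-- Doob's `L²` inequality on the dyadic tree. -/
lemma levelAv_runMax_sq_le (x : DyadicInt → ℝ)
    (hx : ∀ I : DyadicInt, x I = (x I.lo + x I.hi) / 2) (n : ℕ) :
    levelAv n (fun I => ancMax x I ^ 2) ≤ 4 * levelAv n (fun I => x I ^ 2) := by
  -- A supermartingale: replacing the running maximum m by `max m y` does not increase 2m² - 4my,
  -- and for fixed m this is affine in the martingale `x`. At the root it equals -2x² ≤ 0, and m² ≤
  -- 4x² + Ψ is just (2x - m)² ≥ 0.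
  set Ψ : DyadicInt → ℝ := fun I => 2 * ancMax x I ^ 2 - 4 * (ancMax x I * x I)
    with hΨ
  have hstep : ∀ m y : ℝ, 2 * max m y ^ 2 - 4 * (max m y * y) ≤ 2 * m ^ 2 - 4 * (m * y) := by
    intro m y
    rcases le_total m y with h | h
    · rw [max_eq_right h]; nlinarith [sq_nonneg (m - y)]
    · rw [max_eq_left h]
  have h1 : levelAv n Ψ ≤ Ψ root := by
    refine levelAv_le_root n fun I => ?_
    simp only [hΨ, ancMax_lo, ancMax_hi]
    have h1 := hstep (ancMax x I) (x I.lo)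
    have h2 := hstep (ancMax x I) (x I.hi)
    rw [hx I]
    linarith
  have h2 : Ψ root ≤ 0 := by
    have : ancMax x root = x root := rfl
    simp only [hΨ, this]
    nlinarith [sq_nonneg (x root)]
  have h3 : levelAv n (fun I => ancMax x I ^ 2)
      ≤ levelAv n (fun I => 4 * x I ^ 2 + Ψ I) := by
    refine levelAv_mono n fun I => ?_
    simp only [hΨ]
    nlinarith [sq_nonneg (2 * x I - ancMax x I)]
  have h4 : levelAv n (fun I => 4 * x I ^ 2 + Ψ I)
      = 4 * levelAv n (fun I => x I ^ 2) + levelAv n Ψ := by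
    simp only [levelAv, Finset.sum_add_distrib, ← Finset.mul_sum]
    ring
  linarith

lemma lintegral_eq_sum_level (n : ℕ) (f : T → ℝ≥0∞) :
    ∫⁻ x, f x = ∑ a : Fin (2 ^ n), ∫⁻ x in DyadicInt.set ⟨n, a⟩, f x := by
  have hU : (⋃ a : Fin (2 ^ n), DyadicInt.set ⟨n, a⟩) = Set.univ := by
    refine Set.eq_univ_of_forall fun x => Set.mem_iUnion.2 ⟨(ix n x).2, ?_⟩
    exact DyadicInt.mem_ix n x
  rw [← setLIntegral_univ, ← hU, lintegral_iUnion (fun a => DyadicInt.measurableSet_set _), tsum_fintype]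
  intro a b hab
  refine Set.disjoint_left.2 fun x ha hb => hab ?_
  rw [DyadicInt.mem_set_iff] at ha hb
  have := ha.symm.trans hb
  simpa using this

lemma lintegral_step (n : ℕ) (G : DyadicInt → ℝ≥0∞) :
    ∫⁻ x, G (ix n x) = ∑ a : Fin (2 ^ n), volume (DyadicInt.set ⟨n, a⟩) * G ⟨n, a⟩ := by
  rw [lintegral_eq_sum_level n]
  refine Finset.sum_congr rfl fun a _ => ?_
  rw [setLIntegral_congr_fun (DyadicInt.measurableSet_set _) (g := fun _ => G ⟨n, a⟩)]
  · simp [mul_comm]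
  · intro x hx
    rw [DyadicInt.mem_set_iff] at hx
    simp only
    rw [← hx]

lemma lintegral_step_ofReal (n : ℕ) {G : DyadicInt → ℝ} (hG : ∀ I, 0 ≤ G I) :
    ∫⁻ x, ENNReal.ofReal (G (ix n x)) = ENNReal.ofReal (levelAv n G) := by
  rw [lintegral_step n (fun I => ENNReal.ofReal (G I)), levelAv, Finset.mul_sum,
    ENNReal.ofReal_sum_of_nonneg fun a _ => mul_nonneg (by positivity) (hG _)]
  refine Finset.sum_congr rfl fun a _ => ?_
  rw [DyadicInt.volume_set, ← ENNReal.ofReal_mul (DyadicInt.len_pos _).le]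
  rfl

lemma DyadicInt.volume_set_ne_top (I : DyadicInt) : volume I.set ≠ ⊤ := measure_ne_top _ _

lemma av_split (f : T → ℝ≥0∞) (I : DyadicInt) :
    av I.set f = (av I.lo.set f + av I.hi.set f) / 2 := by
  have hlo : volume I.set = 2 * volume I.lo.set := by
    rw [DyadicInt.volume_set, DyadicInt.volume_set, DyadicInt.len_lo,
      show (2 : ℝ≥0∞) = ENNReal.ofReal 2 by simp, ← ENNReal.ofReal_mul (by norm_num)]
    congr 1; ring
  have hhi : volume I.hi.set = volume I.lo.set := by
    rw [DyadicInt.volume_set, DyadicInt.volume_set, DyadicInt.len_lo, DyadicInt.len_hi]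
  unfold av
  rw [hhi, hlo, I.set_eq_union, lintegral_union I.hi.measurableSet_set I.disjoint_lo_hi,
    ENNReal.mul_inv (Or.inl two_ne_zero) (Or.inl ENNReal.ofNat_ne_top), ENNReal.div_eq_inv_mul]
  ring

/-- The dyadic maximal theorem in `L²(𝕋)`. -/
theorem lintegral_maxFn_sq_le {f : T → ℝ≥0∞} (hf : Measurable f) :
    ∫⁻ x, maxFn DyadicInt.set f x ^ 2 ≤ 4 * ∫⁻ x, f x ^ 2 := by
  by_cases htop : ∫⁻ x, f x ^ 2 = ⊤
  · simp [htop]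
  have hf1 : ∫⁻ x, f x ≠ ⊤ := by
    intro h
    have h1 := sq_lintegral_mul_le volume hf (measurable_const (a := (1 : ℝ≥0∞)))
    simp only [mul_one, h, one_pow, lintegral_const, measure_univ] at h1
    rw [ENNReal.top_pow two_ne_zero, top_le_iff] at h1
    exact htop h1
  have hav : ∀ I : DyadicInt, av I.set f ≠ ⊤ := fun I =>
    ENNReal.mul_ne_top (ENNReal.inv_ne_top.2 I.volume_set_ne_zero)
      (ne_top_of_le_ne_top hf1 (setLIntegral_le_lintegral _ _))
  set x : DyadicInt → ℝ := fun I => (av I.set f).toReal with hxdef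
  have hx0 : ∀ I, 0 ≤ x I := fun I => ENNReal.toReal_nonneg
  have hx : ∀ I : DyadicInt, x I = (x I.lo + x I.hi) / 2 := by
    intro I
    simp only [hxdef]
    rw [av_split, ENNReal.toReal_div, ENNReal.toReal_add (hav _) (hav _)]
    rfl
  have hmax0 : ∀ I, 0 ≤ ancMax x I := fun I => (hx0 I).trans (le_ancMax_self x I)
  -- The square of the maximal function truncated at level `n`. It increases in `n`, so Doob's
  -- inequality at each level passes to the limit by monotone convergence.
  set F : ℕ → T → ℝ≥0∞ := fun n t => ENNReal.ofReal (ancMax x (ix n t) ^ 2) with hF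
  have hpt : ∀ t, maxFn DyadicInt.set f t ^ 2 ≤ ⨆ n, ⨆ k ≤ n, F k t := by
    intro t
    have h1 : ∀ I : DyadicInt, (I.set.indicator (fun _ => av I.set f) t) ^ 2 ≤
        ⨆ n, ⨆ k ≤ n, F k t := by
      intro I
      by_cases ht : t ∈ I.set
      · rw [Set.indicator_of_mem ht]
        refine le_iSup_of_le I.1 (le_iSup₂_of_le I.1 le_rfl ?_)
        rw [DyadicInt.mem_set_iff] at ht
        simp only [hF]
        rw [ht, ENNReal.ofReal_pow (hmax0 _)]
        gcongr
        rw [← ENNReal.ofReal_toReal (hav I)]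
        exact ENNReal.ofReal_le_ofReal (le_ancMax_self x I)
      · rw [Set.indicator_of_notMem ht]; simp
    have h2 : maxFn DyadicInt.set f t ≤ (⨆ n, ⨆ k ≤ n, F k t) ^ (1 / 2 : ℝ) := by
      refine iSup_le fun I => ?_
      calc _ = ((I.set.indicator (fun _ => av I.set f) t) ^ 2) ^ (1 / 2 : ℝ) := by
            rw [← ENNReal.rpow_natCast, ← ENNReal.rpow_mul]; norm_num
        _ ≤ _ := ENNReal.rpow_le_rpow (h1 I) (by norm_num)
    calc _ ≤ ((⨆ n, ⨆ k ≤ n, F k t) ^ (1 / 2 : ℝ)) ^ 2 := by gcongr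
      _ = _ := by rw [← ENNReal.rpow_natCast, ← ENNReal.rpow_mul]; norm_num
  have hmono : ∀ t, Monotone fun n => F n t := by
    intro t
    refine monotone_nat_of_le_succ fun n => ?_
    refine ENNReal.ofReal_le_ofReal (pow_le_pow_left₀ (hmax0 _) ?_ 2)
    rw [ancMax_ix_succ]
    exact le_max_left _ _
  have hmeas : ∀ n, Measurable (F n) := by
    intro n
    have : F n = fun t => ∑ a : Fin (2 ^ n), (DyadicInt.set ⟨n, a⟩).indicator
        (fun _ => ENNReal.ofReal (ancMax x ⟨n, a⟩ ^ 2)) t := by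
      ext t
      obtain ⟨a, ha⟩ : ∃ a : Fin (2 ^ n), ix n t = ⟨n, a⟩ := ⟨_, rfl⟩
      have hat : t ∈ DyadicInt.set ⟨n, a⟩ := DyadicInt.mem_set_iff.2 ha
      simp only [hF, ha]
      rw [Finset.sum_eq_single a, Set.indicator_of_mem hat]
      · intro b _ hb
        refine Set.indicator_of_notMem (fun h => hb ?_) _
        rw [DyadicInt.mem_set_iff] at h
        have h2 : (⟨n, a⟩ : DyadicInt) = ⟨n, b⟩ := ha.symm.trans h
        simpa using h2.symm
      · simp
    rw [this]
    exact Finset.measurable_sum _ fun a _ => measurable_const.indicator (DyadicInt.measurableSet_set _)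
  have hbound : ∀ n, ∫⁻ t, F n t ≤ 4 * ∫⁻ x, f x ^ 2 := by
    intro n
    simp only [hF]
    rw [lintegral_step_ofReal n (G := fun I => ancMax x I ^ 2) fun I => sq_nonneg _]
    calc _ ≤ ENNReal.ofReal (4 * levelAv n (fun I => x I ^ 2)) :=
          ENNReal.ofReal_le_ofReal (levelAv_runMax_sq_le x hx n)
      _ = 4 * ENNReal.ofReal (levelAv n (fun I => x I ^ 2)) := by
          rw [ENNReal.ofReal_mul (by norm_num)]; simp
      _ ≤ _ := by
          rw [← lintegral_step_ofReal n (G := fun I => x I ^ 2) fun I => sq_nonneg _,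
            lintegral_step n (fun I => ENNReal.ofReal (x I ^ 2)), lintegral_eq_sum_level n (fun x => f x ^ 2)]
          gcongr with a _
          rw [ENNReal.ofReal_pow (hx0 _), ENNReal.ofReal_toReal (hav _),
            ← volume_mul_av (DyadicInt.volume_set_ne_zero _) (DyadicInt.volume_set_ne_top _)]
          gcongr
          exact sq_av_le (DyadicInt.volume_set_ne_zero _) (DyadicInt.volume_set_ne_top _) hf
  calc ∫⁻ x, maxFn DyadicInt.set f x ^ 2 ≤ ∫⁻ t, ⨆ n, F n t := by
        refine lintegral_mono fun t => (hpt t).trans ?_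
        exact iSup_le fun n => iSup₂_le fun k _ => le_iSup (fun n => F n t) k
    _ = ⨆ n, ∫⁻ t, F n t := lintegral_iSup hmeas fun m n hmn t => hmono t hmn
    _ ≤ _ := iSup_le hbound

/-! ### The strong maximal function -/

lemma Rect.measurableSet_set (R : Rect) : MeasurableSet R.set :=
  R.1.measurableSet_set.prod R.2.measurableSet_set

lemma Rect.volume_set (R : Rect) : volume R.set = volume R.1.set * volume R.2.set := by
  rw [Rect.set, Measure.volume_eq_prod, Measure.prod_prod]

lemma Rect.volume_set_ne_zero (R : Rect) : volume R.set ≠ 0 := by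
  rw [R.volume_set]
  exact mul_ne_zero R.1.volume_set_ne_zero R.2.volume_set_ne_zero

lemma Rect.volume_set_ne_top (R : Rect) : volume R.set ≠ ⊤ := measure_ne_top _ _

lemma av_rect {f : T2 → ℝ≥0∞} (hf : Measurable f) (R : Rect) :
    av R.set f = av R.1.set fun s => av R.2.set fun t => f (s, t) := by
  unfold av
  rw [R.volume_set, Rect.set, Measure.volume_eq_prod, ← Measure.prod_restrict,
    lintegral_prod _ hf.aemeasurable, lintegral_const_mul _ hf.lintegral_prod_right',
    ENNReal.mul_inv (Or.inl R.1.volume_set_ne_zero) (Or.inl R.1.volume_set_ne_top), mul_assoc]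

/-- The strong dyadic maximal theorem in `L²(𝕋²)`. -/
theorem lintegral_strong_maxFn_sq_le {f : T2 → ℝ≥0∞} (hf : Measurable f) :
    ∫⁻ p, maxFn Rect.set f p ^ 2 ≤ 16 * ∫⁻ p, f p ^ 2 := by
  -- Means over rectangles are iterated means, so the strong maximal function is dominated by the
  -- composition of the two one-variable ones. Each costs a factor 4.
  set g : T2 → ℝ≥0∞ := fun p => maxFn DyadicInt.set (fun t => f (p.1, t)) p.2 with hg
  have hgm : Measurable g := by
    have : g = fun p => ⨆ J : DyadicInt, (Prod.snd ⁻¹' J.set : Set T2).indicator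
        (fun p => av J.set fun t => f (p.1, t)) p := by
      ext p
      rfl
    rw [this]
    refine Measurable.iSup fun J => Measurable.indicator ?_ (measurable_snd J.measurableSet_set)
    have : Measurable fun s : T => av J.set fun t => f (s, t) :=
      (hf.lintegral_prod_right' (ν := volume.restrict J.set)).const_mul _
    exact this.comp measurable_fst
  have hle : ∀ p : T2, maxFn Rect.set f p ≤ maxFn DyadicInt.set (fun s => g (s, p.2)) p.1 := by
    intro p
    refine iSup_le fun R => ?_
    by_cases hp : p ∈ R.set
    swap
    · rw [Set.indicator_of_notMem hp]
      exact bot_le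
    rw [Set.indicator_of_mem hp]
    rw [av_rect hf]
    refine le_trans (av_mono R.1.measurableSet_set fun s _ => ?_)
      (av_le_maxFn (fun s => g (s, p.2)) hp.1)
    exact av_le_maxFn (fun t => f (s, t)) hp.2
  have hswap : ∀ h : T2 → ℝ≥0∞, Measurable h → ∫⁻ p, h p = ∫⁻ t, ∫⁻ s, h (s, t) := fun h hh => by
    rw [Measure.volume_eq_prod, lintegral_prod_symm' _ hh]
  have hm2 : Measurable fun p : T2 => maxFn DyadicInt.set (fun s => g (s, p.2)) p.1 := by
    have : (fun p : T2 => maxFn DyadicInt.set (fun s => g (s, p.2)) p.1)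
        = fun p => ⨆ J : DyadicInt, (Prod.fst ⁻¹' J.set : Set T2).indicator
        (fun p => av J.set fun s => g (s, p.2)) p := by
      ext p
      rfl
    rw [this]
    refine Measurable.iSup fun J => Measurable.indicator ?_ (measurable_fst J.measurableSet_set)
    have : Measurable fun t : T => av J.set fun s => g (s, t) :=
      (hgm.lintegral_prod_left' (μ := volume.restrict J.set)).const_mul _
    exact this.comp measurable_snd
  calc ∫⁻ p, maxFn Rect.set f p ^ 2
      ≤ ∫⁻ p : T2, maxFn DyadicInt.set (fun s => g (s, p.2)) p.1 ^ 2 := by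
        gcongr with p; exact hle p
    _ = ∫⁻ t, ∫⁻ s, maxFn DyadicInt.set (fun s => g (s, t)) s ^ 2 := hswap _ (hm2.pow_const 2)
    _ ≤ ∫⁻ t, 4 * ∫⁻ s, g (s, t) ^ 2 := by
        gcongr with t
        exact lintegral_maxFn_sq_le (hgm.comp measurable_prodMk_right)
    _ = 4 * ∫⁻ t, ∫⁻ s, g (s, t) ^ 2 :=
        lintegral_const_mul _ (hgm.pow_const 2).lintegral_prod_left'
    _ = 4 * ∫⁻ s, ∫⁻ t, g (s, t) ^ 2 := by
        rw [← hswap _ (hgm.pow_const 2), Measure.volume_eq_prod,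
          lintegral_prod _ (hgm.pow_const 2).aemeasurable]
    _ ≤ 4 * ∫⁻ s, 4 * ∫⁻ t, f (s, t) ^ 2 := by
        gcongr with s
        exact lintegral_maxFn_sq_le (hf.comp measurable_prodMk_left)
    _ = 16 * ∫⁻ p, f p ^ 2 := by
        rw [lintegral_const_mul _ (hf.pow_const 2).lintegral_prod_right', ← mul_assoc,
          Measure.volume_eq_prod, lintegral_prod _ (hf.pow_const 2).aemeasurable]
        norm_num

end

section

/-! ### Duality between square functions and Carleson families -/

/-- Square roots in `ℝ≥0∞`. -/
def rt (x : ℝ≥0∞) : ℝ≥0∞ := x ^ (1 / 2 : ℝ)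

lemma rt_sq (x : ℝ≥0∞) : rt x ^ 2 = x := by
  rw [rt, ← ENNReal.rpow_natCast, ← ENNReal.rpow_mul]; norm_num

lemma rt_mul_rt (x : ℝ≥0∞) : rt x * rt x = x := by rw [← sq, rt_sq]

lemma rt_sq' (x : ℝ≥0∞) : rt (x ^ 2) = x := by
  rw [rt, ← ENNReal.rpow_natCast, ← ENNReal.rpow_mul]; norm_num

lemma rt_mono {x y : ℝ≥0∞} (h : x ≤ y) : rt x ≤ rt y := ENNReal.rpow_le_rpow h (by norm_num)

lemma rt_mul (x y : ℝ≥0∞) : rt (x * y) = rt x * rt y :=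
  ENNReal.mul_rpow_of_nonneg _ _ (by norm_num)

lemma rt_ne_zero {x : ℝ≥0∞} (h : x ≠ 0) : rt x ≠ 0 := fun h2 => h (by rw [← rt_sq x, h2]; simp)

lemma rt_ne_top {x : ℝ≥0∞} (h : x ≠ ⊤) : rt x ≠ ⊤ := fun h2 => h (by rw [← rt_sq x, h2]; simp)

lemma measurable_rt : Measurable rt := measurable_id.pow_const _

lemma le_of_sq_le_sq {x y : ℝ≥0∞} (h : x ^ 2 ≤ y ^ 2) : x ≤ y := by
  simpa [rt_sq'] using rt_mono h

/-- The square of the square function of the coefficients `c`. -/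
def sqFn (s : Finset Rect) (c : Rect → ℝ≥0∞) (p : T2) : ℝ≥0∞ :=
  ∑ R ∈ s, R.set.indicator (fun _ => c R ^ 2 * (volume R.set)⁻¹) p

lemma measurable_sqFn (s : Finset Rect) (c : Rect → ℝ≥0∞) : Measurable (sqFn s c) :=
  Finset.measurable_sum _ fun R _ => measurable_const.indicator R.measurableSet_set

/-- Carleson families are dual to integrable square functions. -/
theorem Carleson.sq_sum_mul_le {φ : Rect → ℝ≥0∞} {A : ℝ≥0∞}
    (h : Carleson Rect.set (fun R => φ R ^ 2) A) (s : Finset Rect) (c : Rect → ℝ≥0∞)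
    (hc : ∀ R ∈ s, c R ≠ ⊤) :
    (∑ R ∈ s, φ R * c R) ^ 2 ≤ 16 * A * (∫⁻ p, rt (sqFn s c p)) ^ 2 := by
  classical
  set H : T2 → ℝ≥0∞ := fun p => rt (sqFn s c p) with hH
  have hHm : Measurable H := measurable_rt.comp (measurable_sqFn s c)
  have hHi : Measurable fun p => (H p)⁻¹ := hHm.inv
  set D : T2 → ℝ≥0∞ := fun p => rt (H p) with hD
  have hDm : Measurable D := measurable_rt.comp hHm
  -- Cauchy–Schwarz will be applied to φ c = (φ q^(-1/2)) (c q^(1/2)). The second factor sums to the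
  -- integral of H² / H. For the first, 1/q is at most the squared mean of √H, so Carleson embedding
  -- and the maximal theorem apply to √H.
  set q : Rect → ℝ≥0∞ := fun R => av R.set fun p => (H p)⁻¹ with hq
  -- Dropping the vanishing coefficients keeps `H` bounded below on every remaining rectangle, so
  -- that `q` can be inverted.
  set s' := s.filter fun R => c R ≠ 0 with hs'
  have hHtop : ∀ p, H p ≠ ⊤ := by
    intro p
    refine rt_ne_top (ENNReal.sum_ne_top.2 fun R hR => ?_)
    by_cases hp : p ∈ R.set
    · rw [Set.indicator_of_mem hp]
      exact ENNReal.mul_ne_top (ENNReal.pow_ne_top (hc R hR))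
        (ENNReal.inv_ne_top.2 R.volume_set_ne_zero)
    · rw [Set.indicator_of_notMem hp]; exact ENNReal.zero_ne_top
  have hHlow : ∀ R ∈ s', ∀ p ∈ R.set, rt (c R ^ 2 * (volume R.set)⁻¹) ≤ H p := by
    intro R hR p hp
    refine rt_mono ?_
    calc _ = R.set.indicator (fun _ => c R ^ 2 * (volume R.set)⁻¹) p := by
          rw [Set.indicator_of_mem hp]
      _ ≤ _ := Finset.single_le_sum (f := fun R : Rect =>
          R.set.indicator (fun _ => c R ^ 2 * (volume R.set)⁻¹) p) (fun _ _ => bot_le)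
          (Finset.mem_filter.1 hR).1
  have hlow0 : ∀ R ∈ s', rt (c R ^ 2 * (volume R.set)⁻¹) ≠ 0 := by
    intro R hR
    refine rt_ne_zero (mul_ne_zero (pow_ne_zero 2 (Finset.mem_filter.1 hR).2) ?_)
    exact ENNReal.inv_ne_zero.2 R.volume_set_ne_top
  have hH0 : ∀ R ∈ s', ∀ p ∈ R.set, H p ≠ 0 := fun R hR p hp h0 =>
    hlow0 R hR (le_antisymm ((hHlow R hR p hp).trans h0.le) bot_le)
  have hqtop : ∀ R ∈ s', q R ≠ ⊤ := by
    intro R hR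
    have h1 : q R ≤ (rt (c R ^ 2 * (volume R.set)⁻¹))⁻¹ := by
      calc q R ≤ av R.set fun _ => (rt (c R ^ 2 * (volume R.set)⁻¹))⁻¹ :=
            av_mono R.measurableSet_set fun p hp => ENNReal.inv_le_inv.2 (hHlow R hR p hp)
        _ = _ := av_const R.volume_set_ne_zero R.volume_set_ne_top _
    exact ne_top_of_le_ne_top (ENNReal.inv_ne_top.2 (hlow0 R hR)) h1
  -- Cauchy–Schwarz twice, with D = √H: 1 ≤ (mean of D)(mean of 1/D), and the squared mean of 1/D is
  -- at most the mean of 1/D² = 1/H.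
  have hone : ∀ R ∈ s', 1 ≤ av R.set D ^ 2 * q R := by
    intro R hR
    have hD0 : ∀ p ∈ R.set, D p ≠ 0 := fun p hp => rt_ne_zero (hH0 R hR p hp)
    have hDt : ∀ p, D p ≠ ⊤ := fun p => rt_ne_top (hHtop p)
    have h1 : 1 ≤ av R.set fun p => rt (D p) * rt (D p)⁻¹ := by
      rw [← av_const R.volume_set_ne_zero R.volume_set_ne_top 1]
      refine av_mono R.measurableSet_set fun p hp => ?_
      rw [← rt_mul, ENNReal.mul_inv_cancel (hD0 p hp) (hDt p)]
      simp [rt]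
    have h2 : 1 ≤ av R.set D * av R.set fun p => (D p)⁻¹ := by
      calc (1 : ℝ≥0∞) ≤ (av R.set fun p => rt (D p) * rt (D p)⁻¹) ^ 2 := one_le_pow₀ h1
        _ ≤ _ := sq_av_mul_le (measurable_rt.comp hDm) (measurable_rt.comp hDm.inv)
        _ = _ := by simp only [rt_sq]
    calc (1 : ℝ≥0∞) ≤ (av R.set D * av R.set fun p => (D p)⁻¹) ^ 2 := one_le_pow₀ h2
      _ = av R.set D ^ 2 * (av R.set fun p => (D p)⁻¹) ^ 2 := by ring
      _ ≤ av R.set D ^ 2 * av R.set fun p => (D p)⁻¹ ^ 2 := by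
          gcongr
          exact sq_av_le R.volume_set_ne_zero R.volume_set_ne_top hDm.inv
      _ = _ := by
          simp only [hq]
          congr 2
          ext p
          rw [← ENNReal.inv_pow, hD, rt_sq]
  have hq0 : ∀ R ∈ s', q R ≠ 0 := fun R hR h0 => by
    have := hone R hR
    simp [h0] at this
  have hsum1 : ∑ R ∈ s', (φ R * rt (q R)⁻¹) ^ 2 ≤ A * (16 * ∫⁻ p, H p) := by
    calc ∑ R ∈ s', (φ R * rt (q R)⁻¹) ^ 2 ≤ ∑ R ∈ s', φ R ^ 2 * av R.set D ^ 2 := by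
          refine Finset.sum_le_sum fun R hR => ?_
          rw [mul_pow, rt_sq]
          gcongr
          calc (q R)⁻¹ = 1 * (q R)⁻¹ := (one_mul _).symm
            _ ≤ av R.set D ^ 2 * q R * (q R)⁻¹ := by gcongr; exact hone R hR
            _ = _ := by rw [mul_assoc, ENNReal.mul_inv_cancel (hq0 R hR) (hqtop R hR), mul_one]
      _ ≤ A * ∫⁻ p, maxFn Rect.set D p ^ 2 :=
          h.sum_mul_sq_av_le (fun R => R.measurableSet_set) _ _
      _ ≤ A * (16 * ∫⁻ p, D p ^ 2) := by gcongr; exact lintegral_strong_maxFn_sq_le hDm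
      _ = _ := by simp only [hD, rt_sq]
  have hsum2 : ∑ R ∈ s', (c R * rt (q R)) ^ 2 ≤ ∫⁻ p, H p := by
    calc ∑ R ∈ s', (c R * rt (q R)) ^ 2
        ≤ ∑ R ∈ s, ∫⁻ p, R.set.indicator (fun _ => c R ^ 2 * (volume R.set)⁻¹) p * (H p)⁻¹ := by
          refine (Finset.sum_le_sum fun R _ => ?_).trans
            (Finset.sum_le_sum_of_subset (Finset.filter_subset _ _))
          rw [mul_pow, rt_sq]
          simp only [hq, av]
          rw [← mul_assoc, ← lintegral_const_mul _ hHi, ← lintegral_indicator R.measurableSet_set]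
          refine le_of_eq (lintegral_congr fun p => ?_)
          by_cases hp : p ∈ R.set <;> simp [hp]
      _ = ∫⁻ p, sqFn s c p * (H p)⁻¹ := by
          rw [← lintegral_finsetSum]
          · simp only [sqFn, Finset.sum_mul]
          · intro R _
            exact (measurable_const.indicator R.measurableSet_set).mul hHm.inv
      _ ≤ ∫⁻ p, H p := by
          refine lintegral_mono fun p => ?_
          have : sqFn s c p = H p * H p := (rt_mul_rt _).symm
          simp only
          rw [this, mul_assoc]
          exact (mul_le_mul_right (ENNReal.mul_inv_le_one _) _).trans_eq (mul_one _)
  calc (∑ R ∈ s, φ R * c R) ^ 2 = (∑ R ∈ s', (φ R * rt (q R)⁻¹) * (c R * rt (q R))) ^ 2 := by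
        congr 1
        rw [hs', Finset.sum_filter]
        refine Finset.sum_congr rfl fun R hR => ?_
        split_ifs with hcR
        · have hR' : R ∈ s' := Finset.mem_filter.2 ⟨hR, hcR⟩
          have : rt (q R)⁻¹ * rt (q R) = 1 := by
            rw [← rt_mul, ENNReal.inv_mul_cancel (hq0 R hR') (hqtop R hR')]; simp [rt]
          calc φ R * c R = φ R * c R * (rt (q R)⁻¹ * rt (q R)) := by rw [this, mul_one]
            _ = _ := by ring
        · rw [not_not] at hcR
          simp [hcR]
    _ ≤ (A * (16 * ∫⁻ p, H p)) * ∫⁻ p, H p :=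
        (BidiscBMO.sq_sum_mul_le _ _ _).trans (mul_le_mul' hsum1 hsum2)
    _ = _ := by ring

/-- The absorption step of the quadratic estimates. It is the reason why they are proved for finite
sums, where `Q` is known to be finite. -/
lemma le_mul_of_sq_le_mul {Q c : ℝ≥0∞} (hQ : Q ≠ ⊤) (h : Q ^ 2 ≤ c * Q) : Q ≤ c := by
  by_cases h0 : Q = 0
  · simp [h0]
  rw [sq] at h
  exact (ENNReal.mul_le_mul_iff_left h0 hQ).1 h

/-- The square estimate for the paraproduct `Δ_φ`. -/
theorem lintegral_sq_sum_indicator_le {φ : Rect → ℝ≥0∞} {A : ℝ≥0∞}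
    (h : Carleson Rect.set (fun R => φ R ^ 2) A) (s : Finset Rect) (b : Rect → ℝ≥0∞)
    (hφ : ∀ R, φ R ≠ ⊤) (hb : ∀ R, b R ≠ ⊤) :
    ∫⁻ p, (∑ R ∈ s, R.set.indicator (fun _ => φ R * b R * (volume R.set)⁻¹) p) ^ 2
      ≤ 256 * A * ∑ R ∈ s, b R ^ 2 := by
  set G : T2 → ℝ≥0∞ := fun p => ∑ R ∈ s, R.set.indicator
    (fun _ => φ R * b R * (volume R.set)⁻¹) p with hG
  have hGm : Measurable G :=
    Finset.measurable_sum _ fun R _ => measurable_const.indicator R.measurableSet_set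
  set Q := ∫⁻ p, G p ^ 2 with hQ
  have hconst : ∀ R : Rect, φ R * b R * (volume R.set)⁻¹ ≠ ⊤ := fun R =>
    ENNReal.mul_ne_top (ENNReal.mul_ne_top (hφ R) (hb R)) (ENNReal.inv_ne_top.2 R.volume_set_ne_zero)
  obtain ⟨K, hK, hGK⟩ : ∃ K : ℝ≥0∞, K ≠ ⊤ ∧ ∀ p, G p ≤ K := by
    refine ⟨∑ R ∈ s, φ R * b R * (volume R.set)⁻¹, ENNReal.sum_ne_top.2 fun R _ => hconst R,
      fun p => Finset.sum_le_sum fun R _ => Set.indicator_le_self' (fun _ _ => bot_le) _⟩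
  have hQtop : Q ≠ ⊤ := by
    refine ne_top_of_le_ne_top (ENNReal.pow_ne_top hK (n := 2)) ?_
    calc Q ≤ ∫⁻ _ : T2, K ^ 2 := by
          refine lintegral_mono fun p => ?_
          exact pow_le_pow_left' (hGK p) 2
      _ = K ^ 2 := by simp
  -- Expanding only one factor of `G ^ 2` makes Q a linear form in φ, to which the duality applies.
  have hQeq : Q = ∑ R ∈ s, φ R * (b R * av R.set G) := by
    have : ∀ p, G p ^ 2 = ∑ R ∈ s, R.set.indicator
        (fun p => φ R * b R * (volume R.set)⁻¹ * G p) p := by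
      intro p
      rw [sq]
      nth_rewrite 1 [hG]
      rw [Finset.sum_mul]
      refine Finset.sum_congr rfl fun R _ => ?_
      by_cases hp : p ∈ R.set <;> simp [hp]
    simp_rw [hQ, this]
    rw [lintegral_finsetSum]
    · refine Finset.sum_congr rfl fun R _ => ?_
      rw [lintegral_indicator R.measurableSet_set, lintegral_const_mul _ hGm, av]
      ring
    · exact fun R _ => (hGm.const_mul _).indicator R.measurableSet_set
  have havtop : ∀ R : Rect, av R.set G ≠ ⊤ := by
    intro R
    refine ne_top_of_le_ne_top hK ?_
    calc av R.set G ≤ av R.set fun _ => K := av_mono R.measurableSet_set fun p _ => hGK p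
      _ = K := av_const R.volume_set_ne_zero R.volume_set_ne_top _
  have h1 := h.sq_sum_mul_le s (fun R => b R * av R.set G) fun R _ =>
    ENNReal.mul_ne_top (hb R) (havtop R)
  rw [← hQeq] at h1
  have hptw : ∀ p, rt (sqFn s (fun R => b R * av R.set G) p)
      ≤ rt (sqFn s b p) * maxFn Rect.set G p := by
    intro p
    rw [← rt_sq' (maxFn Rect.set G p), ← rt_mul]
    refine rt_mono ?_
    unfold sqFn
    rw [Finset.sum_mul]
    refine Finset.sum_le_sum fun R _ => ?_
    by_cases hp : p ∈ R.set
    · rw [Set.indicator_of_mem hp, Set.indicator_of_mem hp]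
      calc _ = b R ^ 2 * (volume R.set)⁻¹ * av R.set G ^ 2 := by ring
        _ ≤ _ := by gcongr; exact av_le_maxFn G hp
    · simp [hp]
  have h2 : (∫⁻ p, rt (sqFn s (fun R => b R * av R.set G) p)) ^ 2
      ≤ (∑ R ∈ s, b R ^ 2) * (16 * Q) := by
    calc _ ≤ (∫⁻ p, rt (sqFn s b p) * maxFn Rect.set G p) ^ 2 := by
          gcongr with p; exact hptw p
      _ ≤ (∫⁻ p, rt (sqFn s b p) ^ 2) * ∫⁻ p, maxFn Rect.set G p ^ 2 :=
          sq_lintegral_mul_le _ (measurable_rt.comp (measurable_sqFn s b))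
            (measurable_maxFn (fun R => R.measurableSet_set) G)
      _ ≤ _ := by
          gcongr
          · simp only [rt_sq, sqFn]
            rw [lintegral_finsetSum _ fun R _ => measurable_const.indicator R.measurableSet_set]
            refine Finset.sum_le_sum fun R _ => ?_
            rw [lintegral_indicator R.measurableSet_set, lintegral_const,
              Measure.restrict_apply_univ, mul_assoc,
              ENNReal.inv_mul_cancel R.volume_set_ne_zero R.volume_set_ne_top, mul_one]
          · exact lintegral_strong_maxFn_sq_le hGm
  refine le_mul_of_sq_le_mul hQtop (h1.trans ?_)
  calc _ ≤ 16 * A * ((∑ R ∈ s, b R ^ 2) * (16 * Q)) := by gcongr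
    _ = _ := by ring

end

section

/-! ### Mixed paraproducts: the local part -/

/-- Bilinear estimate for products of one-parameter means against a Carleson family. -/
theorem Carleson.sq_sum_mul_av_mul_av_le {φ : Rect → ℝ≥0∞} {A : ℝ≥0∞}
    (h : Carleson Rect.set (fun R => φ R ^ 2) A) (s : Finset Rect)
    {u g : DyadicInt → T → ℝ≥0∞} (hu : ∀ J, Measurable (u J)) (hg : ∀ I, Measurable (g I))
    (hu' : ∀ I J : DyadicInt, av I.set (u J) ≠ ⊤) (hg' : ∀ I J : DyadicInt, av J.set (g I) ≠ ⊤)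
    (𝓘 𝓙 : Finset DyadicInt) (hI : ∀ R ∈ s, R.1 ∈ 𝓘) (hJ : ∀ R ∈ s, R.2 ∈ 𝓙) :
    (∑ R ∈ s, φ R * (av R.1.set (u R.2) * av R.2.set (g R.1))) ^ 2
      ≤ 256 * A * (∑ J ∈ 𝓙, ∫⁻ x, u J x ^ 2) * ∑ I ∈ 𝓘, ∫⁻ x, g I x ^ 2 := by
  -- `U` maximizes in the first variable and `V` in the second. Each rectangle I × J contributes to
  -- the square function at most the (J, I) term of the product `U * V`, so no maximal function acts
  -- across both variables.
  set U : T2 → ℝ≥0∞ := fun p => ∑ J ∈ 𝓙, J.set.indicator (fun _ => (volume J.set)⁻¹) p.2 *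
    maxFn DyadicInt.set (u J) p.1 ^ 2 with hU
  set V : T2 → ℝ≥0∞ := fun p => ∑ I ∈ 𝓘, I.set.indicator (fun _ => (volume I.set)⁻¹) p.1 *
    maxFn DyadicInt.set (g I) p.2 ^ 2 with hV
  have hM : ∀ w : T → ℝ≥0∞, Measurable (maxFn DyadicInt.set w) :=
    measurable_maxFn DyadicInt.measurableSet_set
  have hind : ∀ J : DyadicInt, Measurable (J.set.indicator fun _ => (volume J.set)⁻¹) :=
    fun J => measurable_const.indicator J.measurableSet_set
  have hUJ : ∀ J, Measurable fun p : T2 => J.set.indicator (fun _ => (volume J.set)⁻¹) p.2 *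
      maxFn DyadicInt.set (u J) p.1 ^ 2 := fun J =>
    ((hind J).comp measurable_snd).mul (((hM _).comp measurable_fst).pow_const 2)
  have hVI : ∀ I, Measurable fun p : T2 => I.set.indicator (fun _ => (volume I.set)⁻¹) p.1 *
      maxFn DyadicInt.set (g I) p.2 ^ 2 := fun I =>
    ((hind I).comp measurable_fst).mul (((hM _).comp measurable_snd).pow_const 2)
  have hUm : Measurable U := Finset.measurable_sum _ fun J _ => hUJ J
  have hVm : Measurable V := Finset.measurable_sum _ fun I _ => hVI I
  have hone : ∀ J : DyadicInt, ∫⁻ t, J.set.indicator (fun _ => (volume J.set)⁻¹) t = 1 := by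
    intro J
    rw [lintegral_indicator J.measurableSet_set, lintegral_const, Measure.restrict_apply_univ,
      ENNReal.inv_mul_cancel J.volume_set_ne_zero J.volume_set_ne_top]
  have hUint : ∫⁻ p, U p ≤ 4 * ∑ J ∈ 𝓙, ∫⁻ x, u J x ^ 2 := by
    rw [hU, lintegral_finsetSum _ fun J _ => hUJ J, Finset.mul_sum]
    refine Finset.sum_le_sum fun J _ => ?_
    rw [Measure.volume_eq_prod]
    simp_rw [mul_comm (J.set.indicator _ _)]
    rw [lintegral_prod_mul (f := fun x => maxFn DyadicInt.set (u J) x ^ 2)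
      ((hM _).pow_const 2).aemeasurable (hind J).aemeasurable, hone, mul_one]
    exact lintegral_maxFn_sq_le (hu J)
  have hVint : ∫⁻ p, V p ≤ 4 * ∑ I ∈ 𝓘, ∫⁻ x, g I x ^ 2 := by
    rw [hV, lintegral_finsetSum _ fun I _ => hVI I, Finset.mul_sum]
    refine Finset.sum_le_sum fun I _ => ?_
    rw [Measure.volume_eq_prod, lintegral_prod_mul (g := fun x => maxFn DyadicInt.set (g I) x ^ 2)
      (hind I).aemeasurable ((hM _).pow_const 2).aemeasurable, hone, one_mul]
    exact lintegral_maxFn_sq_le (hg I)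
  have hptw : ∀ p, sqFn s (fun R => av R.1.set (u R.2) * av R.2.set (g R.1)) p ≤ U p * V p := by
    intro p
    rw [hU, hV, Finset.sum_mul_sum, Finset.sum_comm, ← Finset.sum_product']
    refine (Finset.sum_le_sum fun R _ => ?_).trans (Finset.sum_le_sum_of_subset fun R hR =>
      Finset.mem_product.2 ⟨hI R hR, hJ R hR⟩)
    by_cases hp : p ∈ R.set
    · have hp1 : p.1 ∈ R.1.set := hp.1
      have hp2 : p.2 ∈ R.2.set := hp.2
      rw [Set.indicator_of_mem hp, Set.indicator_of_mem hp1, Set.indicator_of_mem hp2,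
        R.volume_set, ENNReal.mul_inv (Or.inl R.1.volume_set_ne_zero)
        (Or.inl R.1.volume_set_ne_top), mul_pow]
      calc _ = (volume R.2.set)⁻¹ * av R.1.set (u R.2) ^ 2 *
            ((volume R.1.set)⁻¹ * av R.2.set (g R.1) ^ 2) := by ring
        _ ≤ _ := by
            gcongr
            · exact av_le_maxFn _ hp1
            · exact av_le_maxFn _ hp2
    · rw [Set.indicator_of_notMem hp]; exact bot_le
  calc _ ≤ 16 * A * (∫⁻ p, rt (sqFn s (fun R => av R.1.set (u R.2) * av R.2.set (g R.1)) p)) ^ 2 :=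
        h.sq_sum_mul_le s _ fun R _ => ENNReal.mul_ne_top (hu' _ _) (hg' _ _)
    _ ≤ 16 * A * (∫⁻ p, rt (U p) * rt (V p)) ^ 2 := by
        gcongr with p
        rw [← rt_mul]
        exact rt_mono (hptw p)
    _ ≤ 16 * A * ((∫⁻ p, rt (U p) ^ 2) * ∫⁻ p, rt (V p) ^ 2) := by
        gcongr
        exact sq_lintegral_mul_le _ (measurable_rt.comp hUm) (measurable_rt.comp hVm)
    _ ≤ 16 * A * ((4 * ∑ J ∈ 𝓙, ∫⁻ x, u J x ^ 2) * (4 * ∑ I ∈ 𝓘, ∫⁻ x, g I x ^ 2)) := by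
        simp only [rt_sq]
        gcongr
    _ = _ := by ring

section haarSum

variable {𝕜 : Type*} [RCLike 𝕜]

/-- A finite one-variable Haar sum. -/
def haarSum (s : Finset DyadicInt) (a : DyadicInt → 𝕜) (x : T) : 𝕜 :=
  ∑ K ∈ s, a K * ((haar K x : ℝ) : 𝕜)

lemma measurable_haarSum (s : Finset DyadicInt) (a : DyadicInt → 𝕜) :
    Measurable (haarSum s a) :=
  Finset.measurable_sum _ fun K _ =>
    (RCLike.measurable_ofReal.comp (measurable_haar K)).const_mul _

lemma integrable_haar_mul_haar (I K : DyadicInt) : Integrable fun x => haar I x * haar K x := by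
  refine integrable_of_bdd ((measurable_haar I).mul (measurable_haar K))
    ⟨((Real.sqrt I.len)⁻¹ * 2) * ((Real.sqrt K.len)⁻¹ * 2), fun x => ?_⟩
  rw [abs_mul]
  exact mul_le_mul (abs_haar_le I x) (abs_haar_le K x) (abs_nonneg _) (by positivity)

lemma lintegral_haarSum_sq (s : Finset DyadicInt) (a : DyadicInt → 𝕜) :
    ∫⁻ x, ‖haarSum s a x‖ₑ ^ 2 = ∑ K ∈ s, ‖a K‖ₑ ^ 2 := by
  have h1 : ∀ x, ‖haarSum s a x‖ ^ 2 = ∑ K ∈ s, ∑ L ∈ s,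
      RCLike.re (starRingEnd 𝕜 (a K) * a L) * (haar K x * haar L x) := by
    intro x
    have h2 : ((‖haarSum s a x‖ ^ 2 : ℝ) : 𝕜) = ∑ K ∈ s, ∑ L ∈ s,
        (starRingEnd 𝕜 (a K) * a L) * ((haar K x * haar L x : ℝ) : 𝕜) := by
      push_cast
      rw [← RCLike.conj_mul, haarSum, map_sum, Finset.sum_mul_sum]
      refine Finset.sum_congr rfl fun K _ => Finset.sum_congr rfl fun L _ => ?_
      rw [map_mul, RCLike.conj_ofReal]
      ring
    have h3 := congrArg RCLike.re h2
    rw [RCLike.ofReal_re] at h3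
    rw [h3]
    simp only [map_sum]
    refine Finset.sum_congr rfl fun K _ => Finset.sum_congr rfl fun L _ => ?_
    rw [mul_comm, RCLike.re_ofReal_mul, mul_comm]
  have h2 : ∫ x, ‖haarSum s a x‖ ^ 2 = ∑ K ∈ s, ‖a K‖ ^ 2 := by
    simp_rw [h1]
    rw [integral_finsetSum _ fun K _ => integrable_finsetSum _ fun L _ =>
      (integrable_haar_mul_haar K L).const_mul _]
    refine Finset.sum_congr rfl fun K hK => ?_
    rw [integral_finsetSum _ fun L _ => (integrable_haar_mul_haar K L).const_mul _]
    simp_rw [integral_const_mul, integral_haar_mul_haar]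
    simp only [mul_ite, mul_one, mul_zero, Finset.sum_ite_eq, hK, if_true]
    rw [RCLike.conj_mul, ← RCLike.ofReal_pow, RCLike.ofReal_re]
  have hint : Integrable fun x => ‖haarSum s a x‖ ^ 2 := by
    simp_rw [h1]
    exact integrable_finsetSum _ fun K _ => integrable_finsetSum _ fun L _ =>
      (integrable_haar_mul_haar K L).const_mul _
  have h3 : ∀ y : 𝕜, ‖y‖ₑ ^ 2 = ENNReal.ofReal (‖y‖ ^ 2) := fun y => by
    rw [ENNReal.ofReal_pow (norm_nonneg _), ofReal_norm]
  simp_rw [h3]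
  rw [← ofReal_integral_eq_lintegral_ofReal hint (Filter.Eventually.of_forall fun x => by positivity),
    h2, ENNReal.ofReal_sum_of_nonneg fun K _ => by positivity]

lemma av_haarSum_ne_top (s : Finset DyadicInt) (a : DyadicInt → 𝕜) (I : DyadicInt) :
    av I.set (fun x => ‖haarSum s a x‖ₑ) ≠ ⊤ := by
  have h1 := sq_av_le I.volume_set_ne_zero I.volume_set_ne_top (measurable_haarSum s a).enorm
  have h2 : av I.set (fun x => ‖haarSum s a x‖ₑ ^ 2) ≠ ⊤ := by
    refine ENNReal.mul_ne_top (ENNReal.inv_ne_top.2 I.volume_set_ne_zero)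
      (ne_top_of_le_ne_top ?_ (setLIntegral_le_lintegral _ _))
    rw [lintegral_haarSum_sq]
    exact ENNReal.sum_ne_top.2 fun K _ => ENNReal.pow_ne_top enorm_ne_top
  intro h3
  rw [h3, ENNReal.top_pow two_ne_zero, top_le_iff] at h1
  exact h2 h1

/-- The mean of a Haar sum over `I` is the sum over the Haar functions that live on strictly
larger intervals. -/
lemma enorm_sum_le_av_haarSum (s : Finset DyadicInt) (a : DyadicInt → 𝕜) {I : DyadicInt} {p : T}
    (hp : p ∈ I.set) :
    ‖∑ K ∈ s with K.1 < I.1, a K * ((haar K p : ℝ) : 𝕜)‖ₑ ≤ av I.set fun x => ‖haarSum s a x‖ₑ := by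
  have hint : ∀ K, Integrable (fun x => ((haar K x : ℝ) : 𝕜)) (volume.restrict I.set) :=
    fun K => ((integrable_haar K).ofReal).restrict
  have h1 : ∫ x in I.set, haarSum s a x
      = ((I.len : ℝ) : 𝕜) * ∑ K ∈ s with K.1 < I.1, a K * ((haar K p : ℝ) : 𝕜) := by
    unfold haarSum
    rw [integral_finsetSum _ fun K _ => (hint K).const_mul _, Finset.mul_sum, Finset.sum_filter]
    refine Finset.sum_congr rfl fun K _ => ?_
    rw [integral_const_mul, integral_ofReal]
    split_ifs with h
    · rw [setIntegral_haar_of_lt h hp]; push_cast; ring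
    · rw [setIntegral_haar_of_le (not_lt.1 h)]; simp
  have h2 := enorm_integral_le_lintegral_enorm (μ := volume.restrict I.set) (haarSum s a)
  rw [h1, enorm_mul] at h2
  have h3 : ‖((I.len : ℝ) : 𝕜)‖ₑ = volume I.set := by
    rw [I.volume_set, ← ofReal_norm, RCLike.norm_ofReal, abs_of_pos I.len_pos]
  rw [h3] at h2
  unfold av
  calc _ = (volume I.set)⁻¹ * (volume I.set * ‖∑ K ∈ s with K.1 < I.1, a K * ((haar K p : ℝ) : 𝕜)‖ₑ) := by
        rw [← mul_assoc, ENNReal.inv_mul_cancel I.volume_set_ne_zero I.volume_set_ne_top, one_mul]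
    _ ≤ _ := by gcongr

end haarSum

end

section

/-! ### Mixed paraproducts: the layers of a family of rectangles -/

/-- The union of the rectangles of `𝓖` whose first side has level below `k`. -/
def below (𝓖 : Finset Rect) (k : ℕ) : Set T2 := ⋃ R ∈ 𝓖.filter fun R => R.1.1 < k, R.set

lemma mem_below {𝓖 : Finset Rect} {k : ℕ} {p : T2} :
    p ∈ below 𝓖 k ↔ ∃ R ∈ 𝓖, R.1.1 < k ∧ p ∈ R.set := by
  simp only [below, Set.mem_iUnion, Finset.mem_filter, exists_prop, and_assoc]

lemma measurableSet_below (𝓖 : Finset Rect) (k : ℕ) : MeasurableSet (below 𝓖 k) :=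
  Finset.measurableSet_biUnion _ fun R _ => R.measurableSet_set

lemma below_mono (𝓖 : Finset Rect) {k l : ℕ} (h : k ≤ l) : below 𝓖 k ⊆ below 𝓖 l := by
  intro p hp
  obtain ⟨R, hR, h1, h2⟩ := mem_below.1 hp
  exact mem_below.2 ⟨R, hR, h1.trans_le h, h2⟩

/-- A first side of level less than `k` has level at most `I.1`, so it contains I as soon as it
meets I. -/
lemma mem_below_congr {𝓖 : Finset Rect} {k : ℕ} {I : DyadicInt} (hk : k ≤ I.1 + 1) {x y t : T}
    (hx : x ∈ I.set) (hy : y ∈ I.set) : (x, t) ∈ below 𝓖 k ↔ (y, t) ∈ below 𝓖 k := by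
  have key : ∀ x y : T, x ∈ I.set → y ∈ I.set → (x, t) ∈ below 𝓖 k → (y, t) ∈ below 𝓖 k := by
    intro x y hx hy h
    obtain ⟨R, hR, h1, h2⟩ := mem_below.1 h
    refine mem_below.2 ⟨R, hR, h1, ?_, h2.2⟩
    exact set_subset_of_mem (by omega) hx h2.1 hy
  exact ⟨key x y hx hy, key y x hy hx⟩

/-- Once `k` exceeds the level of `R.1`, the rectangle R is itself part of the union; before that
only coarser first sides occur. -/
lemma mem_below_of_mem {𝓖 : Finset Rect} {R : Rect} (hR : R ∈ 𝓖) {k : ℕ} {x y t : T}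
    (hx : x ∈ R.1.set) (hy : y ∈ R.1.set) (ht : t ∈ R.2.set) :
    (x, t) ∈ below 𝓖 k ↔ (y, t) ∈ below 𝓖 k := by
  by_cases hk : R.1.1 < k
  · exact iff_of_true (mem_below.2 ⟨R, hR, hk, hx, ht⟩) (mem_below.2 ⟨R, hR, hk, hy, ht⟩)
  · exact mem_below_congr (by omega) hx hy

/-- The part of `⋃ 𝓖` that is first covered at levels in `[16 ^ m, 16 ^ (m + 1))`. -/
def layer (𝓖 : Finset Rect) (m : ℕ) : Set T2 := below 𝓖 (16 ^ (m + 1)) \ below 𝓖 (16 ^ m)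

/-- The indicator function of a layer. -/
def layerFn (𝓖 : Finset Rect) (m : ℕ) : T2 → ℝ≥0∞ := (layer 𝓖 m).indicator fun _ => 1

lemma measurableSet_layer (𝓖 : Finset Rect) (m : ℕ) : MeasurableSet (layer 𝓖 m) :=
  (measurableSet_below _ _).diff (measurableSet_below _ _)

lemma measurable_layerFn (𝓖 : Finset Rect) (m : ℕ) : Measurable (layerFn 𝓖 m) :=
  measurable_const.indicator (measurableSet_layer 𝓖 m)

lemma layerFn_sq (𝓖 : Finset Rect) (m : ℕ) (p : T2) : layerFn 𝓖 m p ^ 2 = layerFn 𝓖 m p := by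
  by_cases h : p ∈ layer 𝓖 m <;> simp [layerFn, h]

lemma layer_unique {𝓖 : Finset Rect} {m n : ℕ} {p : T2} (hm : p ∈ layer 𝓖 m)
    (hn : p ∈ layer 𝓖 n) : m = n := by
  by_contra hne
  rcases Nat.lt_or_gt_of_ne hne with h | h
  · exact hn.2 (below_mono 𝓖 (Nat.pow_le_pow_right (by norm_num) h) hm.1)
  · exact hm.2 (below_mono 𝓖 (Nat.pow_le_pow_right (by norm_num) h) hn.1)

lemma sum_layerFn_le (𝓖 : Finset Rect) (N j : ℕ) (p : T2) :
    ∑ n ∈ Finset.range N, layerFn 𝓖 (n + j) p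
      ≤ (⋃ R ∈ 𝓖, R.set).indicator (fun _ => 1) p := by
  by_cases h : ∃ n ∈ Finset.range N, p ∈ layer 𝓖 (n + j)
  · obtain ⟨n, hn, hp⟩ := h
    rw [Finset.sum_eq_single_of_mem n hn]
    · obtain ⟨R, hR, -, h2⟩ := mem_below.1 hp.1
      rw [layerFn, Set.indicator_of_mem hp, Set.indicator_of_mem (Set.mem_iUnion₂.2 ⟨R, hR, h2⟩)]
    · intro k _ hk
      refine Set.indicator_of_notMem (fun h2 => hk ?_) _
      have := layer_unique hp h2
      omega
  · push Not at h
    rw [Finset.sum_eq_zero fun n hn => show layerFn 𝓖 (n + j) p = 0 from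
      Set.indicator_of_notMem (h n hn) _]
    exact bot_le

/-- A point not yet covered at stage `n` has a first stage of covering, and it lies in the layer
ending there. -/
lemma one_le_sum_layerFn {𝓖 : Finset Rect} {N n : ℕ} {p : T2} (hp : p ∈ below 𝓖 (16 ^ N)) :
    1 ≤ (below 𝓖 (16 ^ n)).indicator (fun _ => 1) p
      + ∑ j ∈ Finset.range N, layerFn 𝓖 (n + j) p := by
  by_cases h : p ∈ below 𝓖 (16 ^ n)
  · rw [Set.indicator_of_mem h]; exact le_self_add
  · have hex : ∃ j, p ∈ below 𝓖 (16 ^ (n + j)) :=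
      ⟨N, below_mono 𝓖 (Nat.pow_le_pow_right (by norm_num) (Nat.le_add_left _ _)) hp⟩
    classical
    have hspec := Nat.find_spec hex
    set j := Nat.find hex with hj
    have hj0 : j ≠ 0 := by
      intro h0
      rw [h0] at hspec
      exact h hspec
    obtain ⟨i, hi⟩ := Nat.exists_eq_succ_of_ne_zero hj0
    have hnot : p ∉ below 𝓖 (16 ^ (n + i)) := Nat.find_min hex (by omega)
    have hiN : i < N := by
      have h1 : j ≤ N := Nat.find_min' hex
        (below_mono 𝓖 (Nat.pow_le_pow_right (by norm_num) (Nat.le_add_left _ _)) hp)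
      omega
    have hmem : p ∈ layer 𝓖 (n + i) := ⟨by rw [hi] at hspec; exact hspec, hnot⟩
    calc (1 : ℝ≥0∞) = layerFn 𝓖 (n + i) p := by rw [layerFn, Set.indicator_of_mem hmem]
      _ ≤ ∑ j ∈ Finset.range N, layerFn 𝓖 (n + j) p :=
          Finset.single_le_sum (f := fun j => layerFn 𝓖 (n + j) p) (fun _ _ => bot_le)
            (Finset.mem_range.2 hiN)
      _ ≤ _ := le_add_self

/-- The proportion of `J` on which the section of a layer over `I` lives. -/
def gam (𝓖 : Finset Rect) (m : ℕ) (R : Rect) : ℝ≥0∞ :=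
  av R.2.set fun t => layerFn 𝓖 m (R.1.pt, t)

lemma layerFn_congr {𝓖 : Finset Rect} {R : Rect} (hR : R ∈ 𝓖) {m : ℕ} {x y t : T}
    (hx : x ∈ R.1.set) (hy : y ∈ R.1.set) (ht : t ∈ R.2.set) :
    layerFn 𝓖 m (x, t) = layerFn 𝓖 m (y, t) := by
  have h1 := mem_below_of_mem hR (k := 16 ^ (m + 1)) hx hy ht
  have h2 := mem_below_of_mem hR (k := 16 ^ m) hx hy ht
  have h3 : (x, t) ∈ layer 𝓖 m ↔ (y, t) ∈ layer 𝓖 m := by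
    simp only [layer, Set.mem_sdiff, h1, h2]
  by_cases h : (y, t) ∈ layer 𝓖 m
  · rw [layerFn, Set.indicator_of_mem h, Set.indicator_of_mem (h3.2 h)]
  · rw [layerFn, Set.indicator_of_notMem h, Set.indicator_of_notMem fun h4 => h (h3.1 h4)]

/-- Over a rectangle of 𝓖 a layer does not depend on the first variable. The one-variable density is
thus a mean over R, within reach of the strong maximal theorem. -/
lemma gam_le_av {𝓖 : Finset Rect} {R : Rect} (hR : R ∈ 𝓖) (m : ℕ) :
    gam 𝓖 m R ≤ av R.set (layerFn 𝓖 m) := by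
  rw [av_rect (measurable_layerFn 𝓖 m),
    ← av_const R.1.volume_set_ne_zero R.1.volume_set_ne_top (gam 𝓖 m R)]
  refine av_mono R.1.measurableSet_set fun s hs => ?_
  refine av_mono R.2.measurableSet_set fun t ht => ?_
  rw [layerFn_congr hR R.1.pt_mem hs ht]

/-- Such an R was covered before the layer begins. Only rectangles of level at least `16 ^ m` see
the layer, and on these the logarithmic condition gains `16 ^ m`. -/
lemma gam_eq_zero {𝓖 : Finset Rect} {R : Rect} (hR : R ∈ 𝓖) {m : ℕ} (h : R.1.1 < 16 ^ m) :
    gam 𝓖 m R = 0 := by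
  refine le_antisymm ?_ bot_le
  calc gam 𝓖 m R ≤ av R.2.set fun _ => 0 := by
        refine av_mono R.2.measurableSet_set fun t ht => ?_
        have : (R.1.pt, t) ∉ layer 𝓖 m := fun h2 =>
          h2.2 (mem_below.2 ⟨R, hR, h, R.1.pt_mem, ht⟩)
        rw [layerFn, Set.indicator_of_notMem this]
    _ = 0 := by simp [av]

lemma sum_inv_pow_four_le (N : ℕ) : ∑ j ∈ Finset.range N, ((4 : ℝ≥0∞) ^ j)⁻¹ ≤ 2 := by
  calc ∑ j ∈ Finset.range N, ((4 : ℝ≥0∞) ^ j)⁻¹ ≤ ∑ j ∈ Finset.range N, ((2 : ℝ≥0∞)⁻¹) ^ j := by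
        refine Finset.sum_le_sum fun j _ => ?_
        rw [← ENNReal.inv_pow]
        gcongr
        norm_num
    _ ≤ ∑' j, ((2 : ℝ≥0∞)⁻¹) ^ j := ENNReal.sum_le_tsum _
    _ = 2 := by rw [ENNReal.tsum_geometric, ENNReal.one_sub_inv_two, inv_inv]

lemma inv_mul_cancel_pow {a : ℕ} (ha : a ≠ 0) (n : ℕ) :
    ((a : ℝ≥0∞) ^ n)⁻¹ * (a : ℝ≥0∞) ^ n = 1 :=
  ENNReal.inv_mul_cancel (pow_ne_zero _ (by exact_mod_cast ha))
    (ENNReal.pow_ne_top (ENNReal.natCast_ne_top a))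

/-- The vanishing of logarithmic oscillation, summed over the layers. -/
lemma sum_layers_le {φ : Rect → ℝ≥0∞} {L : ℝ≥0∞}
    (hφ : ∀ i : ℕ, Carleson Rect.set (fun R => if i ≤ R.1.1 then φ R ^ 2 else 0)
      ((L * (1 / ((i : ℝ≥0∞) + 1))) ^ 2)) (𝓖 : Finset Rect) (N : ℕ) :
    ∑ R ∈ 𝓖, ∑ n ∈ Finset.range N, ∑ j ∈ Finset.range N,
      (2 ^ j * 4 ^ (2 * n + j) * (φ R * gam 𝓖 (n + j) R)) ^ 2
      ≤ 32 * L ^ 2 * volume (⋃ R ∈ 𝓖, R.set) := by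
  have h1 : ∀ m, ∑ R ∈ 𝓖, (φ R * gam 𝓖 m R) ^ 2
      ≤ 16 * L ^ 2 * ((256 : ℝ≥0∞) ^ m)⁻¹ * ∫⁻ p, layerFn 𝓖 m p := by
    intro m
    have hm := (hφ (16 ^ m)).sum_mul_sq_av_le (fun R => R.measurableSet_set) 𝓖 (layerFn 𝓖 m)
    calc ∑ R ∈ 𝓖, (φ R * gam 𝓖 m R) ^ 2
        ≤ ∑ R ∈ 𝓖, (if 16 ^ m ≤ R.1.1 then φ R ^ 2 else 0) * av R.set (layerFn 𝓖 m) ^ 2 := by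
          refine Finset.sum_le_sum fun R hR => ?_
          split_ifs with h
          · rw [mul_pow]; gcongr; exact gam_le_av hR m
          · rw [gam_eq_zero hR (not_le.1 h)]; simp
      _ ≤ _ := hm
      _ ≤ (L ^ 2 * ((256 : ℝ≥0∞) ^ m)⁻¹) * (16 * ∫⁻ p, layerFn 𝓖 m p ^ 2) := by
          gcongr
          · rw [mul_pow]
            gcongr
            rw [one_div, ← ENNReal.inv_pow, ENNReal.inv_le_inv]
            push_cast
            calc (256 : ℝ≥0∞) ^ m = (16 ^ m) ^ 2 := by rw [← pow_mul, mul_comm, pow_mul]; norm_num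
              _ ≤ _ := by gcongr; exact le_self_add
          · exact lintegral_strong_maxFn_sq_le (measurable_layerFn 𝓖 m)
      _ = _ := by simp only [layerFn_sq]; ring
  have h2 : ∀ j, ∑ n ∈ Finset.range N, ∫⁻ p, layerFn 𝓖 (n + j) p ≤ volume (⋃ R ∈ 𝓖, R.set) := by
    intro j
    rw [← lintegral_finsetSum _ fun n _ => measurable_layerFn 𝓖 _]
    calc _ ≤ ∫⁻ p, (⋃ R ∈ 𝓖, R.set).indicator (fun _ => 1) p :=
          lintegral_mono fun p => sum_layerFn_le 𝓖 N j p
      _ = _ := by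
          rw [lintegral_indicator (Finset.measurableSet_biUnion _ fun R _ => R.measurableSet_set)]
          simp
  calc _ = ∑ j ∈ Finset.range N, ∑ n ∈ Finset.range N, ∑ R ∈ 𝓖,
        (2 ^ j * 4 ^ (2 * n + j) * (φ R * gam 𝓖 (n + j) R)) ^ 2 := by
        rw [Finset.sum_comm, Finset.sum_congr rfl fun n _ => Finset.sum_comm, Finset.sum_comm]
    _ ≤ ∑ j ∈ Finset.range N, ∑ n ∈ Finset.range N,
        16 * L ^ 2 * ((4 : ℝ≥0∞) ^ j)⁻¹ * ∫⁻ p, layerFn 𝓖 (n + j) p := by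
        refine Finset.sum_le_sum fun j _ => Finset.sum_le_sum fun n _ => ?_
        have e : ∀ R ∈ 𝓖, (2 ^ j * 4 ^ (2 * n + j) * (φ R * gam 𝓖 (n + j) R)) ^ 2
            = (2 ^ j * 4 ^ (2 * n + j)) ^ 2 * (φ R * gam 𝓖 (n + j) R) ^ 2 :=
          fun R _ => mul_pow _ _ _
        rw [Finset.sum_congr rfl e, ← Finset.mul_sum]
        calc _ ≤ (2 ^ j * 4 ^ (2 * n + j)) ^ 2 *
              (16 * L ^ 2 * ((256 : ℝ≥0∞) ^ (n + j))⁻¹ * ∫⁻ p, layerFn 𝓖 (n + j) p) := by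
              gcongr; exact h1 _
          _ = (((256 : ℝ≥0∞) ^ (n + j))⁻¹ * 256 ^ (n + j)) * (((4 : ℝ≥0∞) ^ j)⁻¹ *
              (16 * L ^ 2 * ∫⁻ p, layerFn 𝓖 (n + j) p)) := by
              -- The weight is chosen so that its square cancels the gain 256^(-(n+j)) up to 4^(-j).
              -- What remains is summable in `j`, while the sum over `n` uses the disjointness of
              -- the layers.
              have h3 : ((2 : ℝ≥0∞) ^ j * 4 ^ (2 * n + j)) ^ 2 =
                  256 ^ (n + j) * ((4 : ℝ≥0∞) ^ j)⁻¹ := by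
                have h4 : ((2 : ℝ≥0∞) ^ j * 4 ^ (2 * n + j)) ^ 2 * 4 ^ j = 256 ^ (n + j) := by
                  rw [show (256 : ℝ≥0∞) = 2 ^ 8 by norm_num, show (4 : ℝ≥0∞) = 2 ^ 2 by norm_num]
                  simp only [← pow_mul, ← pow_add]
                  congr 1
                  ring
                rw [← h4, mul_assoc, ENNReal.mul_inv_cancel (by simp) (by simp), mul_one]
              rw [h3]; ring
          _ = _ := by
              have := inv_mul_cancel_pow (a := 256) (by norm_num) (n + j)
              push_cast at this
              rw [this]; ring
    _ ≤ ∑ j ∈ Finset.range N, 16 * L ^ 2 * ((4 : ℝ≥0∞) ^ j)⁻¹ * volume (⋃ R ∈ 𝓖, R.set) := by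
        refine Finset.sum_le_sum fun j _ => ?_
        rw [← Finset.mul_sum]
        gcongr
        exact h2 j
    _ = 16 * L ^ 2 * (∑ j ∈ Finset.range N, ((4 : ℝ≥0∞) ^ j)⁻¹) * volume (⋃ R ∈ 𝓖, R.set) := by
        rw [Finset.mul_sum, Finset.sum_mul]
    _ ≤ 16 * L ^ 2 * 2 * volume (⋃ R ∈ 𝓖, R.set) := by
        gcongr; exact sum_inv_pow_four_le N
    _ = _ := by ring

end

section

/-! ### Mixed paraproducts: growth of the means -/

/-- The levels `k` with `16 ^ n ≤ k + 1 < 16 ^ (n + 1)`. -/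
def blk (n : ℕ) : Finset ℕ := Finset.Ico (16 ^ n - 1) (16 ^ (n + 1) - 1)

lemma sum_range_eq_sum_blk (h : ℕ → ℝ≥0∞) (N : ℕ) :
    ∑ k ∈ Finset.range (16 ^ N - 1), h k = ∑ n ∈ Finset.range N, ∑ k ∈ blk n, h k := by
  induction N with
  | zero => simp
  | succ N ih =>
    rw [Finset.sum_range_succ, ← ih, blk, Finset.sum_range_add_sum_Ico]
    have : 16 ^ N ≤ 16 ^ (N + 1) := Nat.pow_le_pow_right (by norm_num) (Nat.le_succ N)
    omega

variable {𝕜 : Type*} [RCLike 𝕜]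

/-- The sum of the sizes at `x` of the Haar terms of `f(·, J)` with levels in a block. -/
def blkSum (f : Rect → 𝕜) (x : T) (n : ℕ) (J : DyadicInt) : ℝ≥0∞ :=
  ∑ k ∈ blk n, ‖haar (ix k x) x‖ₑ * ‖f (ix k x, J)‖ₑ

lemma enorm_haar_sq {K : DyadicInt} {x : T} (hx : x ∈ K.set) :
    ‖haar K x‖ₑ ^ 2 = (volume K.set)⁻¹ := by
  rw [K.volume_set, ← ENNReal.ofReal_inv_of_pos K.len_pos, ← ofReal_norm, Real.norm_eq_abs,
    ← ENNReal.ofReal_pow (abs_nonneg _), sq_abs, sq, haar_mul_self, Set.indicator_of_mem hx]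

/-- The two-parameter condition is tested on rectangles with common first side K. Their union is a
product, and |K| cancels. -/
lemma carleson_section {f : Rect → 𝕜} {A : ℝ≥0∞}
    (hf : Carleson Rect.set (fun R => ‖f R‖ₑ ^ 2) A) (K : DyadicInt) :
    Carleson DyadicInt.set (fun J => (volume K.set)⁻¹ * ‖f (K, J)‖ₑ ^ 2) A := by
  classical
  intro s
  have h := hf (s.map ⟨fun J => (K, J), fun _ _ h => (Prod.mk.inj h).2⟩)
  rw [Finset.sum_map] at h
  have hset : (⋃ R ∈ s.map ⟨fun J => ((K, J) : Rect), fun _ _ h => (Prod.mk.inj h).2⟩, Rect.set R)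
      = K.set ×ˢ ⋃ J ∈ s, J.set := by
    ext p
    simp only [Finset.mem_map, Set.mem_iUnion, exists_prop,
      Rect.set, Set.mem_prod]
    constructor
    · rintro ⟨R, ⟨J, hJ, rfl⟩, h1, h2⟩
      exact ⟨h1, J, hJ, h2⟩
    · rintro ⟨h1, J, hJ, h2⟩
      exact ⟨_, ⟨J, hJ, rfl⟩, h1, h2⟩
  rw [hset, Measure.volume_eq_prod, Measure.prod_prod] at h
  calc _ = (volume K.set)⁻¹ * ∑ J ∈ s, ‖f (K, J)‖ₑ ^ 2 := by rw [Finset.mul_sum]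
    _ ≤ (volume K.set)⁻¹ * (A * (volume K.set * volume (⋃ J ∈ s, J.set))) := by
        gcongr; exact h
    _ = ((volume K.set)⁻¹ * volume K.set) * (A * volume (⋃ J ∈ s, J.set)) := by ring
    _ = _ := by
        rw [ENNReal.inv_mul_cancel K.volume_set_ne_zero K.volume_set_ne_top, one_mul]

/-- A block has at most `16 * 16 ^ n` levels. This number enters once through Cauchy–Schwarz and
once through the sum over levels of the packing constants of the sections, whence `256 ^ n`. It
quantifies the logarithmic growth of BMO means. -/
lemma carleson_blkSum {f : Rect → 𝕜} {F : ℝ≥0∞}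
    (hf : Carleson Rect.set (fun R => ‖f R‖ₑ ^ 2) (F ^ 2)) (x : T) (n : ℕ) :
    Carleson DyadicInt.set (fun J => blkSum f x n J ^ 2) (256 * 256 ^ n * F ^ 2) := by
  have hcard : ((blk n).card : ℝ≥0∞) ≤ 16 * 16 ^ n := by
    have : (blk n).card ≤ 16 * 16 ^ n := by
      rw [blk, Nat.card_Ico, pow_succ]; omega
    exact_mod_cast this
  intro s
  calc ∑ J ∈ s, blkSum f x n J ^ 2
      ≤ ∑ J ∈ s, (16 * 16 ^ n) * ∑ k ∈ blk n,
        (volume (ix k x).set)⁻¹ * ‖f (ix k x, J)‖ₑ ^ 2 := by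
        refine Finset.sum_le_sum fun J _ => ?_
        have h := sq_sum_mul_le (blk n) (fun _ => 1)
          (fun k => ‖haar (ix k x) x‖ₑ * ‖f (ix k x, J)‖ₑ)
        simp only [one_mul, one_pow, Finset.sum_const, nsmul_eq_mul, mul_one, mul_pow,
          enorm_haar_sq (DyadicInt.mem_ix _ x)] at h
        exact h.trans (by gcongr)
    _ = (16 * 16 ^ n) * ∑ k ∈ blk n, ∑ J ∈ s,
        (volume (ix k x).set)⁻¹ * ‖f (ix k x, J)‖ₑ ^ 2 := by
        rw [← Finset.mul_sum, Finset.sum_comm]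
    _ ≤ (16 * 16 ^ n) * ∑ k ∈ blk n, F ^ 2 * volume (⋃ J ∈ s, J.set) := by
        gcongr with k _
        exact carleson_section hf (ix k x) s
    _ = (16 * 16 ^ n) * ((blk n).card * (F ^ 2 * volume (⋃ J ∈ s, J.set))) := by
        rw [Finset.sum_const, nsmul_eq_mul]
    _ ≤ (16 * 16 ^ n) * ((16 * 16 ^ n) * (F ^ 2 * volume (⋃ J ∈ s, J.set))) := by gcongr
    _ = _ := by
        have : (256 : ℝ≥0∞) ^ n = 16 ^ n * 16 ^ n := by rw [← mul_pow]; norm_num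
        rw [this]; ring

/-- The one-parameter Carleson family formed from the layers and the block sums. -/
lemma carleson_layers {f : Rect → 𝕜} {F : ℝ≥0∞}
    (hf : Carleson Rect.set (fun R => ‖f R‖ₑ ^ 2) (F ^ 2)) (𝓖 : Finset Rect) (N : ℕ)
    (I : DyadicInt) :
    Carleson DyadicInt.set (fun J => ∑ n ∈ Finset.range N, ∑ j ∈ Finset.range N,
      (2 ^ j * (4 ^ (2 * n + j))⁻¹ * (gam 𝓖 (n + j) (I, J) * blkSum f I.pt n J)) ^ 2)
      (2048 * F ^ 2) := by
  intro s
  set U : Set T := ⋃ J ∈ s, J.set with hU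
  have hUm : MeasurableSet U := Finset.measurableSet_biUnion _ fun J _ => J.measurableSet_set
  have hlm : ∀ m, Measurable fun t => layerFn 𝓖 m (I.pt, t) := fun m =>
    (measurable_layerFn 𝓖 m).comp measurable_prodMk_left
  have h1 : ∀ n m, ∑ J ∈ s, (gam 𝓖 m (I, J) * blkSum f I.pt n J) ^ 2
      ≤ 1024 * 256 ^ n * F ^ 2 * ∫⁻ t in U, layerFn 𝓖 m (I.pt, t) := by
    intro n m
    -- Cutting off to `U` does not change the means over J ∈ s, and it localizes the bound from the
    -- embedding theorem to `U`, as a packing condition requires.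
    set w : T → ℝ≥0∞ := U.indicator fun t => layerFn 𝓖 m (I.pt, t) with hw
    have hwm : Measurable w := (hlm m).indicator hUm
    have h := (carleson_blkSum hf I.pt n).sum_mul_sq_av_le DyadicInt.measurableSet_set s w
    calc _ ≤ ∑ J ∈ s, blkSum f I.pt n J ^ 2 * av J.set w ^ 2 := by
          refine Finset.sum_le_sum fun J hJ => ?_
          rw [mul_pow, mul_comm]
          gcongr
          refine av_mono J.measurableSet_set fun t ht => ?_
          rw [hw, Set.indicator_of_mem (Set.mem_iUnion₂.2 ⟨J, hJ, ht⟩)]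
      _ ≤ _ := h
      _ ≤ 256 * 256 ^ n * F ^ 2 * (4 * ∫⁻ t, w t ^ 2) := by
          gcongr; exact lintegral_maxFn_sq_le hwm
      _ = 256 * 256 ^ n * F ^ 2 * (4 * ∫⁻ t in U, layerFn 𝓖 m (I.pt, t)) := by
          rw [← lintegral_indicator hUm]
          congr 3
          ext t
          by_cases ht : t ∈ U <;> simp [hw, ht, layerFn_sq]
      _ = _ := by ring
  calc _ = ∑ j ∈ Finset.range N, ∑ n ∈ Finset.range N, ∑ J ∈ s,
        (2 ^ j * (4 ^ (2 * n + j))⁻¹ * (gam 𝓖 (n + j) (I, J) * blkSum f I.pt n J)) ^ 2 := by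
        rw [Finset.sum_comm, Finset.sum_congr rfl fun n _ => Finset.sum_comm, Finset.sum_comm]
    _ ≤ ∑ j ∈ Finset.range N, ∑ n ∈ Finset.range N,
        1024 * F ^ 2 * ((4 : ℝ≥0∞) ^ j)⁻¹ * ∫⁻ t in U, layerFn 𝓖 (n + j) (I.pt, t) := by
        refine Finset.sum_le_sum fun j _ => Finset.sum_le_sum fun n _ => ?_
        have e : ∀ J ∈ s,
            (2 ^ j * (4 ^ (2 * n + j))⁻¹ * (gam 𝓖 (n + j) (I, J) * blkSum f I.pt n J)) ^ 2
            = (2 ^ j * (4 ^ (2 * n + j))⁻¹) ^ 2 * (gam 𝓖 (n + j) (I, J) * blkSum f I.pt n J) ^ 2 :=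
          fun R _ => mul_pow _ _ _
        rw [Finset.sum_congr rfl e, ← Finset.mul_sum]
        -- The reciprocal power of 4 is the counterpart of the weight in `sum_layers_le`. It cancels
        -- the growth `256 ^ n` of the block sums and again leaves 4^(-j).
        have h3 : ((2 : ℝ≥0∞) ^ j * (4 ^ (2 * n + j))⁻¹) ^ 2 * 256 ^ n = ((4 : ℝ≥0∞) ^ j)⁻¹ := by
          have h4 : (4 : ℝ≥0∞) ^ (2 * n + j) = 2 ^ j * (2 ^ j * 16 ^ n) := by
            rw [show (4 : ℝ≥0∞) = 2 ^ 2 by norm_num, show (16 : ℝ≥0∞) = 2 ^ 4 by norm_num]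
            simp only [← pow_mul, ← pow_add]
            congr 1
            ring
          have h5 : ((2 : ℝ≥0∞) ^ j * (4 ^ (2 * n + j))⁻¹) = (2 ^ j)⁻¹ * (16 ^ n)⁻¹ := by
            rw [h4, ENNReal.mul_inv (by simp) (by simp), ← mul_assoc,
              ENNReal.mul_inv_cancel (by simp) (by simp), one_mul,
              ENNReal.mul_inv (by simp) (by simp)]
          rw [h5, show (256 : ℝ≥0∞) = 16 * 16 by norm_num, mul_pow (16 : ℝ≥0∞) 16 n]
          have h6 := inv_mul_cancel_pow (a := 16) (by norm_num) n
          push_cast at h6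
          calc _ = ((2 : ℝ≥0∞) ^ j)⁻¹ ^ 2 * (((16 ^ n)⁻¹ * 16 ^ n) * ((16 ^ n)⁻¹ * 16 ^ n)) := by ring
            _ = _ := by
              rw [h6, mul_one, mul_one, ← ENNReal.inv_pow, ← pow_mul, mul_comm j 2, pow_mul]
              norm_num
        calc _ ≤ ((2 : ℝ≥0∞) ^ j * (4 ^ (2 * n + j))⁻¹) ^ 2 *
              (1024 * 256 ^ n * F ^ 2 * ∫⁻ t in U, layerFn 𝓖 (n + j) (I.pt, t)) := by
              gcongr; exact h1 _ _
          _ = (((2 : ℝ≥0∞) ^ j * (4 ^ (2 * n + j))⁻¹) ^ 2 * 256 ^ n) *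
              (1024 * F ^ 2 * ∫⁻ t in U, layerFn 𝓖 (n + j) (I.pt, t)) := by ring
          _ = _ := by rw [h3]; ring
    _ ≤ ∑ j ∈ Finset.range N, 1024 * F ^ 2 * ((4 : ℝ≥0∞) ^ j)⁻¹ * volume U := by
        refine Finset.sum_le_sum fun j _ => ?_
        rw [← Finset.mul_sum, ← lintegral_finsetSum _ fun n _ => hlm _]
        gcongr
        calc _ ≤ ∫⁻ _ in U, 1 := by
              refine lintegral_mono fun t => (sum_layerFn_le 𝓖 N j (I.pt, t)).trans ?_
              exact Set.indicator_le_self' (fun _ _ => bot_le) _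
          _ = _ := by simp
    _ = 1024 * F ^ 2 * (∑ j ∈ Finset.range N, ((4 : ℝ≥0∞) ^ j)⁻¹) * volume U := by
        rw [Finset.mul_sum, Finset.sum_mul]
    _ ≤ 1024 * F ^ 2 * 2 * volume U := by gcongr; exact sum_inv_pow_four_le N
    _ = _ := by ring

/-- At least half of `K × J` is covered by rectangles of `𝓖` that are not shorter than `K`. -/
def wellCovered (𝓖 : Finset Rect) (K J : DyadicInt) : Prop :=
  volume (Rect.set (K, J)) < 2 * volume (Rect.set (K, J) ∩ below 𝓖 (K.1 + 1))

/-- Only first sides at least as long as K are involved. Over K the covered part is therefore a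
product, and its share of K × J can be read off from one section. -/
lemma volume_inter_below (𝓖 : Finset Rect) {K : DyadicInt} (J : DyadicInt) {x : T}
    (hx : x ∈ K.set) : volume (Rect.set (K, J) ∩ below 𝓖 (K.1 + 1))
      = volume K.set * volume (J.set ∩ {t | (x, t) ∈ below 𝓖 (K.1 + 1)}) := by
  have : Rect.set (K, J) ∩ below 𝓖 (K.1 + 1)
      = K.set ×ˢ (J.set ∩ {t | (x, t) ∈ below 𝓖 (K.1 + 1)}) := by
    ext ⟨s, t⟩
    simp only [Rect.set, Set.mem_inter_iff, Set.mem_prod, Set.mem_ofPred_eq]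
    constructor
    · rintro ⟨⟨h1, h2⟩, h3⟩
      exact ⟨h1, h2, (mem_below_congr le_rfl h1 hx).1 h3⟩
    · rintro ⟨h1, h2, h3⟩
      exact ⟨⟨h1, h2⟩, (mem_below_congr le_rfl h1 hx).2 h3⟩
  rw [this, Measure.volume_eq_prod, Measure.prod_prod]

/-- If `K × J` is not well covered then the later layers fill a good part of `R`. -/
lemma one_le_of_not_wellCovered {𝓖 : Finset Rect} {R : Rect} (hR : R ∈ 𝓖) {N : ℕ}
    (hN : R.1.1 < 16 ^ N) {n k : ℕ} (hk : k ∈ blk n)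
    (hbad : ¬ wellCovered 𝓖 (ix k R.1.pt) R.2) :
    1 ≤ 8 * ∑ j ∈ Finset.range N, 4 ^ j * gam 𝓖 (n + j) R ^ 2 := by
  set x := R.1.pt with hx
  -- The shift by one in `blk` serves this: `below 𝓖 (16 ^ n)` is contained in the set `below 𝓖 (k +
  -- 1)` used in `wellCovered`.
  have hkn : 16 ^ n ≤ k + 1 := by
    have := (Finset.mem_Ico.1 hk).1; omega
  set B : Set T := {t | (x, t) ∈ below 𝓖 (16 ^ n)} with hB
  have hBm : MeasurableSet B := measurable_prodMk_left (measurableSet_below 𝓖 _)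
  have hhalf : av R.2.set (B.indicator fun _ => 1) ≤ 2⁻¹ := by
    rw [av_indicator hBm]
    have h1 : 2 * (volume (ix k x).set * volume (R.2.set ∩ B)) ≤ volume (ix k x).set * volume R.2.set := by
      rw [wellCovered, not_lt, volume_inter_below 𝓖 R.2 (DyadicInt.mem_ix k x), Rect.volume_set] at hbad
      refine le_trans ?_ hbad
      gcongr
      exact fun t ht => below_mono 𝓖 hkn ht
    have h2 : 2 * volume (R.2.set ∩ B) ≤ volume R.2.set := by
      rw [mul_left_comm] at h1
      exact (ENNReal.mul_le_mul_iff_right (DyadicInt.volume_set_ne_zero _)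
        (DyadicInt.volume_set_ne_top _)).1 h1
    calc (volume R.2.set)⁻¹ * volume (R.2.set ∩ B)
        = 2⁻¹ * ((volume R.2.set)⁻¹ * (2 * volume (R.2.set ∩ B))) := by
          rw [mul_left_comm _ 2, ← mul_assoc 2⁻¹, ENNReal.inv_mul_cancel (by simp) (by simp), one_mul]
      _ ≤ 2⁻¹ * ((volume R.2.set)⁻¹ * volume R.2.set) := by gcongr
      _ = 2⁻¹ := by
          rw [ENNReal.inv_mul_cancel R.2.volume_set_ne_zero R.2.volume_set_ne_top, mul_one]
  have hlm : ∀ m, Measurable fun t => layerFn 𝓖 m (x, t) := fun m =>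
    (measurable_layerFn 𝓖 m).comp measurable_prodMk_left
  have hone : (1 : ℝ≥0∞) ≤ 2⁻¹ + ∑ j ∈ Finset.range N, gam 𝓖 (n + j) R := by
    calc (1 : ℝ≥0∞) = av R.2.set fun _ => 1 :=
          (av_const R.2.volume_set_ne_zero R.2.volume_set_ne_top 1).symm
      _ ≤ av R.2.set fun t => B.indicator (fun _ => 1) t + ∑ j ∈ Finset.range N, layerFn 𝓖 (n + j) (x, t) := by
          refine av_mono R.2.measurableSet_set fun t ht => ?_
          exact one_le_sum_layerFn (mem_below.2 ⟨R, hR, hN, R.1.pt_mem, ht⟩)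
      _ = av R.2.set (B.indicator fun _ => 1) + ∑ j ∈ Finset.range N, gam 𝓖 (n + j) R := by
          simp only [gam]
          rw [← av_sum _ fun j _ => hlm _]
          unfold av
          rw [lintegral_add_left (measurable_const.indicator hBm), mul_add]
      _ ≤ _ := by gcongr
  have hge : (2 : ℝ≥0∞)⁻¹ ≤ ∑ j ∈ Finset.range N, gam 𝓖 (n + j) R := by
    have h : (2 : ℝ≥0∞)⁻¹ + 2⁻¹ ≤ 2⁻¹ + ∑ j ∈ Finset.range N, gam 𝓖 (n + j) R := by
      rwa [ENNReal.inv_two_add_inv_two]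
    exact (ENNReal.add_le_add_iff_left (by simp)).1 h
  -- Cauchy–Schwarz with weights 2^(-j) and 2^j. Squares of `gam` are wanted because one factor will
  -- be spent on φ and the other on f.
  have hcs : (∑ j ∈ Finset.range N, gam 𝓖 (n + j) R) ^ 2
      ≤ 2 * ∑ j ∈ Finset.range N, 4 ^ j * gam 𝓖 (n + j) R ^ 2 := by
    have h := sq_sum_mul_le (Finset.range N) (fun j => ((2 : ℝ≥0∞) ^ j)⁻¹)
      (fun j => 2 ^ j * gam 𝓖 (n + j) R)
    have e1 : ∀ j, ((2 : ℝ≥0∞) ^ j)⁻¹ * (2 ^ j * gam 𝓖 (n + j) R) = gam 𝓖 (n + j) R := by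
      intro j
      rw [← mul_assoc, ENNReal.inv_mul_cancel (by simp) (by simp), one_mul]
    have e2 : ∀ j, (((2 : ℝ≥0∞) ^ j)⁻¹) ^ 2 = (4 ^ j)⁻¹ := by
      intro j
      rw [← ENNReal.inv_pow, ← pow_mul, mul_comm j 2, pow_mul]; norm_num
    have e3 : ∀ j, (2 ^ j * gam 𝓖 (n + j) R) ^ 2 = 4 ^ j * gam 𝓖 (n + j) R ^ 2 := by
      intro j
      rw [mul_pow, ← pow_mul, mul_comm j 2, pow_mul]; norm_num
    simp only [e1, e2, e3] at h
    exact h.trans (by gcongr; exact sum_inv_pow_four_le N)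
  calc (1 : ℝ≥0∞) = 4 * (2⁻¹) ^ 2 := by
        rw [← ENNReal.inv_pow, show (2 : ℝ≥0∞) ^ 2 = 4 by norm_num,
          ENNReal.mul_inv_cancel (by simp) (by simp)]
    _ ≤ 4 * (∑ j ∈ Finset.range N, gam 𝓖 (n + j) R) ^ 2 := by gcongr
    _ ≤ 4 * (2 * ∑ j ∈ Finset.range N, 4 ^ j * gam 𝓖 (n + j) R ^ 2) := by gcongr
    _ = _ := by ring

open Classical in
/-- The part of the mean of `f(·, J)` that comes from badly covered rectangles. -/
def badSum (𝓖 : Finset Rect) (f : Rect → 𝕜) (R : Rect) : ℝ≥0∞ :=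
  ∑ k ∈ Finset.range R.1.1 with ¬ wellCovered 𝓖 (ix k R.1.pt) R.2,
    ‖haar (ix k R.1.pt) R.1.pt‖ₑ * ‖f (ix k R.1.pt, R.2)‖ₑ

/-- Every bad term may be multiplied by the quantity that `one_le_of_not_wellCovered` bounds below
by 1. That quantity depends on the level only through its block, so it factors out of the block
sums. -/
lemma badSum_le {𝓖 : Finset Rect} (f : Rect → 𝕜) {R : Rect} (hR : R ∈ 𝓖) {N : ℕ}
    (hN : R.1.1 < 16 ^ N) : badSum 𝓖 f R ≤ 8 * ∑ n ∈ Finset.range N, ∑ j ∈ Finset.range N,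
      4 ^ j * gam 𝓖 (n + j) R ^ 2 * blkSum f R.1.pt n R.2 := by
  classical
  set x := R.1.pt
  set y : ℕ → ℝ≥0∞ := fun k => ‖haar (ix k x) x‖ₑ * ‖f (ix k x, R.2)‖ₑ with hy
  calc badSum 𝓖 f R
      = ∑ k ∈ Finset.range R.1.1, if ¬ wellCovered 𝓖 (ix k x) R.2 then y k else 0 := by
        rw [badSum, Finset.sum_filter]
    _ ≤ ∑ k ∈ Finset.range (16 ^ N - 1), if ¬ wellCovered 𝓖 (ix k x) R.2 then y k else 0 :=
        Finset.sum_le_sum_of_subset (Finset.range_subset_range.2 (by omega))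
    _ = ∑ n ∈ Finset.range N, ∑ k ∈ blk n, if ¬ wellCovered 𝓖 (ix k x) R.2 then y k else 0 :=
        sum_range_eq_sum_blk _ N
    _ ≤ ∑ n ∈ Finset.range N, ∑ k ∈ blk n,
        (8 * ∑ j ∈ Finset.range N, 4 ^ j * gam 𝓖 (n + j) R ^ 2) * y k := by
        refine Finset.sum_le_sum fun n _ => Finset.sum_le_sum fun k hk => ?_
        split_ifs with h
        · exact bot_le
        · calc y k = 1 * y k := (one_mul _).symm
            _ ≤ _ := by gcongr; exact one_le_of_not_wellCovered hR hN hk h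
    _ = _ := by
        rw [Finset.mul_sum]
        refine Finset.sum_congr rfl fun n _ => ?_
        rw [← Finset.mul_sum, mul_assoc, Finset.sum_mul]
        rfl

end

section

/-! ### The estimate for mixed paraproducts -/

variable {𝕜 : Type*} [RCLike 𝕜]

/-- The mean over `I` of the Haar series with coefficients `f(·, J)`, for `R = I × J`. -/
def meanCoef (f : Rect → 𝕜) (R : Rect) : 𝕜 :=
  ∑ k ∈ Finset.range R.1.1, f (ix k R.1.pt, R.2) * ((haar (ix k R.1.pt) R.1.pt : ℝ) : 𝕜)

/-- The strips over `I` of a family of rectangles. -/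
def strip (𝓖 : Finset Rect) (c : Rect → ℝ≥0∞) (I : DyadicInt) (t : T) : ℝ≥0∞ :=
  ∑ R ∈ 𝓖 with R.1 = I, R.2.set.indicator (fun _ => c R * (volume R.2.set)⁻¹) t

lemma measurable_strip (𝓖 : Finset Rect) (c : Rect → ℝ≥0∞) (I : DyadicInt) :
    Measurable (strip 𝓖 c I) :=
  Finset.measurable_sum _ fun R _ => measurable_const.indicator R.2.measurableSet_set

lemma strip_le (𝓖 : Finset Rect) (c : Rect → ℝ≥0∞) (I : DyadicInt) (t : T) :
    strip 𝓖 c I t ≤ ∑ R ∈ 𝓖, c R * (volume R.2.set)⁻¹ := by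
  refine (Finset.sum_le_sum fun R _ => ?_).trans
    (Finset.sum_le_sum_of_subset (Finset.filter_subset _ _))
  exact Set.indicator_le_self' (fun _ _ => bot_le) _

lemma sum_bound_ne_top (𝓖 : Finset Rect) {c : Rect → ℝ≥0∞} (hc : ∀ R, c R ≠ ⊤) :
    ∑ R ∈ 𝓖, c R * (volume R.2.set)⁻¹ ≠ ⊤ :=
  ENNReal.sum_ne_top.2 fun R _ =>
    ENNReal.mul_ne_top (hc R) (ENNReal.inv_ne_top.2 R.2.volume_set_ne_zero)

lemma lintegral_strip_sq_ne_top (𝓖 : Finset Rect) {c : Rect → ℝ≥0∞} (hc : ∀ R, c R ≠ ⊤)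
    (I : DyadicInt) : ∫⁻ t, strip 𝓖 c I t ^ 2 ≠ ⊤ := by
  refine ne_top_of_le_ne_top (ENNReal.pow_ne_top (n := 2) (sum_bound_ne_top 𝓖 hc)) ?_
  calc _ ≤ ∫⁻ _ : T, (∑ R ∈ 𝓖, c R * (volume R.2.set)⁻¹) ^ 2 :=
        lintegral_mono fun t => by gcongr; exact strip_le 𝓖 c I t
    _ = _ := by simp

lemma av_strip_ne_top (𝓖 : Finset Rect) {c : Rect → ℝ≥0∞} (hc : ∀ R, c R ≠ ⊤)
    (I J : DyadicInt) : av J.set (strip 𝓖 c I) ≠ ⊤ := by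
  refine ne_top_of_le_ne_top (sum_bound_ne_top 𝓖 hc) ?_
  calc _ ≤ av J.set fun _ => ∑ R ∈ 𝓖, c R * (volume R.2.set)⁻¹ :=
        av_mono J.measurableSet_set fun t _ => strip_le 𝓖 c I t
    _ = _ := av_const J.volume_set_ne_zero J.volume_set_ne_top _

/-- One factor of each square is expanded. The energy becomes a linear form in `c`, with the strips
themselves as test functions. -/
lemma sum_lintegral_strip_sq (𝓖 : Finset Rect) (c : Rect → ℝ≥0∞) :
    ∑ I ∈ 𝓖.image Prod.fst, ∫⁻ t, strip 𝓖 c I t ^ 2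
      = ∑ R ∈ 𝓖, c R * av R.2.set (strip 𝓖 c R.1) := by
  rw [← Finset.sum_fiberwise_of_maps_to (g := Prod.fst) (t := 𝓖.image Prod.fst)
    fun R hR => Finset.mem_image_of_mem _ hR]
  refine Finset.sum_congr rfl fun I _ => ?_
  have h1 : ∀ t, strip 𝓖 c I t ^ 2 = ∑ R ∈ 𝓖 with R.1 = I,
      c R * (volume R.2.set)⁻¹ * R.2.set.indicator (strip 𝓖 c I) t := by
    intro t
    rw [sq]
    nth_rw 1 [strip]
    rw [Finset.sum_mul]
    refine Finset.sum_congr rfl fun R _ => ?_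
    by_cases ht : t ∈ R.2.set <;> simp [ht]
  simp_rw [h1]
  rw [lintegral_finsetSum _ fun R _ =>
    ((measurable_strip 𝓖 c I).indicator R.2.measurableSet_set).const_mul _]
  refine Finset.sum_congr rfl fun R hR => ?_
  rw [lintegral_const_mul _ ((measurable_strip 𝓖 c I).indicator R.2.measurableSet_set),
    lintegral_indicator R.2.measurableSet_set, (Finset.mem_filter.1 hR).2, av, mul_assoc]

/-- The well covered rectangles lie in a set that is not much larger than the union of `𝓖`. -/
lemma sum_wellCovered_le {f : Rect → 𝕜} {F : ℝ≥0∞}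
    (hf : Carleson Rect.set (fun R => ‖f R‖ₑ ^ 2) (F ^ 2)) (𝓖 s : Finset Rect)
    (hs : ∀ R ∈ s, wellCovered 𝓖 R.1 R.2) :
    ∑ R ∈ s, ‖f R‖ₑ ^ 2 ≤ 64 * F ^ 2 * volume (⋃ R ∈ 𝓖, R.set) := by
  set E := ⋃ R ∈ 𝓖, R.set with hE
  have hEm : MeasurableSet E := Finset.measurableSet_biUnion _ fun R _ => R.measurableSet_set
  set w : T2 → ℝ≥0∞ := E.indicator fun _ => 1 with hw
  have hwm : Measurable w := measurable_const.indicator hEm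
  -- A well covered rectangle lies where the maximal function of χ_E is at least 1/2, so the packing
  -- sum can be embedded against `4 * maxFn ^ 2`.
  have h1 : ∀ R ∈ s, ∀ p ∈ R.set, (1 : ℝ≥0∞) ≤ 4 * maxFn Rect.set w p ^ 2 := by
    intro R hR p hp
    have h2 : 1 ≤ 2 * av R.set w := by
      have h3 := (hs R hR).le
      rw [hw, av_indicator hEm]
      have h4 : volume R.set ≤ 2 * volume (R.set ∩ E) := by
        refine h3.trans ?_
        gcongr
        intro q hq
        obtain ⟨R', h5, -, h6⟩ := mem_below.1 hq
        exact Set.mem_iUnion₂.2 ⟨R', h5, h6⟩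
      calc (1 : ℝ≥0∞) = (volume R.set)⁻¹ * volume R.set :=
            (ENNReal.inv_mul_cancel R.volume_set_ne_zero R.volume_set_ne_top).symm
        _ ≤ (volume R.set)⁻¹ * (2 * volume (R.set ∩ E)) := by gcongr
        _ = _ := by ring
    calc (1 : ℝ≥0∞) = 1 ^ 2 := by norm_num
      _ ≤ (2 * maxFn Rect.set w p) ^ 2 := by
          gcongr
          exact h2.trans (by gcongr; exact av_le_maxFn w hp)
      _ = _ := by rw [mul_pow]; norm_num
  have h2 := hf.sum_mul_le (fun R => R.measurableSet_set) s (fun _ => 1)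
    (fun p => 4 * maxFn Rect.set w p ^ 2) h1
  simp only [mul_one] at h2
  refine h2.trans ?_
  rw [lintegral_const_mul _ ((measurable_maxFn (fun R => R.measurableSet_set) w).pow_const 2)]
  calc _ ≤ F ^ 2 * (4 * (16 * ∫⁻ p, w p ^ 2)) := by
        gcongr; exact lintegral_strong_maxFn_sq_le hwm
    _ = F ^ 2 * (4 * (16 * volume E)) := by
        congr 3
        have : ∀ p, w p ^ 2 = E.indicator (fun _ => 1) p := fun p => by
          by_cases hp : p ∈ E <;> simp [hw, hp]
        simp_rw [this]
        rw [lintegral_indicator hEm, lintegral_const, Measure.restrict_apply_univ, one_mul]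
    _ = _ := by ring

open Classical in
-- The well covered ancestors give exactly the mean over `R.1` of one Haar sum that depends on `R.2`
-- alone. Any other members of 𝓚 are harmless: they vanish at the base point or are too fine to
-- affect the mean.
lemma enorm_meanCoef_le (f : Rect → 𝕜) (𝓖 : Finset Rect) (𝓚 : Finset DyadicInt) {R : Rect}
    (h𝓚 : ∀ k < R.1.1, ix k R.1.pt ∈ 𝓚) :
    ‖meanCoef f R‖ₑ ≤ av R.1.set (fun x =>
      ‖haarSum (𝓚.filter fun K => wellCovered 𝓖 K R.2) (fun K => f (K, R.2)) x‖ₑ)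
      + badSum 𝓖 f R := by
  set p := R.1.pt with hp
  rw [meanCoef, ← Finset.sum_filter_add_sum_filter_not _ fun k => wellCovered 𝓖 (ix k p) R.2]
  refine (enorm_add_le _ _).trans (add_le_add ?_ ?_)
  · refine le_trans (le_of_eq ?_) (enorm_sum_le_av_haarSum _ _ R.1.pt_mem)
    congr 1
    have hinj : Set.InjOn (fun k => ix k p)
        ((Finset.range R.1.1).filter fun k => wellCovered 𝓖 (ix k p) R.2 : Set ℕ) :=
      fun a _ b _ h => congrArg Sigma.fst h
    rw [← Finset.sum_image (f := fun K => f (K, R.2) * ((haar K p : ℝ) : 𝕜)) hinj]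
    refine Finset.sum_subset ?_ ?_
    · intro K hK
      obtain ⟨k, hk, rfl⟩ := Finset.mem_image.1 hK
      obtain ⟨hk1, hk2⟩ := Finset.mem_filter.1 hk
      have hk3 := Finset.mem_range.1 hk1
      exact Finset.mem_filter.2 ⟨Finset.mem_filter.2 ⟨h𝓚 k hk3, hk2⟩, hk3⟩
    · intro K hK hK2
      obtain ⟨hK3, hK4⟩ := Finset.mem_filter.1 hK
      have hKp : p ∉ K.set := by
        intro hpK
        have h1 := DyadicInt.mem_set_iff.1 hpK
        refine hK2 (Finset.mem_image.2 ⟨K.1, Finset.mem_filter.2 ⟨Finset.mem_range.2 hK4, ?_⟩, h1⟩)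
        rw [h1]
        exact (Finset.mem_filter.1 hK3).2
      rw [haar_of_notMem hKp]
      simp
  · rw [badSum]
    refine (enorm_sum_le _ _).trans (Finset.sum_le_sum fun k _ => ?_)
    rw [enorm_mul, mul_comm]
    gcongr
    rw [← ofReal_norm, RCLike.norm_ofReal, ← Real.norm_eq_abs, ofReal_norm]

/-- The square estimate for the mixed paraproducts. -/
theorem sum_lintegral_strip_sq_le {φ : Rect → ℝ≥0∞} {L : ℝ≥0∞}
    (hφ : ∀ i : ℕ, Carleson Rect.set (fun R => if i ≤ R.1.1 then φ R ^ 2 else 0)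
      ((L * (1 / ((i : ℝ≥0∞) + 1))) ^ 2)) (hφt : ∀ R, φ R ≠ ⊤)
    {f : Rect → 𝕜} {F : ℝ≥0∞} (hf : Carleson Rect.set (fun R => ‖f R‖ₑ ^ 2) (F ^ 2))
    (𝓖 : Finset Rect) :
    ∑ I ∈ 𝓖.image Prod.fst, ∫⁻ t, strip 𝓖 (fun R => φ R * ‖meanCoef f R‖ₑ) I t ^ 2
      ≤ 2 ^ 26 * L ^ 2 * F ^ 2 * volume (⋃ R ∈ 𝓖, R.set) := by
  classical
  set c : Rect → ℝ≥0∞ := fun R => φ R * ‖meanCoef f R‖ₑ with hc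
  set G := strip 𝓖 c with hG
  set E := ⋃ R ∈ 𝓖, R.set with hE
  have hct : ∀ R, c R ≠ ⊤ := fun R => ENNReal.mul_ne_top (hφt R) enorm_ne_top
  set Q := ∑ I ∈ 𝓖.image Prod.fst, ∫⁻ t, G I t ^ 2 with hQ
  have hQt : Q ≠ ⊤ := ENNReal.sum_ne_top.2 fun I _ => lintegral_strip_sq_ne_top 𝓖 hct I
  set 𝓚 : Finset DyadicInt := 𝓖.biUnion fun R => (Finset.range R.1.1).image fun k => ix k R.1.pt
    with h𝓚
  set u : DyadicInt → T → ℝ≥0∞ := fun J x =>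
    ‖haarSum (𝓚.filter fun K => wellCovered 𝓖 K J) (fun K => f (K, J)) x‖ₑ with hu
  set good := ∑ R ∈ 𝓖, φ R * (av R.1.set (u R.2) * av R.2.set (G R.1)) with hgood
  set bad := ∑ R ∈ 𝓖, φ R * (badSum 𝓖 f R * av R.2.set (G R.1)) with hbad
  have hsplit : Q ≤ good + bad := by
    rw [hQ, sum_lintegral_strip_sq, hgood, hbad, ← Finset.sum_add_distrib]
    refine Finset.sum_le_sum fun R hR => ?_
    calc c R * av R.2.set (G R.1) = φ R * (‖meanCoef f R‖ₑ * av R.2.set (G R.1)) := by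
          rw [hc]; ring
      _ ≤ φ R * ((av R.1.set (u R.2) + badSum 𝓖 f R) * av R.2.set (G R.1)) := by
          gcongr
          refine enorm_meanCoef_le f 𝓖 𝓚 fun k hk => ?_
          exact Finset.mem_biUnion.2 ⟨R, hR, Finset.mem_image.2 ⟨k, Finset.mem_range.2 hk, rfl⟩⟩
      _ = _ := by ring
  have hgood2 : good ^ 2 ≤ 2 ^ 24 * L ^ 2 * F ^ 2 * volume E * Q := by
    -- The good part needs only the case `i = 0`, that is, φ in BMO.
    have h0 : Carleson Rect.set (fun R => φ R ^ 2) (L ^ 2) := by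
      have := hφ 0
      simpa using this
    have h1 := h0.sq_sum_mul_av_mul_av_le 𝓖 (u := u) (g := G)
      (fun J => (measurable_haarSum _ _).enorm) (fun I => measurable_strip 𝓖 c I)
      (fun I J => av_haarSum_ne_top _ _ I) (fun I J => av_strip_ne_top 𝓖 hct I J)
      (𝓖.image Prod.fst) (𝓖.image Prod.snd) (fun R hR => Finset.mem_image_of_mem _ hR)
      (fun R hR => Finset.mem_image_of_mem _ hR)
    have h2 : ∑ J ∈ 𝓖.image Prod.snd, ∫⁻ x, u J x ^ 2 ≤ 64 * F ^ 2 * volume E := by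
      have e : ∀ J, ∫⁻ x, u J x ^ 2 = ∑ K ∈ 𝓚.filter fun K => wellCovered 𝓖 K J, ‖f (K, J)‖ₑ ^ 2 :=
        fun J => lintegral_haarSum_sq _ _
      simp_rw [e, Finset.sum_filter]
      rw [Finset.sum_comm, ← Finset.sum_product' (s := 𝓚) (t := 𝓖.image Prod.snd)
        (f := fun K J => if wellCovered 𝓖 K J then ‖f (K, J)‖ₑ ^ 2 else 0), ← Finset.sum_filter]
      exact sum_wellCovered_le hf 𝓖 _ fun R hR => (Finset.mem_filter.1 hR).2
    calc good ^ 2 ≤ 256 * L ^ 2 * (∑ J ∈ 𝓖.image Prod.snd, ∫⁻ x, u J x ^ 2) * Q := h1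
      _ ≤ 256 * L ^ 2 * (64 * F ^ 2 * volume E) * Q := by gcongr
      _ = 2 ^ 14 * (L ^ 2 * F ^ 2 * volume E * Q) := by ring
      -- The constant is enlarged only to agree with that of the bad part, 64 · 32 · 8192 = 2^24.
      _ ≤ 2 ^ 24 * (L ^ 2 * F ^ 2 * volume E * Q) := by
          gcongr
          · norm_num
          · norm_num
      _ = _ := by ring
  have hbad2 : bad ^ 2 ≤ 2 ^ 24 * L ^ 2 * F ^ 2 * volume E * Q := by
    obtain ⟨N, hN⟩ : ∃ N, ∀ R ∈ 𝓖, R.1.1 < 16 ^ N := by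
      refine ⟨𝓖.sup fun R => R.1.1, fun R hR => ?_⟩
      exact (Finset.le_sup (f := fun R : Rect => R.1.1) hR).trans_lt (Nat.lt_pow_self (by norm_num))
    set X := 𝓖 ×ˢ (Finset.range N ×ˢ Finset.range N) with hX
    -- Each bad term is factored as `y * z` with reciprocal powers of 4, with 4^j = 2^j 2^j, and
    -- with one `gam` on each side. Then `sum_layers_le` bounds the squares of `y`, and
    -- `carleson_layers`, embedded strip by strip, bounds those of `z`.
    set y : Rect × ℕ × ℕ → ℝ≥0∞ := fun q =>
      2 ^ q.2.2 * 4 ^ (2 * q.2.1 + q.2.2) * (φ q.1 * gam 𝓖 (q.2.1 + q.2.2) q.1) with hy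
    set z : Rect × ℕ × ℕ → ℝ≥0∞ := fun q =>
      2 ^ q.2.2 * (4 ^ (2 * q.2.1 + q.2.2))⁻¹ * (gam 𝓖 (q.2.1 + q.2.2) q.1
        * blkSum f q.1.1.pt q.2.1 q.1.2) * av q.1.2.set (G q.1.1) with hz
    have h1 : bad ≤ 8 * ∑ q ∈ X, y q * z q := by
      rw [hX, Finset.sum_product, Finset.mul_sum]
      refine Finset.sum_le_sum fun R hR => ?_
      calc φ R * (badSum 𝓖 f R * av R.2.set (G R.1))
          ≤ φ R * ((8 * ∑ n ∈ Finset.range N, ∑ j ∈ Finset.range N,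
            4 ^ j * gam 𝓖 (n + j) R ^ 2 * blkSum f R.1.pt n R.2) * av R.2.set (G R.1)) := by
            gcongr; exact badSum_le f hR (hN R hR)
        _ = 8 * ((∑ n ∈ Finset.range N, ∑ j ∈ Finset.range N,
            4 ^ j * gam 𝓖 (n + j) R ^ 2 * blkSum f R.1.pt n R.2) * (φ R * av R.2.set (G R.1))) := by
            ring
        _ = 8 * ∑ q ∈ Finset.range N ×ˢ Finset.range N, y (R, q) * z (R, q) := by
            rw [Finset.sum_product, Finset.sum_mul]
            congr 1
            refine Finset.sum_congr rfl fun n _ => ?_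
            rw [Finset.sum_mul]
            refine Finset.sum_congr rfl fun j _ => ?_
            simp only [hy, hz]
            have e : (4 : ℝ≥0∞) ^ (2 * n + j) * (4 ^ (2 * n + j))⁻¹ = 1 :=
              ENNReal.mul_inv_cancel (by simp) (by simp)
            have e2 : (4 : ℝ≥0∞) ^ j = 2 ^ j * 2 ^ j := by rw [← mul_pow]; norm_num
            rw [e2]
            calc _ = 1 * (2 ^ j * 2 ^ j * gam 𝓖 (n + j) R ^ 2 * blkSum f R.1.pt n R.2 *
                  (φ R * av R.2.set (G R.1))) := (one_mul _).symm
              _ = _ := by rw [← e]; ring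
    have h2 : ∑ q ∈ X, y q ^ 2 ≤ 32 * L ^ 2 * volume E := by
      have h3 := sum_layers_le hφ 𝓖 N
      rw [hX, Finset.sum_product]
      refine le_trans (le_of_eq ?_) h3
      refine Finset.sum_congr rfl fun R _ => ?_
      rw [Finset.sum_product]
    have h3 : ∑ q ∈ X, z q ^ 2 ≤ 8192 * F ^ 2 * Q := by
      rw [hX, Finset.sum_product, ← Finset.sum_fiberwise_of_maps_to (g := Prod.fst)
        (t := 𝓖.image Prod.fst) fun R hR => Finset.mem_image_of_mem _ hR, hQ, Finset.mul_sum]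
      refine Finset.sum_le_sum fun I _ => ?_
      have h4 := (carleson_layers hf 𝓖 N I).sum_mul_sq_av_le DyadicInt.measurableSet_set
        ((𝓖.filter fun R => R.1 = I).image Prod.snd) (G I)
      have hinj : Set.InjOn (Prod.snd : Rect → DyadicInt) (𝓖.filter fun R => R.1 = I : Set Rect) := by
        intro R hR R' hR' h
        simp only [Finset.coe_filter, Set.mem_ofPred_eq] at hR hR'
        exact Prod.ext (hR.2.trans hR'.2.symm) h
      rw [Finset.sum_image hinj] at h4
      calc _ = ∑ R ∈ 𝓖 with R.1 = I, (∑ n ∈ Finset.range N, ∑ j ∈ Finset.range N,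
            (2 ^ j * (4 ^ (2 * n + j))⁻¹ * (gam 𝓖 (n + j) (I, R.2) * blkSum f I.pt n R.2)) ^ 2)
            * av R.2.set (G I) ^ 2 := by
            refine Finset.sum_congr rfl fun R hR => ?_
            obtain ⟨-, rfl⟩ := Finset.mem_filter.1 hR
            rw [Finset.sum_product, Finset.sum_mul]
            refine Finset.sum_congr rfl fun n _ => ?_
            rw [Finset.sum_mul]
            refine Finset.sum_congr rfl fun j _ => ?_
            rw [hz, mul_pow _ (av _ _) 2]
        _ ≤ 2048 * F ^ 2 * ∫⁻ x, maxFn DyadicInt.set (G I) x ^ 2 := h4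
        _ ≤ 2048 * F ^ 2 * (4 * ∫⁻ x, G I x ^ 2) := by
            gcongr; exact lintegral_maxFn_sq_le (measurable_strip 𝓖 c I)
        _ = _ := by ring
    calc bad ^ 2 ≤ (8 * ∑ q ∈ X, y q * z q) ^ 2 := by gcongr
      _ = 64 * (∑ q ∈ X, y q * z q) ^ 2 := by rw [mul_pow]; norm_num
      _ ≤ 64 * ((∑ q ∈ X, y q ^ 2) * ∑ q ∈ X, z q ^ 2) := by gcongr; exact sq_sum_mul_le X y z
      _ ≤ 64 * ((32 * L ^ 2 * volume E) * (8192 * F ^ 2 * Q)) := by gcongr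
      _ = _ := by ring
  refine le_mul_of_sq_le_mul hQt ?_
  calc Q ^ 2 ≤ (good + bad) ^ 2 := by gcongr
    _ ≤ 2 * good ^ 2 + 2 * bad ^ 2 := sq_add_le _ _
    _ ≤ 2 * (2 ^ 24 * L ^ 2 * F ^ 2 * volume E * Q) + 2 * (2 ^ 24 * L ^ 2 * F ^ 2 * volume E * Q) := by
        gcongr
    _ = _ := by ring

end

section

/-! ### Sup norms and packing conditions -/

section supNorm

variable {ι : Type*} {S : ι → Set T2} {a : ι → ℝ≥0∞}

/-- A union of the sets `S i` need not be open. It is approximated from outside by open sets, for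
which the supremum is available. -/
lemma Carleson.of_supNorm_le {B : ℝ≥0∞} (hB : B ≠ ⊤)
    (h : (⨆ (Ω : Set T2) (_ : IsOpen Ω),
      ((volume Ω)⁻¹ * ∑' i : {i // S i ⊆ Ω}, a i.1) ^ (1 / 2 : ℝ)) ≤ B) :
    Carleson S a (B ^ 2) := by
  classical
  intro s
  have h1 : ∀ Ω : Set T2, (⋃ i ∈ s, S i) ⊆ Ω → IsOpen Ω → ∑ i ∈ s, a i ≤ B ^ 2 * volume Ω := by
    intro Ω hs hΩ
    have h2 : rt ((volume Ω)⁻¹ * ∑' i : {i // S i ⊆ Ω}, a i.1) ≤ B :=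
      (le_iSup₂_of_le (f := fun (Ω : Set T2) (_ : IsOpen Ω) =>
        ((volume Ω)⁻¹ * ∑' i : {i // S i ⊆ Ω}, a i.1) ^ (1 / 2 : ℝ)) Ω hΩ le_rfl).trans h
    have h3 : (volume Ω)⁻¹ * ∑' i : {i // S i ⊆ Ω}, a i.1 ≤ B ^ 2 := by
      rw [← rt_sq ((volume Ω)⁻¹ * _)]
      gcongr
    have h4 : ∑ i ∈ s, a i ≤ ∑' i : {i // S i ⊆ Ω}, a i.1 := by
      have hsub : ∀ i ∈ s, S i ⊆ Ω := fun i hi =>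
        (Set.subset_iUnion₂ (s := fun i (_ : i ∈ s) => S i) i hi).trans hs
      rw [← Finset.sum_attach]
      calc ∑ i ∈ s.attach, a i.1 = ∑ j ∈ s.attach.map
            ⟨fun i => (⟨i.1, hsub i.1 i.2⟩ : {i // S i ⊆ Ω}),
              fun i j hij => Subtype.ext (congrArg (fun z => z.1) hij)⟩, a j.1 := by
            rw [Finset.sum_map]; rfl
        _ ≤ _ := ENNReal.sum_le_tsum _
    refine h4.trans ?_
    rw [mul_comm] at h3
    -- Here the inverse of the measure is `⊤`, so the finiteness of `B` forces the whole sum to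
    -- vanish.
    by_cases h0 : volume Ω = 0
    · rw [h0, ENNReal.inv_zero] at h3
      have h5 : ∑' i : {i // S i ⊆ Ω}, a i.1 = 0 := by
        by_contra hne
        rw [ENNReal.mul_top hne, top_le_iff] at h3
        exact ENNReal.pow_ne_top hB h3
      rw [h5]
      exact bot_le
    · exact (ENNReal.mul_inv_le_iff h0 (measure_ne_top _ _)).1 h3
  -- The factor `B ^ 2` can be moved through the infimum of outer regularity only if it is nonzero
  -- and finite.
  by_cases hB0 : B = 0
  · have := h1 Set.univ (Set.subset_univ _) isOpen_univ
    simpa [hB0] using this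
  rw [Set.measure_eq_iInf_isOpen (⋃ i ∈ s, S i)]
  have hne : B ^ 2 ≠ 0 := pow_ne_zero _ hB0
  have hnt : B ^ 2 ≠ ⊤ := ENNReal.pow_ne_top hB
  rw [ENNReal.mul_iInf_of_ne hne hnt]
  refine le_iInf fun Ω => ?_
  rw [ENNReal.mul_iInf_of_ne hne hnt]
  refine le_iInf fun hs => ?_
  rw [ENNReal.mul_iInf_of_ne hne hnt]
  exact le_iInf fun hΩ => h1 Ω hs hΩ

lemma Carleson.supNorm_le {B : ℝ≥0∞} (h : Carleson S a (B ^ 2)) :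
    (⨆ (Ω : Set T2) (_ : IsOpen Ω),
      ((volume Ω)⁻¹ * ∑' i : {i // S i ⊆ Ω}, a i.1) ^ (1 / 2 : ℝ)) ≤ B := by
  refine iSup₂_le fun Ω _ => ?_
  change rt _ ≤ B
  rw [← rt_sq' B]
  refine rt_mono ?_
  have h1 : ∑' i : {i // S i ⊆ Ω}, a i.1 ≤ B ^ 2 * volume Ω := by
    rw [ENNReal.tsum_eq_iSup_sum]
    refine iSup_le fun t => ?_
    have h2 := h (t.map (Function.Embedding.subtype _))
    rw [Finset.sum_map] at h2
    refine h2.trans ?_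
    gcongr
    refine Set.iUnion₂_subset fun i hi => ?_
    obtain ⟨j, -, rfl⟩ := Finset.mem_map.1 hi
    exact j.2
  calc _ ≤ (volume Ω)⁻¹ * (B ^ 2 * volume Ω) := by gcongr
    _ = ((volume Ω)⁻¹ * volume Ω) * B ^ 2 := by ring
    _ ≤ 1 * B ^ 2 := by gcongr; exact ENNReal.inv_mul_le_one _
    _ = _ := one_mul _

end supNorm

variable {𝕜 : Type*} [RCLike 𝕜]

lemma carleson_of_bmoNorm_le {b : L2 𝕜} {B : ℝ≥0∞} (hB : B ≠ ⊤) (h : bmoNorm b ≤ B) :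
    Carleson Rect.set (fun R => ‖coef (0, 0) b R‖ₑ ^ 2) (B ^ 2) :=
  Carleson.of_supNorm_le hB h

lemma bmoNorm_le_of_carleson {b : L2 𝕜} {B : ℝ≥0∞}
    (h : Carleson Rect.set (fun R => ‖coef (0, 0) b R‖ₑ ^ 2) (B ^ 2)) : bmoNorm b ≤ B :=
  h.supNorm_le

/-- The supporting rectangle of a function of the completed Haar system. -/
def suppRect (a : Option DyadicInt × Option DyadicInt) : Set T2 := suppC a.1 ×ˢ suppC a.2

lemma carleson_of_bmoNormExt_le {g : L2 𝕜} {B : ℝ≥0∞} (hB : B ≠ ⊤) (h : bmoNormExt g ≤ B) :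
    Carleson suppRect (fun a => ‖(inner 𝕜 (haarRectC 𝕜 a) g : 𝕜)‖ₑ ^ 2) (B ^ 2) :=
  Carleson.of_supNorm_le hB h

lemma bmoNormExt_le_of_carleson {g : L2 𝕜} {B : ℝ≥0∞}
    (h : Carleson suppRect (fun a => ‖(inner 𝕜 (haarRectC 𝕜 a) g : 𝕜)‖ₑ ^ 2) (B ^ 2)) :
    bmoNormExt g ≤ B :=
  h.supNorm_le

lemma volume_biUnion_swap (s : Finset Rect) :
    volume (⋃ R ∈ s, Rect.set R.swap) = volume (⋃ R ∈ s, R.set) := by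
  have h : (⋃ R ∈ s, Rect.set R.swap) = Prod.swap ⁻¹' ⋃ R ∈ s, R.set := by
    ext p
    simp [Rect.set, and_comm]
  rw [h]
  exact (Measure.measurePreserving_swap (μ := (volume : Measure T)) (ν := volume)).measure_preimage
    (Finset.measurableSet_biUnion _ fun R _ => R.measurableSet_set).nullMeasurableSet

lemma Carleson.swap {a : Rect → ℝ≥0∞} {A : ℝ≥0∞} (h : Carleson Rect.set a A) :
    Carleson Rect.set (fun R => a R.swap) A := by
  classical
  intro s
  have h1 := h (s.map (Equiv.prodComm _ _).toEmbedding)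
  rw [Finset.sum_map] at h1
  refine h1.trans (le_of_eq ?_)
  rw [← volume_biUnion_swap s]
  congr 2
  ext p
  simp only [Set.mem_iUnion, Finset.mem_map, exists_prop]
  constructor
  · rintro ⟨_, ⟨R, hR, rfl⟩, hp⟩
    exact ⟨R, hR, hp⟩
  · rintro ⟨R, hR, hp⟩
    exact ⟨_, ⟨R, hR, rfl⟩, hp⟩

/-! ### Hilbert spaces -/

lemma enorm_sq_eq {E : Type*} [NormedAddCommGroup E] (z : E) : ‖z‖ₑ ^ 2 = ENNReal.ofReal (‖z‖ ^ 2) := by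
  rw [ENNReal.ofReal_pow (norm_nonneg _), ofReal_norm]

/-- Bessel's inequality for extended norms. -/
lemma sum_enorm_inner_sq_le {ι E : Type*} [NormedAddCommGroup E] [InnerProductSpace 𝕜 E] {v : ι → E}
    (hv : Orthonormal 𝕜 v) (x : E) (s : Finset ι) :
    ∑ i ∈ s, ‖(inner 𝕜 (v i) x : 𝕜)‖ₑ ^ 2 ≤ ‖x‖ₑ ^ 2 := by
  simp_rw [enorm_sq_eq]
  rw [← ENNReal.ofReal_sum_of_nonneg fun i _ => by positivity]
  exact ENNReal.ofReal_le_ofReal (hv.sum_inner_products_le x)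

/-- A series in a Hilbert space whose finite partial sums are bounded converges
unconditionally. -/
lemma summable_of_norm_sum_le {E ι : Type*} [NormedAddCommGroup E] [InnerProductSpace 𝕜 E]
    [CompleteSpace E] {f : ι → E} {C : ℝ} (h : ∀ s : Finset ι, ‖∑ i ∈ s, f i‖ ≤ C) :
    Summable f := by
  classical
  by_contra hf
  rw [summable_iff_vanishing_norm] at hf
  push Not at hf
  obtain ⟨ε, hε, hf⟩ := hf
  -- Without the Cauchy property there are blocks of norm at least ε away from any finite set. By
  -- the parallelogram law, a suitable sign for the next block adds at least ε² to the squared norm,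
  -- while differences of two partial sums never exceed 2C.
  have key : ∀ N : ℕ, ∃ A B : Finset ι, N * ε ^ 2 ≤ ‖∑ i ∈ A, f i - ∑ i ∈ B, f i‖ ^ 2 := by
    intro N
    induction N with
    | zero => exact ⟨∅, ∅, by simp⟩
    | succ N ih =>
      obtain ⟨A, B, hAB⟩ := ih
      obtain ⟨t, ht, hεt⟩ := hf (A ∪ B)
      have hA : Disjoint A t := (ht.mono_right Finset.subset_union_left).symm
      have hB : Disjoint B t := (ht.mono_right Finset.subset_union_right).symm
      set S := ∑ i ∈ A, f i - ∑ i ∈ B, f i with hS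
      set y := ∑ i ∈ t, f i with hy
      have hp := parallelogram_law_with_norm 𝕜 S y
      have h2 : ε ^ 2 ≤ ‖y‖ ^ 2 := by gcongr
      push_cast
      by_cases hc : ‖S‖ ^ 2 + ‖y‖ ^ 2 ≤ ‖S + y‖ ^ 2
      · refine ⟨A ∪ t, B, ?_⟩
        rw [Finset.sum_union hA, ← hy, show ∑ i ∈ A, f i + y - ∑ i ∈ B, f i = S + y by rw [hS]; abel]
        linarith
      · refine ⟨A, B ∪ t, ?_⟩
        rw [Finset.sum_union hB, ← hy, show ∑ i ∈ A, f i - (∑ i ∈ B, f i + y) = S - y by rw [hS]; abel]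
        linarith
  obtain ⟨N, hN⟩ := exists_nat_gt ((2 * C) ^ 2 / ε ^ 2)
  obtain ⟨A, B, hAB⟩ := key N
  have h1 : ‖∑ i ∈ A, f i - ∑ i ∈ B, f i‖ ≤ 2 * C :=
    (norm_sub_le _ _).trans (by linarith [h A, h B])
  have h2 : ‖∑ i ∈ A, f i - ∑ i ∈ B, f i‖ ^ 2 ≤ (2 * C) ^ 2 := by gcongr
  have h3 := (div_lt_iff₀ (by positivity : (0 : ℝ) < ε ^ 2)).1 hN
  linarith

/-! ### Haar systems on the bidisc -/

lemma enorm_L2_sq (f : L2 𝕜) : ‖f‖ₑ ^ 2 = ∫⁻ p, ‖f p‖ₑ ^ 2 := by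
  rw [Lp.enorm_def, eLpNorm_eq_lintegral_rpow_enorm_toReal (by simp) (by simp), ← ENNReal.rpow_natCast,
    ← ENNReal.rpow_mul]
  simp

lemma inner_tensor {u v u' v' : T → ℝ} {f g : L2 𝕜} (hf : f =ᵐ[volume] tensor 𝕜 u v)
    (hg : g =ᵐ[volume] tensor 𝕜 u' v') :
    (inner 𝕜 f g : 𝕜) = (((∫ s, u s * u' s) * ∫ t, v t * v' t : ℝ) : 𝕜) := by
  rw [L2.inner_def]
  have h : ∀ᵐ p : T2, (inner 𝕜 (f p) (g p) : 𝕜)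
      = (((u p.1 * u' p.1) * (v p.2 * v' p.2) : ℝ) : 𝕜) := by
    filter_upwards [hf, hg] with p h1 h2
    rw [h1, h2, RCLike.inner_apply, tensor, tensor, RCLike.conj_ofReal, ← RCLike.ofReal_mul]
    congr 1
    ring
  rw [integral_congr_ae h, integral_ofReal, Measure.volume_eq_prod,
    integral_prod_mul (fun s => u s * u' s) fun t => v t * v' t]

lemma coeFn_haarRect (ε : Fin 2 × Fin 2) (R : Rect) :
    haarRect 𝕜 ε R =ᵐ[volume] tensor 𝕜 (haarE ε.1 R.1) (haarE ε.2 R.2) := MemLp.coeFn_toLp _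

lemma coeFn_haarRectC (a : Option DyadicInt × Option DyadicInt) :
    haarRectC 𝕜 a =ᵐ[volume] tensor 𝕜 (haarC a.1) (haarC a.2) := MemLp.coeFn_toLp _

lemma orthonormal_haarRectC : Orthonormal 𝕜 (haarRectC 𝕜) := by
  classical
  rw [orthonormal_iff_ite]
  intro a b
  rw [inner_tensor (coeFn_haarRectC a) (coeFn_haarRectC b), integral_haarC_mul_haarC,
    integral_haarC_mul_haarC]
  by_cases h1 : a.1 = b.1 <;> by_cases h2 : a.2 = b.2 <;> simp [h1, h2, Prod.ext_iff]

lemma haarRect_zero (R : Rect) : haarRect 𝕜 (0, 0) R = haarRectC 𝕜 (some R.1, some R.2) := by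
  refine Lp.ext ((coeFn_haarRect _ _).trans (Filter.EventuallyEq.trans ?_ (coeFn_haarRectC _).symm))
  rw [haarE_zero, haarE_zero]
  rfl

lemma orthonormal_haarRect : Orthonormal 𝕜 (haarRect 𝕜 (0, 0)) := by
  have h : haarRect 𝕜 (0, 0) = haarRectC 𝕜 ∘ fun R : Rect => (some R.1, some R.2) :=
    funext haarRect_zero
  rw [h]
  refine orthonormal_haarRectC.comp _ fun R R' hR => ?_
  simpa [Prod.ext_iff] using hR

/-- The indices of the functions of the completed Haar system that `h_I^ε` is made of. -/
def haarIdx (ε : Fin 2) (I : DyadicInt) : Finset (Option DyadicInt) :=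
  if ε = 0 then {some I} else
    Finset.insertNone ((Finset.range I.1).image fun k => ix k I.pt)

/-- The coefficients of `h_I^ε` in the completed Haar system. -/
def haarCf (ε : Fin 2) (I : DyadicInt) : Option DyadicInt → ℝ
  | none => 1
  | some K => if ε = 0 then 1 else haar K I.pt

lemma haarE_eq_sum (ε : Fin 2) (I : DyadicInt) (x : T) :
    haarE ε I x = ∑ a ∈ haarIdx ε I, haarCf ε I a * haarC a x := by
  by_cases h : ε = 0
  · subst h
    simp [haarIdx, haarCf, haarC, haarE_zero]
  · obtain rfl : ε = 1 := Fin.eq_one_of_ne_zero ε h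
    rw [haarE_one_expand I I.pt_mem]
    simp only [haarIdx, one_ne_zero, if_false, Finset.sum_insertNone, haarCf, haarC, one_mul]
    rw [Finset.sum_image fun a _ b _ h => congrArg Sigma.fst h]

lemma subset_suppC {ε : Fin 2} {I : DyadicInt} {a : Option DyadicInt} (ha : a ∈ haarIdx ε I) :
    I.set ⊆ suppC a := by
  unfold haarIdx at ha
  split_ifs at ha with h
  · rw [Finset.mem_singleton.1 ha]; exact subset_rfl
  · cases a with
    | none => exact Set.subset_univ _
    | some K =>
      rw [Finset.some_mem_insertNone, Finset.mem_image] at ha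
      obtain ⟨k, hk, rfl⟩ := ha
      exact set_subset_ix (Finset.mem_range.1 hk).le I.pt_mem

lemma haarRect_eq_sum (ε : Fin 2 × Fin 2) (R : Rect) :
    haarRect 𝕜 ε R = ∑ a ∈ haarIdx ε.1 R.1 ×ˢ haarIdx ε.2 R.2,
      ((haarCf ε.1 R.1 a.1 * haarCf ε.2 R.2 a.2 : ℝ) : 𝕜) • haarRectC 𝕜 a := by
  refine Lp.ext ?_
  have h1 : ∀ᵐ p : T2, ∀ a ∈ haarIdx ε.1 R.1 ×ˢ haarIdx ε.2 R.2,
      (((haarCf ε.1 R.1 a.1 * haarCf ε.2 R.2 a.2 : ℝ) : 𝕜) • haarRectC 𝕜 a : L2 𝕜) p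
      = ((haarCf ε.1 R.1 a.1 * haarCf ε.2 R.2 a.2 : ℝ) : 𝕜) * tensor 𝕜 (haarC a.1) (haarC a.2) p := by
    refine (Filter.eventually_all_finset _).2 fun a _ => ?_
    filter_upwards [Lp.coeFn_smul ((haarCf ε.1 R.1 a.1 * haarCf ε.2 R.2 a.2 : ℝ) : 𝕜)
      (haarRectC 𝕜 a), coeFn_haarRectC (𝕜 := 𝕜) a] with p h2 h3
    rw [h2, Pi.smul_apply, h3, smul_eq_mul]
  filter_upwards [coeFn_haarRect (𝕜 := 𝕜) ε R, h1, Lp.coeFn_finsetSum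
    (haarIdx ε.1 R.1 ×ˢ haarIdx ε.2 R.2) fun a =>
      (((haarCf ε.1 R.1 a.1 * haarCf ε.2 R.2 a.2 : ℝ) : 𝕜) • haarRectC 𝕜 a : L2 𝕜)] with p h2 h3 h4
  rw [h2, h4, Finset.sum_apply, Finset.sum_congr rfl h3, tensor, haarE_eq_sum, haarE_eq_sum,
    Finset.sum_mul_sum, Finset.sum_product]
  simp only [tensor]
  push_cast
  refine Finset.sum_congr rfl fun a _ => Finset.sum_congr rfl fun b _ => ?_
  ring

/-- The expansion of h_R^ε uses only completed Haar functions whose supports contain R. This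
localizes the coefficients of a paraproduct. -/
lemma inner_haarRectC_haarRect (ε : Fin 2 × Fin 2) (R : Rect)
    {a : Option DyadicInt × Option DyadicInt} (h : ¬ R.set ⊆ suppRect a) :
    (inner 𝕜 (haarRectC 𝕜 a) (haarRect 𝕜 ε R) : 𝕜) = 0 := by
  classical
  rw [haarRect_eq_sum, inner_sum]
  refine Finset.sum_eq_zero fun b hb => ?_
  obtain ⟨h1, h2⟩ := Finset.mem_product.1 hb
  rw [inner_smul_right, (orthonormal_iff_ite.1 orthonormal_haarRectC) a b, if_neg, mul_zero]
  rintro rfl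
  exact h (Set.prod_mono (subset_suppC h1) (subset_suppC h2))

/-- A series of `h_R^ε` whose finite partial sums are bounded by the measures of the unions of the
rectangles converges, and its sum lies in `BMO`. -/
lemma summable_and_bmoNormExt_le {ε : Fin 2 × Fin 2} {c : Rect → 𝕜} {B : ℝ≥0∞} (hB : B ≠ ⊤)
    (h : ∀ s : Finset Rect, ‖∑ R ∈ s, c R • haarRect 𝕜 ε R‖ₑ ^ 2
      ≤ B ^ 2 * volume (⋃ R ∈ s, R.set)) :
    (Summable fun R => c R • haarRect 𝕜 ε R) ∧
      bmoNormExt (∑' R, c R • haarRect 𝕜 ε R) ≤ B := by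
  classical
  have h1 : ∀ s : Finset Rect, ‖∑ R ∈ s, c R • haarRect 𝕜 ε R‖ₑ ≤ B := fun s =>
    le_of_sq_le_sq ((h s).trans ((mul_le_mul_right prob_le_one _).trans (mul_one _).le))
  have hsum : Summable fun R => c R • haarRect 𝕜 ε R := by
    refine summable_of_norm_sum_le (𝕜 := 𝕜) (C := B.toReal) fun s => ?_
    rw [← toReal_enorm]
    exact ENNReal.toReal_mono hB (h1 s)
  refine ⟨hsum, bmoNormExt_le_of_carleson fun s => ?_⟩
  set E := ⋃ a ∈ s, suppRect a with hE
  -- The tested coefficients see only the rectangles inside E. The rest of the series is discarded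
  -- before Bessel's inequality, and the L² bound then produces |E|.
  set 𝓡 : Set Rect := {R | R.set ⊆ E} with h𝓡
  set x : Rect → L2 𝕜 := 𝓡.indicator fun R => c R • haarRect 𝕜 ε R with hx
  have hxs : Summable x := hsum.indicator 𝓡
  have hcoef : ∀ a ∈ s, (inner 𝕜 (haarRectC 𝕜 a) (∑' R, c R • haarRect 𝕜 ε R) : 𝕜)
      = inner 𝕜 (haarRectC 𝕜 a) (∑' R, x R) := by
    intro a ha
    rw [← innerSL_apply_apply 𝕜, ← innerSL_apply_apply 𝕜, ContinuousLinearMap.map_tsum _ hsum,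
      ContinuousLinearMap.map_tsum _ hxs]
    refine tsum_congr fun R => ?_
    by_cases hR : R ∈ 𝓡
    · rw [hx, Set.indicator_of_mem hR]
    · rw [hx, Set.indicator_of_notMem hR, map_zero, innerSL_apply_apply, inner_smul_right,
        inner_haarRectC_haarRect, mul_zero]
      exact fun h2 => hR (h2.trans (Set.subset_iUnion₂ (s := fun a (_ : a ∈ s) => suppRect a) a ha))
  have hnorm : ‖∑' R, x R‖ₑ ^ 2 ≤ B ^ 2 * volume E := by
    have ht : Filter.Tendsto (fun t : Finset Rect => ‖∑ R ∈ t, x R‖ₑ ^ 2) Filter.atTop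
        (nhds (‖∑' R, x R‖ₑ ^ 2)) :=
      ((ENNReal.continuous_pow 2).comp continuous_enorm).continuousAt.tendsto.comp hxs.hasSum
    refine le_of_tendsto' ht fun t => ?_
    rw [hx, Finset.sum_indicator_eq_sum_filter]
    refine (h _).trans ?_
    gcongr
    exact Set.iUnion₂_subset fun R hR => (Finset.mem_filter.1 hR).2
  rw [Finset.sum_congr rfl fun a ha => show _ = ‖(inner 𝕜 (haarRectC 𝕜 a) (∑' R, x R) : 𝕜)‖ₑ ^ 2 by
    simp only [hcoef a ha]]
  exact (sum_enorm_inner_sq_le orthonormal_haarRectC _ s).trans hnorm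

end

section

variable {𝕜 : Type*} [RCLike 𝕜]

/-! ### Coefficients -/

lemma inner_eq_integral {u v : T → ℝ} {g : L2 𝕜} (hg : g =ᵐ[volume] tensor 𝕜 u v) (f : L2 𝕜) :
    (inner 𝕜 g f : 𝕜) = ∫ p : T2, ((u p.1 * v p.2 : ℝ) : 𝕜) * f p := by
  rw [L2.inner_def]
  refine integral_congr_ae ?_
  filter_upwards [hg] with p hp
  rw [hp, RCLike.inner_apply, tensor, RCLike.conj_ofReal, mul_comm]

lemma integrable_tensor_mul {u v : T → ℝ} {g : L2 𝕜} (hg : g =ᵐ[volume] tensor 𝕜 u v) (f : L2 𝕜) :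
    Integrable (fun p : T × T => ((u p.1 * v p.2 : ℝ) : 𝕜) * f p) (volume.prod volume) := by
  refine (L2.integrable_inner (𝕜 := 𝕜) g f).congr ?_
  filter_upwards [hg] with p hp
  rw [hp, RCLike.inner_apply, tensor, RCLike.conj_ofReal, mul_comm]

lemma inner_none_left {f : L2 𝕜} (hf : IsL20 f) (b : Option DyadicInt) :
    (inner 𝕜 (haarRectC 𝕜 (none, b)) f : 𝕜) = 0 := by
  rw [inner_eq_integral (coeFn_haarRectC _)]
  refine (integral_prod_symm _ (integrable_tensor_mul (coeFn_haarRectC _) f)).trans ?_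
  refine integral_eq_zero_of_ae ?_
  filter_upwards [hf.2] with t ht
  simp only [haarC, one_mul, Pi.zero_apply]
  rw [integral_const_mul, ht, mul_zero]

lemma inner_none_right {f : L2 𝕜} (hf : IsL20 f) (a : Option DyadicInt) :
    (inner 𝕜 (haarRectC 𝕜 (a, none)) f : 𝕜) = 0 := by
  rw [inner_eq_integral (coeFn_haarRectC _)]
  refine (integral_prod _ (integrable_tensor_mul (coeFn_haarRectC _) f)).trans ?_
  refine integral_eq_zero_of_ae ?_
  filter_upwards [hf.1] with t ht
  simp only [haarC, mul_one, Pi.zero_apply]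
  rw [integral_const_mul, ht, mul_zero]

lemma coef_zero (f : L2 𝕜) (R : Rect) :
    coef (0, 0) f R = inner 𝕜 (haarRectC 𝕜 (some R.1, some R.2)) f := by
  rw [coef, haarRect_zero]

/-- In the expansion of χ_I / |I| the constant term is annihilated by the mean-zero condition. The
Haar coefficients on the strict ancestors of I remain. -/
lemma coef_one_zero {f : L2 𝕜} (hf : IsL20 f) (R : Rect) :
    coef (1, 0) f R = meanCoef (coef (0, 0) f) R := by
  rw [coef, haarRect_eq_sum, sum_inner, Finset.sum_product]
  simp only [haarIdx, one_ne_zero, if_false, if_true, Finset.sum_insertNone, Finset.sum_singleton,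
    inner_smul_left, inner_none_left hf, mul_zero, zero_add]
  rw [Finset.sum_image fun a _ b _ h => congrArg Sigma.fst h, meanCoef]
  refine Finset.sum_congr rfl fun k _ => ?_
  rw [coef_zero, mul_comm, RCLike.conj_ofReal]
  simp [haarCf]

lemma coef_zero_one {f : L2 𝕜} (hf : IsL20 f) (R : Rect) :
    coef (0, 1) f R = meanCoef (fun R => coef (0, 0) f R.swap) R.swap := by
  rw [coef, haarRect_eq_sum, sum_inner, Finset.sum_product_right]
  simp only [haarIdx, one_ne_zero, if_false, if_true, Finset.sum_insertNone, Finset.sum_singleton,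
    inner_smul_left, inner_none_right hf, mul_zero, zero_add]
  rw [Finset.sum_image fun a _ b _ h => congrArg Sigma.fst h, meanCoef]
  refine Finset.sum_congr rfl fun k _ => ?_
  rw [coef_zero, mul_comm, RCLike.conj_ofReal]
  simp [haarCf]

lemma coef_delta (k : ℕ × ℕ) (φ : L2 𝕜) (R : Rect) :
    coef (0, 0) (delta k φ) R = if k = (R.1.1, R.2.1) then coef (0, 0) φ R else 0 := by
  classical
  obtain ⟨⟨i, a⟩, ⟨j, b⟩⟩ := R
  have h := orthonormal_iff_ite.1 (orthonormal_haarRect (𝕜 := 𝕜))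
  rw [coef, delta]
  simp only [inner_sum, inner_smul_right, h]
  by_cases hk : k = (i, j)
  · subst hk
    rw [if_pos rfl, Finset.sum_eq_single a, Finset.sum_eq_single b]
    · simp
    · intro b' _ hb'
      rw [if_neg, mul_zero]
      simpa [eq_comm] using hb'
    · simp
    · intro a' _ ha'
      refine Finset.sum_eq_zero fun b' _ => ?_
      rw [if_neg, mul_zero]
      intro h2
      refine ha' ?_
      simpa [eq_comm] using congrArg Prod.fst h2
    · simp
  · rw [if_neg hk]
    refine Finset.sum_eq_zero fun a' _ => Finset.sum_eq_zero fun b' _ => ?_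
    rw [if_neg, mul_zero]
    rintro h2
    exact hk (Prod.ext (congrArg (fun R : Rect => R.1.1) h2).symm
      (congrArg (fun R : Rect => R.2.1) h2).symm)

lemma enorm_sum_smul_sq {ι E : Type*} [NormedAddCommGroup E] [InnerProductSpace 𝕜 E] {v : ι → E}
    (hv : Orthonormal 𝕜 v) (c : ι → 𝕜) (s : Finset ι) :
    ‖∑ i ∈ s, c i • v i‖ ^ 2 = ∑ i ∈ s, ‖c i‖ ^ 2 := by
  have h := hv.inner_sum c c s
  rw [inner_self_eq_norm_sq_to_K] at h
  have h2 : (((‖∑ i ∈ s, c i • v i‖ ^ 2 : ℝ)) : 𝕜) = ((∑ i ∈ s, ‖c i‖ ^ 2 : ℝ) : 𝕜) := by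
    push_cast
    rw [h]
    exact Finset.sum_congr rfl fun i _ => RCLike.conj_mul _
  exact_mod_cast h2

/-- The Haar series of φ, unconditionally summable by Bessel, regrouped by levels. Summability is
required to read coefficients off `Q1` and `Q2` term by term, since a divergent `tsum` would be `0`.
-/
lemma summable_delta (φ : L2 𝕜) : Summable fun k => delta k φ := by
  have h1 : Summable fun R : Rect => coef (0, 0) φ R • haarRect 𝕜 (0, 0) R := by
    refine summable_of_norm_sum_le (𝕜 := 𝕜) (C := ‖φ‖) fun s => ?_
    refine (sq_le_sq₀ (norm_nonneg _) (norm_nonneg _)).1 ?_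
    rw [enorm_sum_smul_sq orthonormal_haarRect]
    exact orthonormal_haarRect.sum_inner_products_le φ
  let e : (Σ k : ℕ × ℕ, Fin (2 ^ k.1) × Fin (2 ^ k.2)) → Rect := fun q =>
    (⟨q.1.1, q.2.1⟩, ⟨q.1.2, q.2.2⟩)
  have he : Function.Injective e := by
    rintro ⟨⟨i, j⟩, a, b⟩ ⟨⟨i', j'⟩, a', b'⟩ h
    simp only [e, Prod.mk.injEq, Sigma.mk.injEq] at h
    obtain ⟨⟨rfl, h1⟩, rfl, h2⟩ := h
    cases h1
    cases h2
    rfl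
  have h2 := (h1.comp_injective he).sigma
  refine h2.congr fun k => ?_
  rw [tsum_fintype, Fintype.sum_prod_type]
  rfl

lemma coef_tsum_delta (s : Set (ℕ × ℕ)) [DecidablePred (· ∈ s)] (φ : L2 𝕜) (R : Rect) :
    coef (0, 0) (∑' k : s, delta k.1 φ) R = if (R.1.1, R.2.1) ∈ s then coef (0, 0) φ R else 0 := by
  classical
  have hs : Summable fun k : s => delta k.1 φ := (summable_delta φ).subtype s
  rw [coef, ← innerSL_apply_apply 𝕜, ContinuousLinearMap.map_tsum _ hs]
  have h : ∀ k : s, innerSL 𝕜 (haarRect 𝕜 (0, 0) R) (delta k.1 φ)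
      = if k.1 = (R.1.1, R.2.1) then coef (0, 0) φ R else 0 := fun k => coef_delta k.1 φ R
  simp_rw [h]
  split_ifs with hR
  · rw [tsum_eq_single ⟨_, hR⟩]
    · simp
    · intro k hk
      rw [if_neg]
      exact fun h2 => hk (Subtype.ext h2)
  · refine (tsum_congr fun k => ?_).trans (tsum_zero (β := s) (α := 𝕜))
    rw [if_neg]
    exact fun h2 => hR (h2 ▸ k.2)

lemma coef_Q1 (i : ℕ) (φ : L2 𝕜) (R : Rect) :
    coef (0, 0) (Q1 i φ) R = if i ≤ R.1.1 then coef (0, 0) φ R else 0 :=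
  coef_tsum_delta {k | i ≤ k.1} φ R

lemma coef_Q2 (j : ℕ) (φ : L2 𝕜) (R : Rect) :
    coef (0, 0) (Q2 j φ) R = if j ≤ R.2.1 then coef (0, 0) φ R else 0 :=
  coef_tsum_delta {k | j ≤ k.2} φ R

/-! ### Norms of finite sums -/

lemma enorm_haarE_one (I : DyadicInt) (x : T) :
    ‖haarE 1 I x‖ₑ = I.set.indicator (fun _ => (volume I.set)⁻¹) x := by
  rw [haarE_one]
  by_cases hx : x ∈ I.set
  · rw [Set.indicator_of_mem hx, Set.indicator_of_mem hx, I.volume_set,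
      ← ENNReal.ofReal_inv_of_pos I.len_pos, ← ofReal_norm, Real.norm_of_nonneg]
    exact inv_nonneg.2 I.len_pos.le
  · rw [Set.indicator_of_notMem hx, Set.indicator_of_notMem hx, enorm_zero]

lemma enorm_tensor (u v : T → ℝ) (p : T2) : ‖tensor 𝕜 u v p‖ₑ = ‖u p.1‖ₑ * ‖v p.2‖ₑ := by
  rw [tensor, ← enorm_mul, ← ofReal_norm, RCLike.norm_ofReal, ← Real.norm_eq_abs, ofReal_norm]

lemma coeFn_sum_haarRect (ε : Fin 2 × Fin 2) (c : Rect → 𝕜) (s : Finset Rect) :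
    ∀ᵐ p : T2, (∑ R ∈ s, c R • haarRect 𝕜 ε R : L2 𝕜) p
      = ∑ R ∈ s, c R * tensor 𝕜 (haarE ε.1 R.1) (haarE ε.2 R.2) p := by
  have h1 : ∀ᵐ p : T2, ∀ R ∈ s, (c R • haarRect 𝕜 ε R : L2 𝕜) p
      = c R * tensor 𝕜 (haarE ε.1 R.1) (haarE ε.2 R.2) p := by
    refine (Filter.eventually_all_finset _).2 fun R _ => ?_
    filter_upwards [Lp.coeFn_smul (c R) (haarRect 𝕜 ε R), coeFn_haarRect (𝕜 := 𝕜) ε R] with p h2 h3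
    rw [h2, Pi.smul_apply, h3, smul_eq_mul]
  filter_upwards [h1, Lp.coeFn_finsetSum s fun R => (c R • haarRect 𝕜 ε R : L2 𝕜)] with p h2 h3
  rw [h3, Finset.sum_apply, Finset.sum_congr rfl h2]

lemma enorm_sum_haarRect_one_sq_le (c : Rect → 𝕜) (s : Finset Rect) :
    ‖∑ R ∈ s, c R • haarRect 𝕜 (1, 1) R‖ₑ ^ 2
      ≤ ∫⁻ p, (∑ R ∈ s, R.set.indicator (fun _ => ‖c R‖ₑ * (volume R.set)⁻¹) p) ^ 2 := by
  rw [enorm_L2_sq]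
  refine lintegral_mono_ae ?_
  filter_upwards [coeFn_sum_haarRect (1, 1) c s] with p hp
  rw [hp]
  gcongr
  refine (enorm_sum_le _ _).trans (Finset.sum_le_sum fun R _ => ?_)
  rw [enorm_mul, enorm_tensor, enorm_haarE_one, enorm_haarE_one, Rect.volume_set,
    ENNReal.mul_inv (Or.inl R.1.volume_set_ne_zero) (Or.inl R.1.volume_set_ne_top)]
  by_cases h1 : p.1 ∈ R.1.set <;> by_cases h2 : p.2 ∈ R.2.set <;> simp [Rect.set, h1, h2]

/-- The bound for the paraproduct `Δ_φ`. -/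
theorem boundedBy_one_one {φ : L2 𝕜} {A : ℝ≥0} (hφ : bmoNorm φ ≤ A) :
    BoundedBy (1, 1) φ (16 * A) := by
  intro f _ hft
  have h1 := carleson_of_bmoNorm_le ENNReal.coe_ne_top hφ
  have h2 := carleson_of_bmoNorm_le hft.ne le_rfl
  refine summable_and_bmoNormExt_le (ε := (1, 1)) (c := fun R => coef (0, 0) φ R * coef (0, 0) f R)
    (ENNReal.mul_ne_top ENNReal.coe_ne_top hft.ne) fun s => ?_
  refine (enorm_sum_haarRect_one_sq_le _ s).trans ?_
  simp only [enorm_mul]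
  refine (lintegral_sq_sum_indicator_le h1 s _ (fun _ => enorm_ne_top) fun _ => enorm_ne_top).trans ?_
  calc _ ≤ 256 * (A : ℝ≥0∞) ^ 2 * (bmoNorm f ^ 2 * volume (⋃ R ∈ s, R.set)) := by
        gcongr
        exact h2 s
    _ = _ := by
        push_cast
        ring

/-- The Gram matrix of the functions of a mixed paraproduct. -/
def IsMixed (x : Rect → L2 𝕜) : Prop :=
  ∀ R R' : Rect, (inner 𝕜 (x R) (x R') : 𝕜)
    = (((if R.1 = R'.1 then 1 else 0) * ∫ t, haarE 1 R.2 t * haarE 1 R'.2 t : ℝ) : 𝕜)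

lemma isMixed_zero_one : IsMixed (haarRect 𝕜 (0, 1)) := by
  intro R R'
  rw [inner_tensor (coeFn_haarRect _ _) (coeFn_haarRect _ _)]
  simp only [haarE_zero, integral_haar_mul_haar]

lemma isMixed_one_zero : IsMixed fun R => haarRect 𝕜 (1, 0) R.swap := by
  intro R R'
  rw [inner_tensor (coeFn_haarRect _ _) (coeFn_haarRect _ _), mul_comm]
  simp only [haarE_zero, integral_haar_mul_haar, Prod.fst_swap, Prod.snd_swap]

/-- Different first sides are orthogonal, and for a common first side the inner products are those
of the functions χ_J / |J|. Taking absolute values in the double sum leaves the energy of the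
strips. -/
lemma IsMixed.enorm_sum_sq_le {x : Rect → L2 𝕜} (hx : IsMixed x) (c : Rect → 𝕜) (s : Finset Rect) :
    ‖∑ R ∈ s, c R • x R‖ₑ ^ 2
      ≤ ∑ I ∈ s.image Prod.fst, ∫⁻ t, strip s (fun R => ‖c R‖ₑ) I t ^ 2 := by
  classical
  have hE : ∀ R R' : Rect, ‖(inner 𝕜 (x R) (x R') : 𝕜)‖ₑ ≤ if R.1 = R'.1 then
      ∫⁻ t, ‖haarE 1 R.2 t‖ₑ * ‖haarE 1 R'.2 t‖ₑ else 0 := by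
    intro R R'
    rw [hx R R', ← ofReal_norm, RCLike.norm_ofReal, ← Real.norm_eq_abs, ofReal_norm]
    split_ifs with h
    · rw [one_mul]
      refine (enorm_integral_le_lintegral_enorm _).trans (le_of_eq ?_)
      simp_rw [enorm_mul]
    · simp
  have h1 : ‖∑ R ∈ s, c R • x R‖ₑ ^ 2 ≤ ∑ R ∈ s, ∑ R' ∈ s,
      ‖c R‖ₑ * ‖c R'‖ₑ * ‖(inner 𝕜 (x R) (x R') : 𝕜)‖ₑ := by
    have h2 : ‖∑ R ∈ s, c R • x R‖ₑ ^ 2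
        = ‖(inner 𝕜 (∑ R ∈ s, c R • x R) (∑ R ∈ s, c R • x R) : 𝕜)‖ₑ := by
      rw [inner_self_eq_norm_sq_to_K, ← ofReal_norm, ← ofReal_norm, norm_pow, RCLike.norm_ofReal,
        abs_norm, ENNReal.ofReal_pow (norm_nonneg _)]
    rw [h2, sum_inner]
    refine (enorm_sum_le _ _).trans (Finset.sum_le_sum fun R _ => ?_)
    rw [inner_sum]
    refine (enorm_sum_le _ _).trans (Finset.sum_le_sum fun R' _ => ?_)
    rw [inner_smul_left, inner_smul_right, enorm_mul, enorm_mul, mul_assoc]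
    gcongr
    rw [← ofReal_norm, RCLike.norm_conj, ofReal_norm]
  refine h1.trans ?_
  rw [← Finset.sum_fiberwise_of_maps_to (g := Prod.fst) (t := s.image Prod.fst)
    fun R hR => Finset.mem_image_of_mem _ hR]
  refine Finset.sum_le_sum fun I _ => ?_
  have hm : ∀ J : DyadicInt, Measurable fun t => ‖haarE 1 J t‖ₑ := fun J => (measurable_haarE 1 J).enorm
  have hmm : ∀ R R' : Rect, Measurable fun t =>
      ‖c R‖ₑ * ‖c R'‖ₑ * (‖haarE 1 R.2 t‖ₑ * ‖haarE 1 R'.2 t‖ₑ) := fun R R' =>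
    ((hm _).mul (hm _)).const_mul _
  have h3 : ∀ t, strip s (fun R => ‖c R‖ₑ) I t ^ 2 = ∑ R ∈ s with R.1 = I, ∑ R' ∈ s with R'.1 = I,
      ‖c R‖ₑ * ‖c R'‖ₑ * (‖haarE 1 R.2 t‖ₑ * ‖haarE 1 R'.2 t‖ₑ) := by
    intro t
    have h4 : strip s (fun R => ‖c R‖ₑ) I t = ∑ R ∈ s with R.1 = I, ‖c R‖ₑ * ‖haarE 1 R.2 t‖ₑ := by
      refine Finset.sum_congr rfl fun R _ => ?_
      rw [enorm_haarE_one]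
      by_cases ht : t ∈ R.2.set <;> simp [ht]
    rw [h4, sq, Finset.sum_mul_sum]
    refine Finset.sum_congr rfl fun R _ => Finset.sum_congr rfl fun R' _ => ?_
    ring
  simp_rw [h3]
  rw [lintegral_finsetSum _ fun R _ => Finset.measurable_sum _ fun R' _ => hmm R R']
  refine Finset.sum_le_sum fun R hR => ?_
  rw [lintegral_finsetSum _ fun R' _ => hmm R R', Finset.sum_filter]
  refine Finset.sum_le_sum fun R' hR' => ?_
  have hRI := (Finset.mem_filter.1 hR).2
  have h5 := hE R R'
  split_ifs with h6
  · rw [hRI, h6, if_pos rfl] at h5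
    rw [lintegral_const_mul' _ _ (ENNReal.mul_ne_top enorm_ne_top enorm_ne_top)]
    gcongr
  · rw [hRI, if_neg fun h => h6 h.symm] at h5
    rw [nonpos_iff_eq_zero.1 h5, mul_zero]

lemma IsMixed.enorm_sum_sq_le_volume {x : Rect → L2 𝕜} (hx : IsMixed x) {φ f : Rect → 𝕜} {L F : ℝ≥0∞}
    (hφ : ∀ i : ℕ, Carleson Rect.set (fun R => if i ≤ R.1.1 then ‖φ R‖ₑ ^ 2 else 0)
      ((L * (1 / ((i : ℝ≥0∞) + 1))) ^ 2))
    (hf : Carleson Rect.set (fun R => ‖f R‖ₑ ^ 2) (F ^ 2)) (s : Finset Rect) :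
    ‖∑ R ∈ s, (φ R * meanCoef f R) • x R‖ₑ ^ 2
      ≤ (2 ^ 13 * L * F) ^ 2 * volume (⋃ R ∈ s, R.set) := by
  refine (hx.enorm_sum_sq_le _ s).trans ?_
  simp only [enorm_mul]
  refine (sum_lintegral_strip_sq_le hφ (fun _ => enorm_ne_top) hf s).trans (le_of_eq ?_)
  ring

lemma lmo_const_ne_top (C : ℝ≥0) (i : ℕ) : (C : ℝ≥0∞) * (1 / ((i : ℝ≥0∞) + 1)) ≠ ⊤ :=
  ENNReal.mul_ne_top ENNReal.coe_ne_top (ENNReal.div_ne_top ENNReal.one_ne_top (by simp))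

theorem boundedBy_zero_one {φ : L2 𝕜} {C : ℝ≥0}
    (hφ : ∀ i : ℕ, bmoNorm (Q1 i φ) ≤ C * (1 / ((i : ℝ≥0∞) + 1))) :
    BoundedBy (0, 1) φ (2 ^ 13 * C) := by
  intro f hf hft
  have h1 : ∀ i : ℕ, Carleson Rect.set
      (fun R => if i ≤ R.1.1 then ‖coef (0, 0) φ R‖ₑ ^ 2 else 0)
      (((C : ℝ≥0∞) * (1 / ((i : ℝ≥0∞) + 1))) ^ 2) := fun i =>
    (carleson_of_bmoNorm_le (lmo_const_ne_top C i) (hφ i)).mono fun R => by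
      rw [coef_Q1]
      split_ifs <;> simp
  have h2 := carleson_of_bmoNorm_le hft.ne le_rfl
  have h3 : paraTerm (0, 1) φ f = fun R =>
      (coef (0, 0) φ R * meanCoef (coef (0, 0) f) R) • haarRect 𝕜 (0, 1) R := by
    funext R
    rw [paraTerm, ← coef_one_zero hf]
    rfl
  rw [paraproduct, h3]
  refine summable_and_bmoNormExt_le (ENNReal.mul_ne_top ENNReal.coe_ne_top hft.ne) fun s => ?_
  refine (isMixed_zero_one.enorm_sum_sq_le_volume h1 h2 s).trans (le_of_eq ?_)
  push_cast
  ring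

/-- The exchange of variables carries this to the estimate behind `boundedBy_zero_one`:
coefficients, packing conditions and Gram matrix are all read through `Prod.swap`. -/
theorem boundedBy_one_zero {φ : L2 𝕜} {C : ℝ≥0}
    (hφ : ∀ j : ℕ, bmoNorm (Q2 j φ) ≤ C * (1 / ((j : ℝ≥0∞) + 1))) :
    BoundedBy (1, 0) φ (2 ^ 13 * C) := by
  classical
  intro f hf hft
  have h1 : ∀ j : ℕ, Carleson Rect.set
      (fun R => if j ≤ R.1.1 then ‖coef (0, 0) φ R.swap‖ₑ ^ 2 else 0)
      (((C : ℝ≥0∞) * (1 / ((j : ℝ≥0∞) + 1))) ^ 2) := fun j =>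
    (carleson_of_bmoNorm_le (lmo_const_ne_top C j) (hφ j)).swap.mono fun R => by
      rw [coef_Q2, Prod.snd_swap]
      split_ifs <;> simp
  have h2 := (carleson_of_bmoNorm_le hft.ne le_rfl).swap
  have h3 : paraTerm (1, 0) φ f = fun R =>
      (coef (0, 0) φ R * meanCoef (fun R => coef (0, 0) f R.swap) R.swap) • haarRect 𝕜 (1, 0) R := by
    funext R
    rw [paraTerm, ← coef_zero_one hf]
    rfl
  rw [paraproduct, h3]
  refine summable_and_bmoNormExt_le (ENNReal.mul_ne_top ENNReal.coe_ne_top hft.ne) fun s => ?_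
  have h4 := isMixed_one_zero.enorm_sum_sq_le_volume h1 h2 (s.map (Equiv.prodComm _ _).toEmbedding)
  rw [Finset.sum_map] at h4
  refine h4.trans (le_of_eq ?_)
  rw [← volume_biUnion_swap s]
  have h5 : (⋃ R ∈ s.map (Equiv.prodComm DyadicInt DyadicInt).toEmbedding, Rect.set R)
      = ⋃ R ∈ s, Rect.set R.swap := by
    ext p
    simp only [Set.mem_iUnion, Finset.mem_map, exists_prop]
    constructor
    · rintro ⟨_, ⟨R, hR, rfl⟩, hp⟩
      exact ⟨R, hR, hp⟩
    · rintro ⟨R, hR, hp⟩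
      exact ⟨_, ⟨R, hR, rfl⟩, hp⟩
  rw [h5]
  push_cast
  ring

end

section

/-! ### Haar coefficients on large intervals of functions with small support -/

/-- Summation over the dyadic tree by means of a potential. -/
lemma sum_len_mul_le_root {G D : DyadicInt → ℝ} (hG : ∀ I, 0 ≤ G I) (hD : ∀ I, 0 ≤ D I)
    (h : ∀ I, D I ≤ G I - (G I.lo + G I.hi) / 2) (s : Finset DyadicInt) :
    ∑ I ∈ s, I.len * D I ≤ G root := by
  classical
  -- Telescoping over the levels: the drop of the level average of `G` dominates the level average
  -- of `D`.
  have h1 : ∀ n : ℕ, ∑ k ∈ Finset.range n, levelAv k D + levelAv n G ≤ G root := by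
    intro n
    induction n with
    | zero => rw [levelAv_zero]; simp
    | succ n ih =>
      have h2 : levelAv n D + levelAv (n + 1) G ≤ levelAv n G := by
        rw [levelAv_succ]
        unfold levelAv
        rw [← mul_add, ← Finset.sum_add_distrib]
        gcongr with a
        linarith [h ⟨n, a⟩]
      rw [Finset.sum_range_succ]
      linarith
  set n := s.sup (fun I => I.1) + 1 with hn
  have h3 : s ⊆ (Finset.range n).sigma fun _ => Finset.univ := fun I hI =>
    Finset.mem_sigma.2 ⟨Finset.mem_range.2 (Nat.lt_succ_of_le
      (Finset.le_sup (f := fun I : DyadicInt => I.1) hI)), Finset.mem_univ _⟩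
  calc ∑ I ∈ s, I.len * D I
      ≤ ∑ I ∈ ((Finset.range n).sigma fun _ => Finset.univ : Finset DyadicInt), DyadicInt.len I * D I :=
        Finset.sum_le_sum_of_subset_of_nonneg h3 fun I _ _ => mul_nonneg I.len_pos.le (hD I)
    _ = ∑ k ∈ Finset.range n, levelAv k D := by
        rw [Finset.sum_sigma]
        refine Finset.sum_congr rfl fun k _ => ?_
        rw [levelAv, Finset.mul_sum]
        rfl
    _ ≤ G root := by
        have h4 : 0 ≤ levelAv n G := by
          unfold levelAv
          exact mul_nonneg (by positivity) (Finset.sum_nonneg fun a _ => hG _)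
        linarith [h1 n]

/-- The mean of `f` over `I`. -/
def mean (f : T → ℝ) (I : DyadicInt) : ℝ := I.len⁻¹ * ∫ x in I.set, f x

lemma mean_split {f : T → ℝ} (hf : Integrable f) (I : DyadicInt) :
    mean f I = (mean f I.lo + mean f I.hi) / 2 := by
  have hl := I.len_pos.ne'
  unfold mean
  rw [I.set_eq_union, setIntegral_union I.disjoint_lo_hi I.hi.measurableSet_set hf.integrableOn
    hf.integrableOn, DyadicInt.len_lo, DyadicInt.len_hi]
  field_simp

/-- The coefficient is √|I|/2 times the difference of the means over the two halves, so its square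
is |I| times their variance. This is an increment of the kind summed in `sum_len_mul_le_root`. -/
lemma sq_integral_mul_haar {f : T → ℝ} (hf : Integrable f) (I : DyadicInt) :
    (∫ x, f x * haar I x) ^ 2 = I.len * ((mean f I.lo ^ 2 + mean f I.hi ^ 2) / 2 - mean f I ^ 2) := by
  have hl := I.len_pos
  have hs : (Real.sqrt I.len)⁻¹ ^ 2 = I.len⁻¹ := by rw [inv_pow, Real.sq_sqrt hl.le]
  rw [mean_split hf I, integral_mul_haar I hf]
  unfold mean
  rw [DyadicInt.len_lo, DyadicInt.len_hi, ← mul_sub, mul_pow, hs]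
  field_simp
  ring

/-- `D` has small density in all dyadic intervals that strictly contain `I`. -/
def Alive (D : Set T) (δ : ℝ) (I : DyadicInt) : Prop :=
  ∀ k < I.1, mean (D.indicator fun _ => 1) (ix k I.pt) ≤ δ

lemma integrable_indicator_one {D : Set T} (hD : MeasurableSet D) :
    Integrable (D.indicator fun _ => (1 : ℝ)) := (integrable_const _).indicator hD

/-- The parent has density at most δ, and passing to a half at most doubles it. -/
lemma Alive.mean_le {D : Set T} (hD : MeasurableSet D) {δ : ℝ}
    (hroot : mean (D.indicator fun _ => 1) root ≤ 2 * δ) {I : DyadicInt} (h : Alive D δ I) :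
    mean (D.indicator fun _ => 1) I ≤ 2 * δ := by
  obtain ⟨k, a⟩ := I
  cases k with
  | zero =>
    have : (⟨0, a⟩ : DyadicInt) = root := by
      unfold root
      congr 1
      exact Subsingleton.elim (α := Fin 1) _ _
    rwa [this]
  | succ k =>
    set I : DyadicInt := ⟨k + 1, a⟩ with hI
    have h1 := h k (Nat.lt_succ_self k)
    have h2 : I.set ⊆ (ix k I.pt).set := set_subset_ix (Nat.le_succ k) I.pt_mem
    have h3 : (ix k I.pt).len = 2 * I.len := by
      simp only [DyadicInt.len, ix_fst, hI, pow_succ]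
      field_simp
    have h4 : ∫ x in I.set, D.indicator (fun _ => (1 : ℝ)) x
        ≤ ∫ x in (ix k I.pt).set, D.indicator (fun _ => (1 : ℝ)) x :=
      setIntegral_mono_set (integrable_indicator_one hD).integrableOn
        (Filter.Eventually.of_forall fun _ => Set.indicator_nonneg (fun _ _ => zero_le_one) _)
        h2.eventuallyLE
    have hl := I.len_pos
    unfold mean at h1 ⊢
    rw [h3] at h1
    calc _ ≤ I.len⁻¹ * ∫ x in (ix k I.pt).set, D.indicator (fun _ => (1 : ℝ)) x := by gcongr
      _ = 2 * ((2 * I.len)⁻¹ * ∫ x in (ix k I.pt).set, D.indicator (fun _ => (1 : ℝ)) x) := by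
          field_simp
      _ ≤ _ := by linarith

/-- Cauchy–Schwarz for f = f χ_D, in the form of integrating (f - c χ_D)² ≥ 0 with c equal to the
mean of f divided by η. -/
lemma sq_mean_le {D : Set T} (hD : MeasurableSet D) {f : T → ℝ} (hf : Measurable f)
    (hb : ∃ K : ℝ, ∀ x, |f x| ≤ K) (hfD : ∀ x ∉ D, f x = 0) {η : ℝ} (hη : 0 < η) {I : DyadicInt}
    (h : mean (D.indicator fun _ => 1) I ≤ η) : mean f I ^ 2 ≤ η * mean (fun x => f x ^ 2) I := by
  set c := mean f I / η with hc
  have hi1 : Integrable f := integrable_of_bdd hf hb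
  have hi2 : Integrable fun x => f x ^ 2 := integrable_sq_of_bdd hf hb
  have hi3 := integrable_indicator_one hD
  have h1 : 0 ≤ ∫ x in I.set, (f x ^ 2 - 2 * c * f x + c ^ 2 * D.indicator (fun _ => (1 : ℝ)) x) := by
    refine integral_nonneg fun x => ?_
    by_cases hx : x ∈ D
    · simp only [Set.indicator_of_mem hx, Pi.zero_apply]
      nlinarith [sq_nonneg (f x - c)]
    · simp [hx, hfD x hx]
  have hi4 : Integrable fun x => 2 * c * f x := hi1.const_mul _
  have hi5 : Integrable fun x => f x ^ 2 - 2 * c * f x := hi2.sub hi4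
  rw [integral_add hi5.integrableOn (hi3.const_mul _).integrableOn,
    integral_sub hi2.integrableOn hi4.integrableOn, integral_const_mul,
    integral_const_mul] at h1
  have hl := inv_pos.2 I.len_pos
  have h2 := mul_nonneg hl.le h1
  have h3 : 0 ≤ mean (fun x => f x ^ 2) I - 2 * c * mean f I + c ^ 2 * mean (D.indicator fun _ => 1) I := by
    unfold mean
    linarith
  have h4 : c ^ 2 * mean (D.indicator fun _ => 1) I ≤ c ^ 2 * η := by gcongr
  have h5 : c * η = mean f I := by rw [hc]; field_simp
  have h6 : c ^ 2 * η = c * mean f I := by rw [← h5]; ring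
  have h7 : c * mean f I ≤ mean (fun x => f x ^ 2) I := by linarith
  calc mean f I ^ 2 = η * (c * mean f I) := by rw [← h5]; ring
    _ ≤ _ := by gcongr

lemma set_root : root.set = Set.univ := by
  refine Set.eq_univ_of_forall fun x => ?_
  rw [DyadicInt.mem_set_iff]
  exact Sigma.ext rfl (heq_of_eq (Subsingleton.elim (α := Fin 1) _ _))

lemma exists_set_eq_suppC (a : Option DyadicInt) : ∃ I : DyadicInt, I.set = suppC a := by
  cases a with
  | none => exact ⟨root, set_root⟩
  | some I => exact ⟨I, rfl⟩

/-- `D` has density greater than `δ` in some dyadic interval that contains `suppC a`. -/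
def Dense (D : Set T) (δ : ℝ) (a : Option DyadicInt) : Prop :=
  ∃ K : DyadicInt, suppC a ⊆ K.set ∧ ENNReal.ofReal δ < av K.set (D.indicator fun _ => 1)

lemma mean_le_of_not_dense {D : Set T} (hD : MeasurableSet D) {δ : ℝ} (hδ : 0 < δ)
    {a : Option DyadicInt} (ha : ¬ Dense D δ a) {K : DyadicInt} (hK : suppC a ⊆ K.set) :
    mean (D.indicator fun _ => 1) K ≤ δ := by
  have h1 : av K.set (D.indicator fun _ => 1) ≤ ENNReal.ofReal δ :=
    not_lt.1 fun h => ha ⟨K, hK, h⟩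
  have hl := K.len_pos
  rw [av_indicator hD, DyadicInt.volume_set, ← ENNReal.ofReal_inv_of_pos hl,
    ← ofReal_measureReal, ← ENNReal.ofReal_mul (inv_pos.2 hl).le, ENNReal.ofReal_le_ofReal_iff hδ.le] at h1
  rw [mean, setIntegral_indicator hD]
  simpa using h1

/-- Haar coefficients of a function supported in `D` on intervals that are not contained in an
interval where `D` is dense. -/
theorem sum_sq_integral_le {D : Set T} (hD : MeasurableSet D) {f : T → ℝ} (hf : Measurable f)
    (hb : ∃ K : ℝ, ∀ x, |f x| ≤ K) (hfD : ∀ x ∉ D, f x = 0) {δ : ℝ} (hδ : 0 < δ)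
    (s : Finset (Option DyadicInt)) (hs : ∀ a ∈ s, ¬ Dense D δ a) :
    ∑ a ∈ s, (∫ x, f x * haarC a x) ^ 2 ≤ 2 * δ * ∫ x, f x ^ 2 := by
  classical
  have hi1 : Integrable f := integrable_of_bdd hf hb
  have hi2 : Integrable fun x => f x ^ 2 := integrable_sq_of_bdd hf hb
  rcases s.eq_empty_or_nonempty with rfl | ⟨a, ha⟩
  · rw [Finset.sum_empty]
    exact mul_nonneg (by positivity) (integral_nonneg fun x => sq_nonneg (f x))
  have hroot : mean (D.indicator fun _ => 1) root ≤ δ :=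
    mean_le_of_not_dense hD hδ (hs a ha) (by rw [set_root]; exact Set.subset_univ _)
  have hroot2 : mean (D.indicator fun _ => 1) root ≤ 2 * δ := by linarith
  -- The potential is nonnegative on alive intervals, whose density is at most 2δ. If the density of
  -- I itself is at most δ, both halves stay alive, the f² term averages to itself, and the drop is
  -- exactly the variance in `Δ`. Otherwise both halves are dead, with potential 0.
  set G : DyadicInt → ℝ := fun I =>
    if Alive D δ I then 2 * δ * mean (fun x => f x ^ 2) I - mean f I ^ 2 else 0 with hG
  set B : DyadicInt → Prop := fun I => Alive D δ I ∧ mean (D.indicator fun _ => 1) I ≤ δ with hB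
  set Δ : DyadicInt → ℝ := fun I =>
    if B I then (mean f I.lo ^ 2 + mean f I.hi ^ 2) / 2 - mean f I ^ 2 else 0 with hΔ
  have hG0 : ∀ I, 0 ≤ G I := by
    intro I
    by_cases h : Alive D δ I
    · simp only [hG, if_pos h, sub_nonneg]
      exact sq_mean_le hD hf hb hfD (by linarith) (h.mean_le hD hroot2)
    · simp only [hG, if_neg h, le_refl]
  have hΔ0 : ∀ I, 0 ≤ Δ I := by
    intro I
    by_cases h : B I
    · simp only [hΔ, if_pos h]
      have h1 := sq_integral_mul_haar hi1 I
      have h2 : 0 ≤ I.len * ((mean f I.lo ^ 2 + mean f I.hi ^ 2) / 2 - mean f I ^ 2) :=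
        h1 ▸ sq_nonneg _
      exact nonneg_of_mul_nonneg_right h2 I.len_pos
    · simp only [hΔ, if_neg h, le_refl]
  have hchild : ∀ I L : DyadicInt, L.1 = I.1 + 1 → L.set ⊆ I.set → (Alive D δ L ↔ B I) := by
    intro I L hL hsub
    have h1 : ∀ k ≤ I.1, ix k L.pt = ix k I.pt := fun k hk =>
      ix_eq_of_mem hk (hsub L.pt_mem) I.pt_mem
    have h2 : ix I.1 I.pt = I := I.ix_pt
    constructor
    · intro h
      refine ⟨fun k hk => ?_, ?_⟩
      · rw [← h1 k hk.le]
        exact h k (by omega)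
      · have := h I.1 (by omega)
        rwa [h1 _ le_rfl, h2] at this
    · intro h k hk
      rw [h1 k (by omega)]
      rcases Nat.lt_or_ge k I.1 with h3 | h3
      · exact h.1 k h3
      · rw [show k = I.1 by omega, h2]
        exact h.2
  have hstep : ∀ I, Δ I ≤ G I - (G I.lo + G I.hi) / 2 := by
    intro I
    have hlo := hchild I I.lo rfl I.lo_subset
    have hhi := hchild I I.hi rfl I.hi_subset
    by_cases h : B I
    · simp only [hΔ, hG, if_pos h, if_pos h.1, if_pos (hlo.2 h), if_pos (hhi.2 h)]
      rw [mean_split hi2 I]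
      linarith
    · simp only [hΔ, if_neg h]
      have e1 : G I.lo = 0 := by simp only [hG, if_neg (mt hlo.1 h)]
      have e2 : G I.hi = 0 := by simp only [hG, if_neg (mt hhi.1 h)]
      rw [e1, e2]
      linarith [hG0 I]
  have hlen : root.len = 1 := by simp [root, DyadicInt.len]
  have hmr : ∀ g : T → ℝ, mean g root = ∫ x, g x := fun g => by
    rw [mean, hlen, set_root, setIntegral_univ, inv_one, one_mul]
  have hGroot : G root = 2 * δ * (∫ x, f x ^ 2) - (∫ x, f x) ^ 2 := by
    have : Alive D δ root := fun k hk => absurd hk (Nat.not_lt_zero k)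
    simp only [hG, if_pos this, hmr]
  have hmain : ∑ I ∈ s.eraseNone, (∫ x, f x * haar I x) ^ 2
      ≤ 2 * δ * (∫ x, f x ^ 2) - (∫ x, f x) ^ 2 := by
    rw [← hGroot]
    refine le_trans (Finset.sum_le_sum fun I hI => ?_)
      (sum_len_mul_le_root hG0 hΔ0 hstep s.eraseNone)
    have hBI : B I := by
      have h1 : ∀ k ≤ I.1, mean (D.indicator fun _ => 1) (ix k I.pt) ≤ δ := fun k hk =>
        mean_le_of_not_dense hD hδ (hs _ (Finset.mem_eraseNone.1 hI)) (set_subset_ix hk I.pt_mem)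
      refine ⟨fun k hk => h1 k hk.le, ?_⟩
      have := h1 I.1 le_rfl
      rwa [I.ix_pt] at this
    simp only [hΔ, if_pos hBI]
    exact (sq_integral_mul_haar hi1 I).le
  -- The term -(∫ f)² in the potential of the root pays exactly for the constant Haar function, so
  -- its index may be added freely.
  calc ∑ a ∈ s, (∫ x, f x * haarC a x) ^ 2
      ≤ ∑ a ∈ Finset.insertNone s.eraseNone, (∫ x, f x * haarC a x) ^ 2 := by
        refine Finset.sum_le_sum_of_subset_of_nonneg (fun a ha => ?_) fun _ _ _ => sq_nonneg _
        cases a with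
        | none => exact Finset.none_mem_insertNone
        | some I => exact Finset.some_mem_insertNone.2 (Finset.mem_eraseNone.2 ha)
    _ = (∫ x, f x) ^ 2 + ∑ I ∈ s.eraseNone, (∫ x, f x * haar I x) ^ 2 := by
        rw [Finset.sum_insertNone]
        simp [haarC]
    _ ≤ _ := by linarith

/-- Bessel's inequality, up to a constant. -/
lemma sum_sq_integral_haarC_le {f : T → ℝ} (hf : Measurable f) (hb : ∃ K : ℝ, ∀ x, |f x| ≤ K)
    (s : Finset (Option DyadicInt)) :
    ∑ a ∈ s, (∫ x, f x * haarC a x) ^ 2 ≤ 2 * ∫ x, f x ^ 2 := by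
  -- With D everything and δ = 1 the density condition is never violated, because all densities
  -- equal 1 and do not exceed it.
  have h := sum_sq_integral_le MeasurableSet.univ hf hb (fun x hx => absurd (Set.mem_univ x) hx)
    one_pos s fun a _ ⟨K, _, hK⟩ => by
      rw [Set.indicator_univ, av_const K.volume_set_ne_zero K.volume_set_ne_top, ENNReal.ofReal_one]
        at hK
      exact lt_irrefl _ hK
  simpa using h

end

/-! ### Enlargements of a planar set and the Haar coefficients of its indicator -/

section

/-- The set where the maximal function of `χ_D` exceeds `δ`. -/
def bigSet {ι X : Type*} [MeasureSpace X] (E : ι → Set X) (D : Set X) (δ : ℝ) : Set X :=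
  {x | ENNReal.ofReal δ < maxFn E (D.indicator fun _ => 1) x}

/-- The set where the maximal function of `χ_E` in the first variable exceeds `δ`. -/
def sliceSet (E : Set T2) (δ : ℝ) : Set T2 :=
  {p | p.1 ∈ bigSet DyadicInt.set {s | (s, p.2) ∈ E} δ}

section slices

variable {E : Set T2}

lemma measurable_av_slice (hE : MeasurableSet E) (K : DyadicInt) :
    Measurable fun t : T => av K.set ({s | (s, t) ∈ E}.indicator fun _ => 1) := by
  have h : Measurable fun p : T2 => E.indicator (fun _ => (1 : ℝ≥0∞)) p :=
    measurable_const.indicator hE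
  exact (h.lintegral_prod_left' (μ := volume.restrict K.set)).const_mul _

lemma measurable_slice_maxFn (hE : MeasurableSet E) : Measurable fun p : T2 =>
    maxFn DyadicInt.set ({s | (s, p.2) ∈ E}.indicator fun _ => 1) p.1 := by
  have : (fun p : T2 => maxFn DyadicInt.set ({s | (s, p.2) ∈ E}.indicator fun _ => 1) p.1)
      = fun p => ⨆ J : DyadicInt, (Prod.fst ⁻¹' J.set : Set T2).indicator
      (fun p => av J.set ({s | (s, p.2) ∈ E}.indicator fun _ => 1)) p := by
    ext p
    rfl
  rw [this]
  exact Measurable.iSup fun J => Measurable.indicator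
    ((measurable_av_slice hE J).comp measurable_snd) (measurable_fst J.measurableSet_set)

lemma measurableSet_sliceSet (hE : MeasurableSet E) (δ : ℝ) : MeasurableSet (sliceSet E δ) :=
  measurableSet_lt measurable_const (measurable_slice_maxFn hE)

/-- Chebyshev's inequality for the squares, with the one-variable maximal theorem on every
horizontal slice. -/
lemma volume_sliceSet_le (hE : MeasurableSet E) (δ : ℝ) :
    ENNReal.ofReal δ ^ 2 * volume (sliceSet E δ) ≤ 4 * volume E := by
  have hm := (measurable_slice_maxFn hE).pow_const 2
  have hind : Measurable fun p : T2 => E.indicator (fun _ => (1 : ℝ≥0∞)) p :=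
    measurable_const.indicator hE
  calc _ ≤ ENNReal.ofReal δ ^ 2 * volume {p : T2 | ENNReal.ofReal δ ^ 2
        ≤ maxFn DyadicInt.set ({s | (s, p.2) ∈ E}.indicator fun _ => 1) p.1 ^ 2} := by
        gcongr
        intro p hp
        have hp' : ENNReal.ofReal δ < _ := hp
        exact pow_le_pow_left' hp'.le 2
    _ ≤ ∫⁻ p : T2, maxFn DyadicInt.set ({s | (s, p.2) ∈ E}.indicator fun _ => 1) p.1 ^ 2 :=
        mul_meas_ge_le_lintegral hm _
    _ = ∫⁻ t, ∫⁻ s, maxFn DyadicInt.set ({s | (s, t) ∈ E}.indicator fun _ => 1) s ^ 2 := by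
        rw [Measure.volume_eq_prod, lintegral_prod_symm' _ hm]
    _ ≤ ∫⁻ t, 4 * ∫⁻ s, E.indicator (fun _ => 1) (s, t) := by
        gcongr with t
        have hs : MeasurableSet {s | (s, t) ∈ E} := measurable_prodMk_right hE
        refine (lintegral_maxFn_sq_le (measurable_const.indicator hs)).trans (le_of_eq ?_)
        congr 2
        ext s
        by_cases h : (s, t) ∈ E <;> simp [h]
    _ = 4 * volume E := by
        rw [lintegral_const_mul _ hind.lintegral_prod_left', ← lintegral_prod_symm' _ hind,
          ← Measure.volume_eq_prod, lintegral_indicator hE]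
        simp

lemma volume_bigSet_le (hE : MeasurableSet E) (δ : ℝ) :
    ENNReal.ofReal δ ^ 2 * volume (bigSet Rect.set E δ) ≤ 16 * volume E := by
  have hm := (measurable_maxFn (fun R : Rect => R.measurableSet_set)
    (E.indicator fun _ => (1 : ℝ≥0∞))).pow_const 2
  calc _ ≤ ENNReal.ofReal δ ^ 2 * volume {p : T2 | ENNReal.ofReal δ ^ 2
        ≤ maxFn Rect.set (E.indicator fun _ => 1) p ^ 2} := by
        gcongr
        intro p hp
        have hp' : ENNReal.ofReal δ < _ := hp
        exact pow_le_pow_left' hp'.le 2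
    _ ≤ ∫⁻ p : T2, maxFn Rect.set (E.indicator fun _ => 1) p ^ 2 := mul_meas_ge_le_lintegral hm _
    _ ≤ 16 * ∫⁻ p, E.indicator (fun _ => 1) p ^ 2 :=
        lintegral_strong_maxFn_sq_le (measurable_const.indicator hE)
    _ = 16 * volume E := by
        have : ∀ p, E.indicator (fun _ => (1 : ℝ≥0∞)) p ^ 2 = E.indicator (fun _ => 1) p := fun p => by
          by_cases hp : p ∈ E <;> simp [hp]
        simp_rw [this]
        rw [lintegral_indicator hE]
        simp

/-- The Haar coefficients in the first variable of `χ_E`. -/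
def sliceCoef (E : Set T2) (a : Option DyadicInt) (t : T) : ℝ :=
  ∫ s, E.indicator (fun _ => (1 : ℝ)) (s, t) * haarC a s

lemma measurable_sliceCoef (hE : MeasurableSet E) (a : Option DyadicInt) : Measurable (sliceCoef E a) := by
  have h : Measurable fun p : T × T => E.indicator (fun _ => (1 : ℝ)) p * haarC a p.1 :=
    (measurable_const.indicator hE).mul ((measurable_haarC a).comp measurable_fst)
  exact (h.stronglyMeasurable.integral_prod_left' (μ := (volume : Measure T))).measurable

lemma exists_sliceCoef_le (E : Set T2) (a : Option DyadicInt) : ∃ K : ℝ, ∀ t, |sliceCoef E a t| ≤ K := by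
  obtain ⟨K, hK⟩ := exists_haarC_le a
  refine ⟨K, fun t => ?_⟩
  have h1 := norm_integral_le_of_norm_le_const (μ := (volume : Measure T)) (C := K)
    (f := fun s => E.indicator (fun _ => (1 : ℝ)) (s, t) * haarC a s)
    (Filter.Eventually.of_forall fun s => ?_)
  · simpa [sliceCoef] using h1
  rw [Real.norm_eq_abs, abs_mul]
  have h0 : 0 ≤ K := (abs_nonneg _).trans (hK s)
  by_cases h : (s, t) ∈ E <;> simp [h, hK, h0]

lemma measurableSet_dense (hE : MeasurableSet E) (δ : ℝ) (a : Option DyadicInt) :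
    MeasurableSet {t | Dense {s | (s, t) ∈ E} δ a} := by
  have : {t | Dense {s | (s, t) ∈ E} δ a} = ⋃ K : {K : DyadicInt // suppC a ⊆ K.set},
      {t | ENNReal.ofReal δ < av K.1.set ({s | (s, t) ∈ E}.indicator fun _ => 1)} := by
    ext t
    simp [Dense]
  rw [this]
  exact MeasurableSet.iUnion fun K => measurableSet_lt measurable_const (measurable_av_slice hE K.1)

lemma mem_sliceSet_of_dense {δ : ℝ} {a : Option DyadicInt} {s t : T} (hs : s ∈ suppC a)
    (h : Dense {s | (s, t) ∈ E} δ a) : (s, t) ∈ sliceSet E δ := by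
  obtain ⟨K, hK, h⟩ := h
  exact h.trans_le (av_le_maxFn _ (hK hs))

/-- Above every t where the slice is dense around `a`, the whole of `suppC a` lies in `sliceSet E
δ`. If such t have density above δ in K, so has `sliceSet E δ` in the rectangle `suppC a` × K. -/
lemma dense_imp_subset (hE : MeasurableSet E) {δ : ℝ} {a b : Option DyadicInt}
    (h : Dense {t | Dense {s | (s, t) ∈ E} δ a} δ b) :
    suppRect (a, b) ⊆ bigSet Rect.set (sliceSet E δ) δ := by
  obtain ⟨K, hK, h⟩ := h
  obtain ⟨I, hI⟩ := exists_set_eq_suppC a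
  rintro ⟨s, t⟩ ⟨hs, ht⟩
  have hst : (s, t) ∈ Rect.set (I, K) := ⟨hI ▸ hs, hK ht⟩
  refine h.trans_le (le_trans ?_ (av_le_maxFn _ hst))
  rw [av_rect (measurable_const.indicator (measurableSet_sliceSet hE δ))]
  rw [← av_const I.volume_set_ne_zero I.volume_set_ne_top (av K.set _)]
  refine av_mono I.measurableSet_set fun x hx => av_mono K.measurableSet_set fun y _ => ?_
  by_cases hy : Dense {s | (s, y) ∈ E} δ a
  · have h1 : (x, y) ∈ sliceSet E δ := mem_sliceSet_of_dense (hI ▸ hx) hy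
    rw [Set.indicator_of_mem h1]
    exact Set.indicator_le_self' (fun _ _ => bot_le) _
  · rw [Set.indicator_of_notMem (show y ∉ {t | Dense {s | (s, t) ∈ E} δ a} from hy)]
    exact bot_le

/-- The Haar coefficients of `χ_E` on the rectangles that are not contained in an enlargement of
`E` carry little of the mass of `χ_E`. -/
theorem sum_sq_sliceCoef_le (hE : MeasurableSet E) {δ : ℝ} (hδ : 0 < δ) (s : Finset (Option DyadicInt × Option DyadicInt))
    (hs : ∀ a ∈ s, ¬ suppRect a ⊆ bigSet Rect.set (sliceSet E δ) δ) :
    ∑ a ∈ s, (∫ t, sliceCoef E a.1 t * haarC a.2 t) ^ 2 ≤ 16 * δ * volume.real E := by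
  classical
  set 𝓘 := s.image Prod.fst with h𝓘
  set D : Option DyadicInt → Set T := fun a => {t | Dense {s | (s, t) ∈ E} δ a} with hD
  have hDm : ∀ a, MeasurableSet (D a) := measurableSet_dense hE δ
  -- The slice coefficients are split according to whether the slice is dense around `a`. For `v`
  -- the small factor δ comes from the first variable and Bessel handles the second. For `u` the
  -- roles are reversed: by `dense_imp_subset`, the set `D a` carrying `u a` is not dense around the
  -- second index.
  set u : Option DyadicInt → T → ℝ := fun a => (D a).indicator (sliceCoef E a) with hu
  set v : Option DyadicInt → T → ℝ := fun a => (D a)ᶜ.indicator (sliceCoef E a) with hv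
  have hum : ∀ a, Measurable (u a) := fun a => (measurable_sliceCoef hE a).indicator (hDm a)
  have hvm : ∀ a, Measurable (v a) := fun a => (measurable_sliceCoef hE a).indicator (hDm a).compl
  have hbd : ∀ (S : Set T) a, ∃ K : ℝ, ∀ t, |S.indicator (sliceCoef E a) t| ≤ K := by
    intro S a
    obtain ⟨K, hK⟩ := exists_sliceCoef_le E a
    refine ⟨K, fun t => ?_⟩
    have h0 : 0 ≤ K := (abs_nonneg _).trans (hK t)
    by_cases h : t ∈ S <;> simp [h, hK, h0]
  have hub : ∀ a, ∃ K : ℝ, ∀ t, |u a t| ≤ K := fun a => hbd _ a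
  have hvb : ∀ a, ∃ K : ℝ, ∀ t, |v a t| ≤ K := fun a => hbd _ a
  have hslice : ∀ t, MeasurableSet {s | (s, t) ∈ E} := fun t => measurable_prodMk_right hE
  have hfm : ∀ t, Measurable fun s => E.indicator (fun _ => (1 : ℝ)) (s, t) := fun t =>
    (measurable_const.indicator hE).comp measurable_prodMk_right
  have hfb : ∀ t, ∃ K : ℝ, ∀ s, |E.indicator (fun _ => (1 : ℝ)) (s, t)| ≤ K := fun t =>
    ⟨1, fun s => by by_cases h : (s, t) ∈ E <;> simp [h]⟩
  have hind : Measurable fun p : T × T => E.indicator (fun _ => (1 : ℝ)) p ^ 2 :=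
    (measurable_const.indicator hE).pow_const 2
  have hindi : Integrable (fun p : T × T => E.indicator (fun _ => (1 : ℝ)) p ^ 2)
      (volume.prod volume) :=
    integrable_sq_of_bdd (measurable_const.indicator hE)
      ⟨1, fun p => by by_cases h : p ∈ E <;> simp [h]⟩
  have hvol : ∫ t, ∫ s, E.indicator (fun _ => (1 : ℝ)) (s, t) ^ 2 = volume.real E := by
    have h1 : ∀ p : T × T, E.indicator (fun _ => (1 : ℝ)) p ^ 2 = E.indicator (fun _ => 1) p :=
      fun p => by by_cases hp : p ∈ E <;> simp [hp]
    rw [← integral_prod_symm _ hindi]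
    simp_rw [h1]
    rw [integral_indicator hE]
    simp [Measure.volume_eq_prod]
  have hU : ∑ a ∈ 𝓘, ∫ t, u a t ^ 2 ≤ 2 * volume.real E := by
    rw [← integral_finsetSum _ fun a _ => integrable_sq_of_bdd (hum a) (hub a), ← hvol,
      ← integral_const_mul]
    refine integral_mono (integrable_finsetSum _ fun a _ => integrable_sq_of_bdd (hum a) (hub a))
      (hindi.integral_prod_right.const_mul 2) fun t => ?_
    refine le_trans (Finset.sum_le_sum fun a _ => ?_) (sum_sq_integral_haarC_le (hfm t) (hfb t) 𝓘)
    by_cases h : t ∈ D a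
    · simp only [hu, Set.indicator_of_mem h]; exact le_rfl
    · simp only [hu, Set.indicator_of_notMem h]; rw [sq, zero_mul]; exact sq_nonneg _
  have hV : ∑ a ∈ 𝓘, ∫ t, v a t ^ 2 ≤ 2 * δ * volume.real E := by
    rw [← integral_finsetSum _ fun a _ => integrable_sq_of_bdd (hvm a) (hvb a), ← hvol,
      ← integral_const_mul]
    refine integral_mono (integrable_finsetSum _ fun a _ => integrable_sq_of_bdd (hvm a) (hvb a))
      (hindi.integral_prod_right.const_mul (2 * δ)) fun t => ?_
    have h1 := sum_sq_integral_le (hslice t) (hfm t) (hfb t)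
      (fun x hx => Set.indicator_of_notMem (show (x, t) ∉ E from hx) _) hδ
      (𝓘.filter fun a => ¬ Dense {s | (s, t) ∈ E} δ a) fun a ha => (Finset.mem_filter.1 ha).2
    refine le_trans (le_of_eq ?_) h1
    rw [Finset.sum_filter]
    refine Finset.sum_congr rfl fun a _ => ?_
    by_cases h : t ∈ D a
    · have h2 : t ∉ (D a)ᶜ := fun h3 => h3 h
      rw [if_neg (not_not.2 (show Dense {s | (s, t) ∈ E} δ a from h))]
      simp only [hv, Set.indicator_of_notMem h2]
      norm_num
    · have h2 : t ∈ (D a)ᶜ := h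
      rw [if_pos (show ¬ Dense {s | (s, t) ∈ E} δ a from h)]
      simp only [hv, Set.indicator_of_mem h2]
      rfl
  have hsplit : ∀ a ∈ s, (∫ t, sliceCoef E a.1 t * haarC a.2 t) ^ 2
      ≤ 2 * (∫ t, u a.1 t * haarC a.2 t) ^ 2 + 2 * (∫ t, v a.1 t * haarC a.2 t) ^ 2 := by
    intro a _
    have hint : ∀ w : T → ℝ, Measurable w → (∃ K : ℝ, ∀ t, |w t| ≤ K) →
        Integrable fun t => w t * haarC a.2 t := by
      rintro w hw ⟨K, hK⟩
      obtain ⟨L, hL⟩ := exists_haarC_le a.2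
      refine integrable_of_bdd (hw.mul (measurable_haarC _)) ⟨K * L, fun t => ?_⟩
      rw [abs_mul]
      exact mul_le_mul (hK t) (hL t) (abs_nonneg _) ((abs_nonneg _).trans (hK t))
    have h1 : ∫ t, sliceCoef E a.1 t * haarC a.2 t
        = (∫ t, u a.1 t * haarC a.2 t) + ∫ t, v a.1 t * haarC a.2 t := by
      rw [← integral_add (hint _ (hum _) (hub _)) (hint _ (hvm _) (hvb _))]
      refine integral_congr_ae (Filter.Eventually.of_forall fun t => ?_)
      simp only [← add_mul, hu, hv]
      rw [Set.indicator_self_add_compl_apply]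
    rw [h1]
    nlinarith [sq_nonneg ((∫ t, u a.1 t * haarC a.2 t) - ∫ t, v a.1 t * haarC a.2 t)]
  have hfib : ∀ F : Option DyadicInt × Option DyadicInt → ℝ, ∑ a ∈ s, F a
      = ∑ i ∈ 𝓘, ∑ j ∈ (s.filter fun a => a.1 = i).image Prod.snd, F (i, j) := by
    intro F
    rw [← Finset.sum_fiberwise_of_maps_to (g := Prod.fst) (t := 𝓘)
      fun R hR => Finset.mem_image_of_mem _ hR]
    refine Finset.sum_congr rfl fun i _ => ?_
    rw [Finset.sum_image]
    · refine Finset.sum_congr rfl fun a ha => ?_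
      rw [← (Finset.mem_filter.1 ha).2]
    · intro a ha b hb h
      exact Prod.ext ((Finset.mem_filter.1 ha).2.trans (Finset.mem_filter.1 hb).2.symm) h
  have hu2 : ∑ a ∈ s, (∫ t, u a.1 t * haarC a.2 t) ^ 2 ≤ 4 * δ * volume.real E := by
    rw [hfib]
    calc _ ≤ ∑ i ∈ 𝓘, 2 * δ * ∫ t, u i t ^ 2 := by
          refine Finset.sum_le_sum fun i _ => ?_
          refine sum_sq_integral_le (hDm i) (hum i) (hub i)
            (fun t ht => Set.indicator_of_notMem ht _) hδ _ fun j hj => ?_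
          obtain ⟨a, ha, rfl⟩ := Finset.mem_image.1 hj
          obtain ⟨ha1, rfl⟩ := Finset.mem_filter.1 ha
          exact fun h => hs a ha1 (dense_imp_subset hE h)
      _ = 2 * δ * ∑ i ∈ 𝓘, ∫ t, u i t ^ 2 := by rw [Finset.mul_sum]
      _ ≤ 2 * δ * (2 * volume.real E) := by gcongr
      _ = _ := by ring
  have hv2 : ∑ a ∈ s, (∫ t, v a.1 t * haarC a.2 t) ^ 2 ≤ 4 * δ * volume.real E := by
    rw [hfib]
    calc _ ≤ ∑ i ∈ 𝓘, 2 * ∫ t, v i t ^ 2 :=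
          Finset.sum_le_sum fun i _ => sum_sq_integral_haarC_le (hvm i) (hvb i) _
      _ = 2 * ∑ i ∈ 𝓘, ∫ t, v i t ^ 2 := by rw [Finset.mul_sum]
      _ ≤ 2 * (2 * δ * volume.real E) := by gcongr
      _ = _ := by ring
  refine (Finset.sum_le_sum hsplit).trans ?_
  rw [Finset.sum_add_distrib, ← Finset.mul_sum, ← Finset.mul_sum]
  linarith

end slices

end

section

variable {𝕜 : Type*} [RCLike 𝕜]

/-! ### Necessity for the paraproduct `Δ_φ` -/

lemma isL20_sum (c : Rect → 𝕜) (s : Finset Rect) :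
    IsL20 (∑ R ∈ s, c R • haarRect 𝕜 (0, 0) R) := by
  have h : ∀ᵐ p ∂((volume : Measure T).prod (volume : Measure T)),
      (∑ R ∈ s, c R • haarRect 𝕜 (0, 0) R : L2 𝕜) p
      = ∑ R ∈ s, c R * ((haar R.1 p.1 * haar R.2 p.2 : ℝ) : 𝕜) := by
    have h1 := coeFn_sum_haarRect (0, 0) c s
    simp only [haarE_zero, tensor] at h1
    exact h1
  constructor
  · filter_upwards [Measure.ae_ae_of_ae_prod h] with x hx
    rw [integral_congr_ae hx, integral_finsetSum _ fun R _ =>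
      (((integrable_haar R.2).const_mul (haar R.1 x)).ofReal).const_mul (c R)]
    refine Finset.sum_eq_zero fun R _ => ?_
    rw [integral_const_mul, integral_ofReal, integral_const_mul, integral_haar]
    simp
  · have h2 := (Measure.measurePreserving_swap (μ := (volume : Measure T))
      (ν := volume)).quasiMeasurePreserving.ae h
    filter_upwards [Measure.ae_ae_of_ae_prod h2] with y hy
    simp only [Prod.swap_prod_mk] at hy
    rw [integral_congr_ae hy, integral_finsetSum _ fun R _ =>
      (((integrable_haar R.1).mul_const (haar R.2 y)).ofReal).const_mul (c R)]
    refine Finset.sum_eq_zero fun R _ => ?_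
    rw [integral_const_mul, integral_ofReal, integral_mul_const, integral_haar]
    simp

/-- A finite form of Parseval's identity. Since the element lies in a finite span, completeness of
the Haar system is never needed. -/
lemma enorm_inner_le_sum {ι E : Type*} [NormedAddCommGroup E] [InnerProductSpace 𝕜 E] {v : ι → E}
    (hv : Orthonormal 𝕜 v) (s : Finset ι) {x : E} (hx : x ∈ Submodule.span 𝕜 (v '' s)) (y : E) :
    ‖(inner 𝕜 x y : 𝕜)‖ₑ ≤ ∑ i ∈ s, ‖(inner 𝕜 (v i) x : 𝕜)‖ₑ * ‖(inner 𝕜 (v i) y : 𝕜)‖ₑ := by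
  classical
  have h1 : x = ∑ i ∈ s, (inner 𝕜 (v i) x : 𝕜) • v i := by
    induction hx using Submodule.span_induction with
    | mem z hz =>
      obtain ⟨j, hj, rfl⟩ := hz
      simp only [orthonormal_iff_ite.1 hv, ite_smul, one_smul, zero_smul, Finset.sum_ite_eq',
        Finset.mem_coe.1 hj, if_true]
    | zero => simp
    | add a b _ _ ha hb =>
      simp only [inner_add_right, add_smul, Finset.sum_add_distrib]
      rw [← ha, ← hb]
    | smul c a _ ha =>
      simp only [inner_smul_right, mul_smul, ← Finset.smul_sum]
      rw [← ha]
  nth_rw 1 [h1]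
  rw [sum_inner]
  refine (enorm_sum_le _ _).trans (Finset.sum_le_sum fun i _ => ?_)
  rw [inner_smul_left, enorm_mul, ← ofReal_norm, RCLike.norm_conj, ofReal_norm]

lemma integral_haarE_one (I : DyadicInt) : ∫ x, haarE 1 I x = 1 := by
  simp_rw [haarE_one]
  rw [integral_indicator I.measurableSet_set, setIntegral_const, volume_real_set, smul_eq_mul,
    mul_inv_cancel₀ I.len_pos.ne']

/-- The characteristic function of a set as an element of `L²(𝕋²)`. -/
def chi (𝕜 : Type*) [RCLike 𝕜] {E : Set T2} (hE : MeasurableSet E) : L2 𝕜 :=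
  indicatorConstLp 2 hE (measure_ne_top _ _) 1

lemma inner_chi {u v : T → ℝ} {g : L2 𝕜} (hg : g =ᵐ[volume] tensor 𝕜 u v) {E : Set T2}
    (hE : MeasurableSet E) : (inner 𝕜 g (chi 𝕜 hE) : 𝕜)
      = ((∫ p : T2, u p.1 * v p.2 * E.indicator (fun _ => 1) p : ℝ) : 𝕜) := by
  rw [inner_eq_integral hg, ← integral_ofReal]
  refine integral_congr_ae ?_
  filter_upwards [indicatorConstLp_coeFn (p := 2) (hs := hE)
    (hμs := measure_ne_top (volume : Measure T2) E) (c := (1 : 𝕜))] with p hp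
  rw [chi, hp]
  by_cases h : p ∈ E <;> simp [h]

lemma inner_haarRectC_chi (a : Option DyadicInt × Option DyadicInt) {E : Set T2}
    (hE : MeasurableSet E) : (inner 𝕜 (haarRectC 𝕜 a) (chi 𝕜 hE) : 𝕜)
      = ((∫ t, sliceCoef E a.1 t * haarC a.2 t : ℝ) : 𝕜) := by
  rw [inner_chi (coeFn_haarRectC a) hE]
  congr 1
  have hint : Integrable (fun p : T × T => haarC a.1 p.1 * haarC a.2 p.2 *
      E.indicator (fun _ => (1 : ℝ)) p) (volume.prod volume) := by
    obtain ⟨K, hK⟩ := exists_haarC_le a.1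
    obtain ⟨L, hL⟩ := exists_haarC_le a.2
    refine integrable_of_bdd ((((measurable_haarC a.1).comp measurable_fst).mul
      ((measurable_haarC a.2).comp measurable_snd)).mul (measurable_const.indicator hE))
      ⟨K * L * 1, fun p => ?_⟩
    rw [abs_mul, abs_mul]
    have hK0 : 0 ≤ K := (abs_nonneg _).trans (hK p.1)
    have hL0 : 0 ≤ L := (abs_nonneg _).trans (hL p.2)
    gcongr
    · exact hK _
    · exact hL _
    · by_cases h : p ∈ E <;> simp [h]
  refine (integral_prod_symm _ hint).trans ?_
  refine integral_congr_ae (Filter.Eventually.of_forall fun t => ?_)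
  simp only [sliceCoef]
  rw [← integral_mul_const]
  refine integral_congr_ae (Filter.Eventually.of_forall fun s => ?_)
  simp only
  ring

lemma inner_haarRect_chi {R : Rect} {E : Set T2} (hE : MeasurableSet E) (hR : R.set ⊆ E) :
    (inner 𝕜 (haarRect 𝕜 (1, 1) R) (chi 𝕜 hE) : 𝕜) = 1 := by
  rw [inner_chi (coeFn_haarRect _ R) hE]
  have h : ∀ p : T2, haarE 1 R.1 p.1 * haarE 1 R.2 p.2 * E.indicator (fun _ => (1 : ℝ)) p
      = haarE 1 R.1 p.1 * haarE 1 R.2 p.2 := by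
    intro p
    by_cases hp : p ∈ E
    · simp [hp]
    · have hp2 : ¬ (p.1 ∈ R.1.set ∧ p.2 ∈ R.2.set) := fun h => hp (hR h)
      rw [haarE_one, haarE_one]
      by_cases h1 : p.1 ∈ R.1.set
      · have h2 : p.2 ∉ R.2.set := fun h2 => hp2 ⟨h1, h2⟩
        simp [h2]
      · simp [h1]
  simp_rw [h]
  rw [Measure.volume_eq_prod, integral_prod_mul (fun s => haarE 1 R.1 s) fun t => haarE 1 R.2 t,
    integral_haarE_one, integral_haarE_one]
  simp

lemma enorm_chi_sq {E : Set T2} (hE : MeasurableSet E) : ‖chi 𝕜 hE‖ₑ ^ 2 = volume E := by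
  rw [enorm_L2_sq]
  have h : ∀ᵐ p : T2, ‖chi 𝕜 hE p‖ₑ ^ 2 = E.indicator (fun _ => 1) p := by
    filter_upwards [indicatorConstLp_coeFn (p := 2) (hs := hE)
      (hμs := measure_ne_top (volume : Measure T2) E) (c := (1 : 𝕜))] with p hp
    rw [chi, hp]
    by_cases h : p ∈ E <;> simp [h]
  rw [lintegral_congr_ae h, lintegral_indicator hE]
  simp

lemma haarRect_mem_span (ε : Fin 2 × Fin 2) (R : Rect)
    (s : Finset (Option DyadicInt × Option DyadicInt)) (h : haarIdx ε.1 R.1 ×ˢ haarIdx ε.2 R.2 ⊆ s) :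
    haarRect 𝕜 ε R ∈ Submodule.span 𝕜 (haarRectC 𝕜 '' s) := by
  rw [haarRect_eq_sum]
  exact Submodule.sum_mem _ fun a ha => Submodule.smul_mem _ _
    (Submodule.subset_span ⟨a, h ha, rfl⟩)

/-- Each enlargement at threshold 2^(-14) costs 2^28, apart from the constants 4 and 16 of the two
maximal theorems. -/
lemma volume_bigSet_sliceSet_le {E : Set T2} (hE : MeasurableSet E) :
    volume (bigSet Rect.set (sliceSet E (2 ^ 14)⁻¹) (2 ^ 14)⁻¹) ≤ 2 ^ 62 * volume E := by
  have h1 := volume_sliceSet_le hE (2 ^ 14)⁻¹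
  have h2 := volume_bigSet_le (measurableSet_sliceSet hE (2 ^ 14)⁻¹) (2 ^ 14)⁻¹
  have hδ : ENNReal.ofReal (2 ^ 14)⁻¹ = (2 ^ 14)⁻¹ := by
    rw [ENNReal.ofReal_inv_of_pos (by positivity), ENNReal.ofReal_pow (by norm_num)]
    simp
  rw [hδ] at h1 h2
  have key : ∀ x y : ℝ≥0∞, ((2 ^ 14)⁻¹ : ℝ≥0∞) ^ 2 * x ≤ y → x ≤ 2 ^ 28 * y := by
    intro x y h
    have e : (2 ^ 28 : ℝ≥0∞) * ((2 ^ 14)⁻¹ : ℝ≥0∞) ^ 2 = 1 := by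
      rw [← ENNReal.inv_pow, ← pow_mul]
      exact ENNReal.mul_inv_cancel (by simp) (by simp)
    calc x = (2 ^ 28 : ℝ≥0∞) * ((2 ^ 14)⁻¹ : ℝ≥0∞) ^ 2 * x := by rw [e, one_mul]
      _ = 2 ^ 28 * (((2 ^ 14)⁻¹ : ℝ≥0∞) ^ 2 * x) := mul_assoc _ _ _
      _ ≤ _ := by gcongr
  calc _ ≤ 2 ^ 28 * (16 * volume (sliceSet E (2 ^ 14)⁻¹)) := key _ _ h2
    _ ≤ 2 ^ 28 * (16 * (2 ^ 28 * (4 * volume E))) := by gcongr; exact key _ _ h1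
    _ = _ := by ring

/-- The main estimate: an `L²` function `F` in the span of the `χ_R`, `R ⊆ E`, that has a large
integral and not too large `L²` norm has a large part of its Haar expansion close to `E`. -/
lemma enorm_inner_chi_sq_le {E : Set T2} (hE : MeasurableSet E) {F : L2 𝕜}
    {s : Finset (Option DyadicInt × Option DyadicInt)}
    (hF : F ∈ Submodule.span 𝕜 (haarRectC 𝕜 '' s)) {A : ℝ≥0∞}
    (hA : Carleson suppRect (fun a => ‖(inner 𝕜 (haarRectC 𝕜 a) F : 𝕜)‖ₑ ^ 2) A) :
    ‖(inner 𝕜 F (chi 𝕜 hE) : 𝕜)‖ₑ ^ 2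
      ≤ 2 ^ 63 * A * volume E ^ 2 + 2 * (‖F‖ₑ ^ 2 * ((2 ^ 10)⁻¹ * volume E)) := by
  classical
  -- With δ = 2^(-14) the energy of χ_E away from Ω is at most 16δ|E| = 2^(-10)|E|, small enough to
  -- be absorbed in `BoundedBy.packing_le`.
  set Ω := bigSet Rect.set (sliceSet E (2 ^ 14)⁻¹) (2 ^ 14)⁻¹ with hΩ
  set y : Option DyadicInt × Option DyadicInt → ℝ≥0∞ := fun a =>
    ‖(inner 𝕜 (haarRectC 𝕜 a) F : 𝕜)‖ₑ with hy
  set z : Option DyadicInt × Option DyadicInt → ℝ≥0∞ := fun a =>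
    ‖(inner 𝕜 (haarRectC 𝕜 a) (chi 𝕜 hE) : 𝕜)‖ₑ with hz
  set s₁ := s.filter fun a => suppRect a ⊆ Ω with hs₁
  set s₂ := s.filter fun a => ¬ suppRect a ⊆ Ω with hs₂
  have h0 : ‖(inner 𝕜 F (chi 𝕜 hE) : 𝕜)‖ₑ ≤ ∑ a ∈ s₁, y a * z a + ∑ a ∈ s₂, y a * z a := by
    rw [Finset.sum_filter_add_sum_filter_not]
    exact enorm_inner_le_sum orthonormal_haarRectC s hF _
  have h1 : (∑ a ∈ s₁, y a * z a) ^ 2 ≤ 2 ^ 62 * A * volume E ^ 2 := by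
    calc _ ≤ (∑ a ∈ s₁, y a ^ 2) * ∑ a ∈ s₁, z a ^ 2 := sq_sum_mul_le _ _ _
      _ ≤ (A * (2 ^ 62 * volume E)) * volume E := by
          refine mul_le_mul' ((hA s₁).trans ?_) ?_
          · gcongr
            refine le_trans (measure_mono ?_) (volume_bigSet_sliceSet_le hE)
            exact Set.iUnion₂_subset fun a ha => (Finset.mem_filter.1 ha).2
          · exact (sum_enorm_inner_sq_le orthonormal_haarRectC _ s₁).trans (enorm_chi_sq hE).le
      _ = _ := by ring
  have h2 : (∑ a ∈ s₂, y a * z a) ^ 2 ≤ ‖F‖ₑ ^ 2 * ((2 ^ 10)⁻¹ * volume E) := by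
    refine (sq_sum_mul_le _ _ _).trans ?_
    refine mul_le_mul' (sum_enorm_inner_sq_le orthonormal_haarRectC _ s₂) ?_
    have h3 := sum_sq_sliceCoef_le hE (δ := (2 ^ 14)⁻¹) (by positivity) s₂
      fun a ha => (Finset.mem_filter.1 ha).2
    have h4 : ∀ a, z a ^ 2 = ENNReal.ofReal ((∫ t, sliceCoef E a.1 t * haarC a.2 t) ^ 2) := by
      intro a
      simp only [hz]
      rw [inner_haarRectC_chi, enorm_sq_eq, RCLike.norm_ofReal, sq_abs]
    simp_rw [h4]
    rw [← ENNReal.ofReal_sum_of_nonneg fun i _ => sq_nonneg _]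
    refine (ENNReal.ofReal_le_ofReal h3).trans (le_of_eq ?_)
    rw [show (16 : ℝ) * (2 ^ 14)⁻¹ = (2 ^ 10)⁻¹ by norm_num, ENNReal.ofReal_mul (by positivity),
      ofReal_measureReal, ENNReal.ofReal_inv_of_pos (by positivity), ENNReal.ofReal_pow (by norm_num)]
    simp
  calc _ ≤ (∑ a ∈ s₁, y a * z a + ∑ a ∈ s₂, y a * z a) ^ 2 := by gcongr
    _ ≤ 2 * (∑ a ∈ s₁, y a * z a) ^ 2 + 2 * (∑ a ∈ s₂, y a * z a) ^ 2 := sq_add_le _ _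
    _ ≤ 2 * (2 ^ 62 * A * volume E ^ 2) + 2 * (‖F‖ₑ ^ 2 * ((2 ^ 10)⁻¹ * volume E)) := by gcongr
    _ = _ := by ring

lemma volume_biUnion_ne_zero {s : Finset Rect} (hs : s.Nonempty) : volume (⋃ R ∈ s, R.set) ≠ 0 := by
  obtain ⟨R, hR⟩ := hs
  intro h
  exact R.volume_set_ne_zero (measure_mono_null
    (Set.subset_iUnion₂ (s := fun R (_ : R ∈ s) => R.set) R hR) h)

/-- The packing constant of a finite subfamily of largest packing ratio is controlled by the norm
of `Δ_φ`. -/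
lemma BoundedBy.packing_le {φ : L2 𝕜} {M : ℝ≥0} (h : BoundedBy (1, 1) φ M) {𝓖 : Finset Rect}
    (h𝓖 : 𝓖.Nonempty) {X : ℝ≥0∞} (hX0 : X ≠ 0) (hXt : X ≠ ⊤)
    (hX : ∑ R ∈ 𝓖, ‖coef (0, 0) φ R‖ₑ ^ 2 = X * volume (⋃ R ∈ 𝓖, R.set))
    (hmax : ∀ s ⊆ 𝓖, ∑ R ∈ s, ‖coef (0, 0) φ R‖ₑ ^ 2 ≤ X * volume (⋃ R ∈ s, R.set)) :
    X ≤ 2 ^ 64 * (M : ℝ≥0∞) ^ 2 := by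
  classical
  set E := ⋃ R ∈ 𝓖, R.set with hEdef
  have hE : MeasurableSet E := Finset.measurableSet_biUnion _ fun R _ => R.measurableSet_set
  have hE0 : volume E ≠ 0 := volume_biUnion_ne_zero h𝓖
  -- By extremality of 𝓖 the truncated coefficients pack with constant X. The test function with the
  -- conjugate coefficients therefore has norm at most √X, and `Δ_φ` turns it into a nonnegative
  -- combination of the χ_R / |R|.
  set a : Rect → 𝕜 := fun R => if R ∈ 𝓖 then coef (0, 0) φ R else 0 with ha
  have haC : Carleson Rect.set (fun R => ‖a R‖ₑ ^ 2) (rt X ^ 2) := by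
    rw [rt_sq]
    intro s
    have h1 : ∑ R ∈ s, ‖a R‖ₑ ^ 2 = ∑ R ∈ s with R ∈ 𝓖, ‖coef (0, 0) φ R‖ₑ ^ 2 := by
      rw [Finset.sum_filter]
      refine Finset.sum_congr rfl fun R _ => ?_
      simp only [ha]
      split_ifs <;> simp
    rw [h1]
    refine (hmax _ fun R hR => (Finset.mem_filter.1 hR).2).trans ?_
    refine mul_le_mul_right (measure_mono ?_) _
    exact Set.iUnion₂_subset fun R hR =>
      Set.subset_iUnion₂ (s := fun R (_ : R ∈ s) => R.set) R (Finset.mem_filter.1 hR).1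
  set f : L2 𝕜 := ∑ R ∈ 𝓖, starRingEnd 𝕜 (coef (0, 0) φ R) • haarRect 𝕜 (0, 0) R with hf
  have hcoef : ∀ R, coef (0, 0) f R = starRingEnd 𝕜 (a R) := by
    intro R
    rw [coef, hf]
    simp only [inner_sum, inner_smul_right,
      orthonormal_iff_ite.1 (orthonormal_haarRect (𝕜 := 𝕜)), mul_ite, mul_one, mul_zero,
      Finset.sum_ite_eq, ha]
    split_ifs <;> simp
  have hfn : bmoNorm f ≤ rt X := bmoNorm_le_of_carleson (haC.mono fun R => by
    rw [hcoef, ← ofReal_norm, RCLike.norm_conj, ofReal_norm])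
  obtain ⟨-, hF⟩ := h f (isL20_sum _ _) (hfn.trans_lt (rt_ne_top hXt).lt_top)
  set F : L2 𝕜 := ∑ R ∈ 𝓖, ((‖a R‖ ^ 2 : ℝ) : 𝕜) • haarRect 𝕜 (1, 1) R with hFdef
  have hFeq : paraproduct (1, 1) φ f = F := by
    have h1 : ∀ R, paraTerm (1, 1) φ f R = ((‖a R‖ ^ 2 : ℝ) : 𝕜) • haarRect 𝕜 (1, 1) R := by
      intro R
      have h2 : coef (0, 0) φ R * starRingEnd 𝕜 (a R) = ((‖a R‖ ^ 2 : ℝ) : 𝕜) := by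
        simp only [ha]
        split_ifs
        · rw [RCLike.mul_conj]
          push_cast
          rfl
        · simp
      rw [← h2, ← hcoef]
      rfl
    rw [paraproduct, tsum_congr h1, tsum_eq_sum (s := 𝓖)]
    intro R hR
    simp [ha, hR]
  have hC : Carleson suppRect (fun a => ‖(inner 𝕜 (haarRectC 𝕜 a) F : 𝕜)‖ₑ ^ 2)
      ((M * rt X) ^ 2) := by
    refine carleson_of_bmoNormExt_le (ENNReal.mul_ne_top ENNReal.coe_ne_top (rt_ne_top hXt)) ?_
    rw [← hFeq]
    refine hF.trans ?_
    gcongr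
  have ha2 : ∀ R, ‖((‖a R‖ ^ 2 : ℝ) : 𝕜)‖ₑ = ‖a R‖ₑ * ‖a R‖ₑ := fun R => by
    rw [← sq, enorm_sq_eq, ← ofReal_norm, RCLike.norm_ofReal, abs_of_nonneg (sq_nonneg _)]
  have hsum : ∑ R ∈ 𝓖, ‖a R‖ₑ ^ 2 = X * volume E := by
    rw [← hX]
    exact Finset.sum_congr rfl fun R hR => by simp only [ha, if_pos hR]
  have hFn : ‖F‖ₑ ^ 2 ≤ 256 * X * (X * volume E) := by
    refine (enorm_sum_haarRect_one_sq_le _ 𝓖).trans ?_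
    simp only [ha2]
    refine (lintegral_sq_sum_indicator_le haC 𝓖 _ (fun _ => enorm_ne_top)
      fun _ => enorm_ne_top).trans ?_
    rw [hsum, rt_sq]
  have hFchi : ‖(inner 𝕜 F (chi 𝕜 hE) : 𝕜)‖ₑ = X * volume E := by
    have h1 : (inner 𝕜 F (chi 𝕜 hE) : 𝕜) = ((∑ R ∈ 𝓖, ‖a R‖ ^ 2 : ℝ) : 𝕜) := by
      rw [hFdef, sum_inner]
      push_cast
      refine Finset.sum_congr rfl fun R hR => ?_
      rw [inner_smul_left, inner_haarRect_chi hE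
        (Set.subset_iUnion₂ (s := fun R (_ : R ∈ 𝓖) => R.set) R hR), mul_one]
      simp
    rw [h1, ← hsum, ← ofReal_norm, RCLike.norm_ofReal,
      abs_of_nonneg (Finset.sum_nonneg fun R _ => sq_nonneg _),
      ENNReal.ofReal_sum_of_nonneg fun R _ => sq_nonneg _]
    exact Finset.sum_congr rfl fun R _ => (enorm_sq_eq _).symm
  have hspan : F ∈ Submodule.span 𝕜 (haarRectC 𝕜 ''
      (𝓖.biUnion fun R => haarIdx 1 R.1 ×ˢ haarIdx 1 R.2 : Finset _)) :=
    Submodule.sum_mem _ fun R hR => Submodule.smul_mem _ _ (haarRect_mem_span _ R _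
      (Finset.subset_biUnion_of_mem (fun R : Rect => haarIdx 1 R.1 ×ˢ haarIdx 1 R.2) hR))
  have hmain := enorm_inner_chi_sq_le hE hspan hC
  rw [hFchi] at hmain
  set Y := X * volume E ^ 2 with hY
  have hY0 : Y ≠ 0 := mul_ne_zero hX0 (pow_ne_zero _ hE0)
  have hYt : Y ≠ ⊤ := ENNReal.mul_ne_top hXt (ENNReal.pow_ne_top (measure_ne_top _ _))
  -- The contribution away from E is 2 · 256 · 2^(-10) = 1/2 of the left-hand side and is absorbed,
  -- because X and |E| are finite.
  have h1 : X * Y ≤ (2 ^ 63 * (M : ℝ≥0∞) ^ 2 + X / 2) * Y := by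
    calc X * Y = (X * volume E) ^ 2 := by rw [hY]; ring
      _ ≤ _ := hmain
      _ ≤ 2 ^ 63 * (M * rt X) ^ 2 * volume E ^ 2
          + 2 * (256 * X * (X * volume E) * ((2 ^ 10)⁻¹ * volume E)) := by gcongr
      _ = 2 ^ 63 * (M : ℝ≥0∞) ^ 2 * Y + (512 * (2 ^ 10)⁻¹) * X * Y := by
          rw [mul_pow, rt_sq, hY]; ring
      _ = _ := by
          have : (512 : ℝ≥0∞) * (2 ^ 10)⁻¹ = 2⁻¹ := by
            rw [show (2 : ℝ≥0∞) ^ 10 = 512 * 2 by norm_num,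
              ENNReal.mul_inv (by simp) (by simp), ← mul_assoc,
              ENNReal.mul_inv_cancel (by simp) (by simp), one_mul]
          rw [this, ENNReal.div_eq_inv_mul, add_mul]
  have h2 : X ≤ 2 ^ 63 * (M : ℝ≥0∞) ^ 2 + X / 2 := (ENNReal.mul_le_mul_iff_left hY0 hYt).1 h1
  have h3 : X / 2 ≤ 2 ^ 63 * (M : ℝ≥0∞) ^ 2 := by
    have hX2 : X / 2 ≠ ⊤ := ENNReal.div_ne_top hXt two_ne_zero
    nth_rw 1 [← ENNReal.add_halves X] at h2
    exact (ENNReal.add_le_add_iff_right hX2).1 h2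
  calc X = X / 2 + X / 2 := (ENNReal.add_halves X).symm
    _ ≤ 2 ^ 63 * (M : ℝ≥0∞) ^ 2 + 2 ^ 63 * (M : ℝ≥0∞) ^ 2 := by gcongr
    _ = _ := by ring

/-- The lower bound for the norm of `Δ_φ`. -/
theorem BoundedBy.bmoNorm_le {φ : L2 𝕜} {M : ℝ≥0} (h : BoundedBy (1, 1) φ M) :
    bmoNorm φ ≤ 2 ^ 32 * M := by
  classical
  refine bmoNorm_le_of_carleson fun 𝓕 => ?_
  set g : Finset Rect → ℝ≥0∞ := fun s =>
    (volume (⋃ R ∈ s, R.set))⁻¹ * ∑ R ∈ s, ‖coef (0, 0) φ R‖ₑ ^ 2 with hg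
  -- The largest packing ratio inside 𝓕 is finite, whereas `bmoNorm φ` is not known to be. It
  -- replaces that norm in the absorption argument.
  obtain ⟨𝓖, h𝓖, hmax⟩ := Finset.exists_max_image 𝓕.powerset g ⟨∅, Finset.empty_mem_powerset _⟩
  have hsum : ∀ s : Finset Rect, ∑ R ∈ s, ‖coef (0, 0) φ R‖ₑ ^ 2
      = g s * volume (⋃ R ∈ s, R.set) := by
    intro s
    rcases s.eq_empty_or_nonempty with rfl | hs
    · simp
    · rw [hg]
      simp only
      rw [mul_right_comm, ENNReal.inv_mul_cancel (volume_biUnion_ne_zero hs) (measure_ne_top _ _),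
        one_mul]
  have hX : g 𝓖 ≤ 2 ^ 64 * (M : ℝ≥0∞) ^ 2 := by
    rcases 𝓖.eq_empty_or_nonempty with h0 | h𝓖n
    · simp [hg, h0]
    by_cases hX0 : g 𝓖 = 0
    · rw [hX0]
      exact bot_le
    refine h.packing_le h𝓖n hX0 ?_ (hsum 𝓖) fun s hs => ?_
    · exact ENNReal.mul_ne_top (ENNReal.inv_ne_top.2 (volume_biUnion_ne_zero h𝓖n))
        (ENNReal.sum_ne_top.2 fun R _ => ENNReal.pow_ne_top enorm_ne_top)
    · rw [hsum s]
      gcongr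
      exact hmax s (Finset.mem_powerset.2 (hs.trans (Finset.mem_powerset.1 h𝓖)))
  rw [hsum 𝓕]
  calc _ ≤ g 𝓖 * volume (⋃ R ∈ 𝓕, R.set) := by
        gcongr
        exact hmax 𝓕 (Finset.mem_powerset_self _)
    _ ≤ 2 ^ 64 * (M : ℝ≥0∞) ^ 2 * volume (⋃ R ∈ 𝓕, R.set) := by gcongr
    _ = _ := by ring

end

/-! ### From admissible bounds to operator norms -/

section

variable {𝕜 : Type*} [RCLike 𝕜]

lemma paraNorm_le {β : Fin 2 × Fin 2} {φ : L2 𝕜} {M : ℝ≥0} (h : BoundedBy β φ M) :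
    paraNorm β φ ≤ M :=
  iInf₂_le M h

/-- A nonzero constant is needed to pass through the infimum, which is `⊤` when no `C` is
admissible. -/
lemma paraNorm_le_mul_iInf {β : Fin 2 × Fin 2} {φ : L2 𝕜} {P : ℝ≥0 → Prop} {K : ℝ≥0} (hK : K ≠ 0)
    (h : ∀ C, P C → BoundedBy β φ (K * C)) :
    paraNorm β φ ≤ K * ⨅ (C : ℝ≥0) (_ : P C), (C : ℝ≥0∞) := by
  have hK0 : (K : ℝ≥0∞) ≠ 0 := by exact_mod_cast hK
  rw [ENNReal.mul_iInf_of_ne hK0 ENNReal.coe_ne_top]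
  refine le_iInf fun C => ?_
  rw [ENNReal.mul_iInf_of_ne hK0 ENNReal.coe_ne_top]
  refine le_iInf fun hC => ?_
  exact (paraNorm_le (h C hC)).trans (by push_cast; exact le_rfl)

lemma isBoundedOnBMO_one_one_iff (φ : L2 𝕜) : IsBoundedOnBMO (1, 1) φ ↔ bmoNorm φ < ⊤ := by
  constructor
  · rintro ⟨M, hM⟩
    exact hM.bmoNorm_le.trans_lt (ENNReal.mul_lt_top (by simp) ENNReal.coe_lt_top)
  · intro h
    exact ⟨_, boundedBy_one_one (A := (bmoNorm φ).toNNReal) (ENNReal.coe_toNNReal h.ne).ge⟩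

lemma bmoNorm_le_paraNorm (φ : L2 𝕜) : (2 ^ 32)⁻¹ * bmoNorm φ ≤ paraNorm (1, 1) φ := by
  refine le_iInf₂ fun M hM => ?_
  rw [← ENNReal.div_eq_inv_mul]
  exact ENNReal.div_le_of_le_mul' hM.bmoNorm_le

lemma paraNorm_one_one_le (φ : L2 𝕜) : paraNorm (1, 1) φ ≤ 16 * bmoNorm φ := by
  by_cases h : bmoNorm φ = ⊤
  · rw [h, ENNReal.mul_top (by norm_num)]
    exact le_top
  · refine (paraNorm_le (boundedBy_one_one (A := (bmoNorm φ).toNNReal)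
      (ENNReal.coe_toNNReal h).ge)).trans (le_of_eq ?_)
    rw [ENNReal.coe_mul, ENNReal.coe_toNNReal h]
    rfl

end

end BidiscBMO

end

theorem theorem3p2 {𝕜 : Type*} [RCLike 𝕜] :
    ∃ c C : ℝ≥0, 0 < c ∧ 0 < C ∧ ∀ φ : BidiscBMO.L2 𝕜,
      ((BidiscBMO.IsBoundedOnBMO (1, 1) φ ↔ BidiscBMO.bmoNorm φ < ⊤) ∧
        (c : ℝ≥0∞) * BidiscBMO.bmoNorm φ ≤ BidiscBMO.paraNorm (1, 1) φ ∧
        BidiscBMO.paraNorm (1, 1) φ ≤ C * BidiscBMO.bmoNorm φ) ∧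
      (BidiscBMO.MemLMO1 φ →
        BidiscBMO.IsBoundedOnBMO (0, 1) φ ∧
        BidiscBMO.paraNorm (0, 1) φ ≤ C * BidiscBMO.lmo1Norm φ) ∧
      (BidiscBMO.MemLMO2 φ →
        BidiscBMO.IsBoundedOnBMO (1, 0) φ ∧
        BidiscBMO.paraNorm (1, 0) φ ≤ C * BidiscBMO.lmo2Norm φ) := by
  -- The lower constant is the inverse of that in `BoundedBy.bmoNorm_le`. The upper one is the
  -- square root of the 2^26 for mixed paraproducts and exceeds the 16 for `Δ_φ`.
  refine ⟨(2 ^ 32)⁻¹, 2 ^ 13, by positivity, by positivity, fun φ => ⟨⟨?_, ?_, ?_⟩, ?_, ?_⟩⟩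
  · exact BidiscBMO.isBoundedOnBMO_one_one_iff φ
  · refine le_trans (le_of_eq ?_) (BidiscBMO.bmoNorm_le_paraNorm φ)
    rw [ENNReal.coe_inv (by positivity)]
    push_cast
    rfl
  · refine (BidiscBMO.paraNorm_one_one_le φ).trans ?_
    gcongr
    push_cast
    norm_num
  · rintro ⟨C, hC, h⟩
    exact ⟨⟨_, BidiscBMO.boundedBy_zero_one h⟩,
      BidiscBMO.paraNorm_le_mul_iInf (by positivity) fun C hC => BidiscBMO.boundedBy_zero_one hC.2⟩
  · rintro ⟨C, hC, h⟩
    exact ⟨⟨_, BidiscBMO.boundedBy_one_zero h⟩,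
      BidiscBMO.paraNorm_le_mul_iInf (by positivity) fun C hC => BidiscBMO.boundedBy_one_zero hC.2⟩
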